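/- Let $\alpha\in[0,1[$ be irrational, let $\mu$ be the Lebesgue probability measure on $[0,1[\,=\mathbb R/\mathbb Z$, and let $T_\alpha(x)=x+\alpha \bmod 1$. Let $\mathrm{Aut}([0,1[,\mu)$ be the group of $\mu$-preserving Borel bijections of $[0,1[$, modulo equality $\mu$-almost everywhere. For $x,y$ in the same $T_\alpha$-orbit put $d(x,y)=\min\{|k| : k\in\mathbb Z,\ T_\alpha^k(x)=y\}$. The $\mathrm L^1$ full group $[T_\alpha]_1$ is the group of all $S\in\mathrm{Aut}([0,1[,\mu)$ such that $S(x)$ is in the $T_\alpha$-orbit of $x$ for almost every $x$ and $x\mapsto d(x,S(x))$ is integrable; it carries the topology of the metric $\tilde d(S,S')=\int d(S(x),S'(x))\,d\mu(x)$. For a Borel set $A$ with $A\cap T_\alpha(A)=\emptyset$, let $I_{T_\alpha,A}\in[T_\alpha]_1$ be the map equal to $T_\alpha$ on $A$, to $T_\alpha^{-1}$ on $T_\alpha(A)$, and to the identity elsewhere. **Proposition.** (1) For every irrational $\beta\in\,]0,\alpha[$ such that $[0,\beta[\,\cap\, T_\alpha([0,\beta[)=\emptyset$ (that is, $\beta\le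 1-\alpha$), the element $I_{T_\alpha,[0,\beta[}$ has order $2$, and the subgroup generated by $T_\alpha$ and $I_{T_\alpha,[0,\beta[}$ is dense in $[T_\alpha]_1$. (2) The topological rank of $[T_\alpha]_1$, i.e. the least number of elements generating a dense subgroup, is equal to $2$. -/

import Mathlib

open MeasureTheory
open scoped ENNReal

noncomputable section

namespace L1Full

/-! ### Measure-preserving transformations -/

section Aut

variable {X : Type*} [MeasurableSpace X]

/-- The group of bimeasurable bijections of `X` that preserve `μ`; product is composition. -/
def mpPerm (μ : Measure X) : Subgroup (Equiv.Perm X) where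
  carrier := {e | MeasurePreserving e μ μ ∧ MeasurePreserving e.symm μ μ}
  mul_mem' := fun ha hb => ⟨ha.1.comp hb.1, hb.2.comp ha.2⟩
  one_mem' := ⟨MeasurePreserving.id μ, MeasurePreserving.id μ⟩
  inv_mem' := fun ha => ⟨ha.2, ha.1⟩

/-- The transformations that coincide with the identity almost everywhere. -/
def nullPerm (μ : Measure X) : Subgroup (mpPerm μ) where
  carrier := {e | ∀ᵐ x ∂μ, e.1 x = x}
  mul_mem' := fun {a b} ha hb => by
    simp only [Set.mem_ofPred_eq] at *
    filter_upwards [ha, hb] with x h1 h2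
    simp [h1, h2]
  one_mem' := by simp
  inv_mem' := fun {a} ha => by
    simp only [Set.mem_ofPred_eq] at *
    filter_upwards [ha] with x h1
    change a.1.symm x = x
    rw [Equiv.symm_apply_eq, h1]

instance (μ : Measure X) : (nullPerm μ).Normal where
  conj_mem := fun n hn g => by
    have h : ∀ᵐ x ∂μ, n.1 x = x := hn
    have h2 := g.2.2.quasiMeasurePreserving.ae h
    change ∀ᵐ x ∂μ, g.1 (n.1 (g.1.symm x)) = x
    filter_upwards [h2] with x hx
    rw [hx]; simp

/-- `Aut(X, μ)`: measure-preserving transformations modulo almost everywhere equality. -/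
abbrev Aut (μ : Measure X) : Type _ := mpPerm μ ⧸ nullPerm μ

theorem aut_mk_eq_iff {μ : Measure X} (S S' : mpPerm μ) :
    (S : Aut μ) = (S' : Aut μ) ↔ ∀ᵐ x ∂μ, S.1 x = S'.1 x := by
  rw [QuotientGroup.eq]
  change (∀ᵐ x ∂μ, S.1.symm (S'.1 x) = x) ↔ _
  refine ⟨fun h => ?_, fun h => ?_⟩ <;> filter_upwards [h] with x hx
  · rw [Equiv.symm_apply_eq] at hx; exact hx.symm
  · rw [Equiv.symm_apply_eq]; exact hx.symm

end Aut

/-! ### The orbit metric -/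

section Orbit

variable {X : Type*}

/-- The graph distance `min {|k| : k ∈ ℤ, T^k x = y}` on the orbits of `T`; it is `∞` between
points of different orbits. -/
def orbDist (T : Equiv.Perm X) (x y : X) : ℝ≥0∞ :=
  ⨅ (k : ℤ) (_ : (T ^ k) x = y), (k.natAbs : ℝ≥0∞)

theorem orbDist_le (T : Equiv.Perm X) {x y : X} (k : ℤ) (h : (T ^ k) x = y) :
    orbDist T x y ≤ k.natAbs := iInf₂_le k h

theorem orbDist_self (T : Equiv.Perm X) (x : X) : orbDist T x x = 0 := by
  have := orbDist_le T (x := x) (y := x) 0 (by simp)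
  simpa using this

theorem orbDist_comm_le (T : Equiv.Perm X) (x y : X) : orbDist T x y ≤ orbDist T y x := by
  refine le_iInf₂ fun k hk => ?_
  refine (orbDist_le T (-k) ?_).trans (by simp)
  rw [zpow_neg, Equiv.Perm.inv_eq_iff_eq, hk]

theorem orbDist_comm (T : Equiv.Perm X) (x y : X) : orbDist T x y = orbDist T y x :=
  le_antisymm (orbDist_comm_le T x y) (orbDist_comm_le T y x)

theorem orbDist_triangle (T : Equiv.Perm X) (x y z : X) :
    orbDist T x z ≤ orbDist T x y + orbDist T y z := by
  unfold orbDist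
  simp only [ENNReal.iInf_add, ENNReal.add_iInf]
  refine le_iInf₂ fun k hk => le_iInf₂ fun l hl => ?_
  refine (orbDist_le T (k + l) ?_).trans ?_
  · rw [zpow_add, Equiv.Perm.mul_apply, hl, hk]
  · rw [add_comm (l.natAbs : ℝ≥0∞)]
    have := Int.natAbs_add_le k l
    exact_mod_cast this

theorem eq_of_orbDist_eq_zero (T : Equiv.Perm X) {x y : X} (h : orbDist T x y = 0) : x = y := by
  by_contra hne
  have : (1 : ℝ≥0∞) ≤ orbDist T x y := by
    refine le_iInf₂ fun k hk => ?_
    have hk0 : k ≠ 0 := by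
      rintro rfl
      exact hne (by simpa using hk)
    have : 1 ≤ k.natAbs := Nat.one_le_iff_ne_zero.2 (by simpa using hk0)
    exact_mod_cast this
  simp [h] at this

open Classical in
/-- The map equal to `T` on `A`, to `T⁻¹` on `T(A)` and to the identity elsewhere. -/
def swapFun (T : Equiv.Perm X) (A : Set X) (x : X) : X :=
  if x ∈ A then T x else if x ∈ T '' A then T.symm x else x

theorem swapFun_invol (T : Equiv.Perm X) {A : Set X} (hA : Disjoint A (T '' A)) :
    Function.Involutive (swapFun T A) := by
  classical
  intro x
  by_cases h1 : x ∈ A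
  · have h2 : T x ∈ T '' A := ⟨x, h1, rfl⟩
    have h3 : T x ∉ A := fun h => Set.disjoint_left.1 hA h h2
    simp only [swapFun, h1, if_true, h2, h3, if_false, Equiv.symm_apply_apply]
  · by_cases h2 : x ∈ T '' A
    · obtain ⟨y, hy, rfl⟩ := h2
      have h2 : T y ∈ T '' A := ⟨y, hy, rfl⟩
      simp only [swapFun, h1, h2, if_true, if_false, Equiv.symm_apply_apply, hy]
    · simp only [swapFun, h1, h2, if_false]

end Orbit

section FullGroup

variable {X : Type*} [MeasurableSpace X] {μ : Measure X}

theorem measurable_zpow (T : mpPerm μ) (k : ℤ) : Measurable ((T.1 ^ k : Equiv.Perm X)) :=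
  ((T ^ k).2.1).measurable

theorem measurable_orbDist [MeasurableEq X] (T : mpPerm μ) {f g : X → X} (hf : Measurable f) (hg : Measurable g) :
    Measurable fun x => orbDist T.1 (f x) (g x) := by
  classical
  unfold orbDist
  refine Measurable.iInf fun k => ?_
  have hs : MeasurableSet {x | (T.1 ^ k) (f x) = g x} :=
    measurableSet_eq_fun ((measurable_zpow T k).comp hf) hg
  have : (fun x => ⨅ (_ : (T.1 ^ k) (f x) = g x), ((k.natAbs : ℕ) : ℝ≥0∞)) =
      fun x => if (T.1 ^ k) (f x) = g x then ((k.natAbs : ℕ) : ℝ≥0∞) else ⊤ := by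
    funext x
    split_ifs with h <;> simp [h]
  rw [this]
  exact Measurable.ite hs measurable_const measurable_const

/-- `∫ d_T(S x, S' x) dμ(x)`, where `d_T` is the graph distance on the orbits of `T`. -/
def l1Dist (T : mpPerm μ) (S S' : Aut μ) : ℝ≥0∞ :=
  Quotient.liftOn₂ S S' (fun s s' : mpPerm μ => ∫⁻ x, orbDist T.1 (s.1 x) (s'.1 x) ∂μ) <| by
    intro a b a' b' h h'
    have h1 := (aut_mk_eq_iff a a').1 (Quotient.sound h)
    have h2 := (aut_mk_eq_iff b b').1 (Quotient.sound h')
    refine lintegral_congr_ae ?_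
    filter_upwards [h1, h2] with x e1 e2
    rw [e1, e2]

theorem l1Dist_mk (T s s' : mpPerm μ) :
    l1Dist T (s : Aut μ) (s' : Aut μ) = ∫⁻ x, orbDist T.1 (s.1 x) (s'.1 x) ∂μ := rfl

theorem l1Dist_self (T : mpPerm μ) (S : Aut μ) : l1Dist T S S = 0 := by
  induction S using QuotientGroup.induction_on with
  | H s => simp [l1Dist_mk, orbDist_self]

theorem l1Dist_comm (T : mpPerm μ) (S S' : Aut μ) : l1Dist T S S' = l1Dist T S' S := by
  induction S using QuotientGroup.induction_on with
  | H s =>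
    induction S' using QuotientGroup.induction_on with
    | H s' => simp only [l1Dist_mk, orbDist_comm]

theorem l1Dist_triangle [MeasurableEq X] (T : mpPerm μ) (S S' S'' : Aut μ) :
    l1Dist T S S'' ≤ l1Dist T S S' + l1Dist T S' S'' := by
  induction S using QuotientGroup.induction_on with
  | H s =>
    induction S' using QuotientGroup.induction_on with
    | H s' =>
      induction S'' using QuotientGroup.induction_on with
      | H s'' =>
        simp only [l1Dist_mk]
        rw [← lintegral_add_left
          (measurable_orbDist T s.2.1.measurable s'.2.1.measurable)]
        exact lintegral_mono fun x => orbDist_triangle _ _ _ _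

theorem eq_of_l1Dist_eq_zero [MeasurableEq X] (T : mpPerm μ) {S S' : Aut μ} (h : l1Dist T S S' = 0) : S = S' := by
  induction S using QuotientGroup.induction_on with
  | H s =>
    induction S' using QuotientGroup.induction_on with
    | H s' =>
      rw [l1Dist_mk, lintegral_eq_zero_iff
        (measurable_orbDist T s.2.1.measurable s'.2.1.measurable)] at h
      rw [aut_mk_eq_iff]
      filter_upwards [h] with x hx
      exact eq_of_orbDist_eq_zero _ hx

theorem l1Dist_mul_right [MeasurableEq X] (T : mpPerm μ) (S S' R : Aut μ) :
    l1Dist T (S * R) (S' * R) = l1Dist T S S' := by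
  induction S using QuotientGroup.induction_on with
  | H s =>
    induction S' using QuotientGroup.induction_on with
    | H s' =>
      induction R using QuotientGroup.induction_on with
      | H r =>
        rw [← QuotientGroup.mk_mul, ← QuotientGroup.mk_mul, l1Dist_mk, l1Dist_mk]
        exact r.2.1.lintegral_comp
          (measurable_orbDist T s.2.1.measurable s'.2.1.measurable)

/-- The full group `[T]`: all `S ∈ Aut(X, μ)` with `S x` in the `T`-orbit of `x` for almost
every `x`. -/
def fullGroup (T : mpPerm μ) : Subgroup (Aut μ) :=
  Subgroup.map (QuotientGroup.mk' (nullPerm μ))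
    { carrier := {s : mpPerm μ | ∀ᵐ x ∂μ, ∃ k : ℤ, s.1 x = (T.1 ^ k) x}
      mul_mem' := fun {a b} ha hb => by
        have ha' := b.2.1.quasiMeasurePreserving.ae ha
        simp only [Set.mem_ofPred_eq] at *
        filter_upwards [ha', hb] with x ⟨k, hk⟩ ⟨l, hl⟩
        refine ⟨k + l, ?_⟩
        rw [zpow_add, Equiv.Perm.mul_apply, ← hl, ← hk]
        rfl
      one_mem' := by
        change ∀ᵐ x ∂μ, ∃ k : ℤ, x = (T.1 ^ k) x
        exact Filter.Eventually.of_forall fun x => ⟨0, by simp⟩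
      inv_mem' := fun {a} ha => by
        have ha' := a.2.2.quasiMeasurePreserving.ae ha
        simp only [Set.mem_ofPred_eq] at *
        filter_upwards [ha'] with x ⟨k, hk⟩
        refine ⟨-k, ?_⟩
        rw [zpow_neg, eq_comm, Equiv.Perm.inv_eq_iff_eq]
        rw [Equiv.apply_symm_apply] at hk
        exact hk }

/-- The `L¹` full group `[T]₁`: all `S ∈ [T]` such that `x ↦ d_T(x, S x)` is integrable. -/
def l1FullGroup [MeasurableEq X] (T : mpPerm μ) : Subgroup (Aut μ) where
  carrier := {S | S ∈ fullGroup T ∧ l1Dist T 1 S < ∞}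
  mul_mem' := fun {a b} ha hb => by
    refine ⟨mul_mem ha.1 hb.1, (l1Dist_triangle T 1 b (a * b)).trans_lt ?_⟩
    have h := l1Dist_mul_right T 1 a b
    rw [one_mul] at h
    rw [h]
    exact ENNReal.add_lt_top.2 ⟨hb.2, ha.2⟩
  one_mem' := ⟨one_mem _, by simp [l1Dist_self]⟩
  inv_mem' := fun {a} ha => by
    refine ⟨inv_mem ha.1, ?_⟩
    have h := l1Dist_mul_right T 1 a⁻¹ a
    rw [one_mul, inv_mul_cancel, l1Dist_comm] at h
    rw [← h]
    exact ha.2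

/-- `[T]₁` carries the metric `(S, S') ↦ ∫ d_T(S x, S' x) dμ(x)` and its topology. -/
instance [MeasurableEq X] (T : mpPerm μ) : EMetricSpace (l1FullGroup T) where
  edist S S' := l1Dist T S.1 S'.1
  edist_self S := l1Dist_self T S.1
  edist_comm S S' := l1Dist_comm T S.1 S'.1
  edist_triangle S S' S'' := l1Dist_triangle T S.1 S'.1 S''.1
  eq_of_edist_eq_zero h := Subtype.ext (eq_of_l1Dist_eq_zero T h)

/-- Any transformation moving points by at most one step along the orbits of `T` lies in `[T]₁`. -/
theorem mem_l1FullGroup_of_step [MeasurableEq X] [IsFiniteMeasure μ] (T s : mpPerm μ)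
    (h : ∀ x, ∃ k : ℤ, k.natAbs ≤ 1 ∧ s.1 x = (T.1 ^ k) x) :
    (s : Aut μ) ∈ l1FullGroup T := by
  refine ⟨⟨s, ?_, rfl⟩, ?_⟩
  · change ∀ᵐ x ∂μ, ∃ k : ℤ, s.1 x = (T.1 ^ k) x
    refine Filter.Eventually.of_forall fun x => ?_
    obtain ⟨k, -, hk⟩ := h x
    exact ⟨k, hk⟩
  · have : l1Dist T 1 (s : Aut μ) ≤ ∫⁻ _ : X, 1 ∂μ := by
      rw [← QuotientGroup.mk_one, l1Dist_mk]
      refine lintegral_mono fun x => ?_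
      obtain ⟨k, hk1, hk⟩ := h x
      refine (orbDist_le T.1 k hk.symm).trans ?_
      exact_mod_cast hk1
    refine this.trans_lt ?_
    simp

/-- `T` as an element of `[T]₁`. -/
def l1Self [MeasurableEq X] [IsFiniteMeasure μ] (T : mpPerm μ) : l1FullGroup T :=
  ⟨(T : Aut μ), mem_l1FullGroup_of_step T T fun x => ⟨1, by simp, by simp⟩⟩

/-! ### The involutions `I_{T,A}` -/

theorem swapFun_measurable (T : mpPerm μ) {A : Set X} (hA : MeasurableSet A) :
    Measurable (swapFun T.1 A) := by
  classical
  have hTA : MeasurableSet (T.1 '' A) := by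
    rw [Equiv.image_eq_preimage_symm]
    exact T.2.2.measurable hA
  exact Measurable.ite hA T.2.1.measurable (Measurable.ite hTA T.2.2.measurable measurable_id)

theorem swapFun_measurePreserving (T : mpPerm μ) {A : Set X} (hA : MeasurableSet A)
    (hd : Disjoint A (T.1 '' A)) : MeasurePreserving (swapFun T.1 A) μ μ := by
  classical
  have hTA : MeasurableSet (T.1 '' A) := by
    rw [Equiv.image_eq_preimage_symm]
    exact T.2.2.measurable hA
  refine ⟨swapFun_measurable T hA, ?_⟩
  ext B hB
  have hm := swapFun_measurable T hA
  rw [Measure.map_apply hm hB]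
  have split : ∀ C : Set X, μ C = μ (C ∩ A) + (μ ((C \ A) ∩ T.1 '' A) + μ ((C \ A) \ T.1 '' A)) := by
    intro C
    rw [measure_inter_add_sdiff _ hTA, measure_inter_add_sdiff _ hA]
  rw [split (swapFun T.1 A ⁻¹' B), split B]
  have e1 : (swapFun T.1 A ⁻¹' B) ∩ A = T.1 ⁻¹' ((B \ A) ∩ T.1 '' A) := by
    ext x
    simp only [Set.mem_inter_iff, Set.mem_preimage, Set.mem_sdiff, T.1.injective.mem_set_image]
    constructor
    · rintro ⟨hx, hxA⟩
      have : T.1 x ∉ A := fun h => Set.disjoint_left.1 hd h ⟨x, hxA, rfl⟩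
      simp only [swapFun, hxA, if_true] at hx
      exact ⟨⟨hx, this⟩, hxA⟩
    · rintro ⟨⟨hx, -⟩, hxA⟩
      simp only [swapFun, hxA, if_true]
      exact ⟨hx, trivial⟩
  have e2 : ((swapFun T.1 A ⁻¹' B) \ A) ∩ T.1 '' A = T.1.symm ⁻¹' (B ∩ A) := by
    ext x
    simp only [Set.mem_inter_iff, Set.mem_preimage, Set.mem_sdiff, Equiv.image_eq_preimage_symm]
    constructor
    · rintro ⟨⟨hx, hxA⟩, hxT⟩
      have h2 : x ∈ T.1 '' A := by rw [Equiv.image_eq_preimage_symm]; exact hxT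
      simp only [swapFun, hxA, h2, if_true, if_false] at hx
      exact ⟨hx, hxT⟩
    · rintro ⟨hx, hxT⟩
      have h2 : x ∈ T.1 '' A := by rw [Equiv.image_eq_preimage_symm]; exact hxT
      have hxA : x ∉ A := fun h => Set.disjoint_left.1 hd h h2
      refine ⟨⟨?_, hxA⟩, hxT⟩
      simp only [swapFun, hxA, h2, if_true, if_false]
      exact hx
  have e3 : ((swapFun T.1 A ⁻¹' B) \ A) \ T.1 '' A = (B \ A) \ T.1 '' A := by
    ext x
    simp only [Set.mem_preimage, Set.mem_sdiff]
    constructor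
    · rintro ⟨⟨hx, hxA⟩, hxT⟩
      simp only [swapFun, hxA, hxT, if_false] at hx
      exact ⟨⟨hx, hxA⟩, hxT⟩
    · rintro ⟨⟨hx, hxA⟩, hxT⟩
      refine ⟨⟨?_, hxA⟩, hxT⟩
      simp only [swapFun, hxA, hxT, if_false]
      exact hx
  rw [e1, e2, e3, T.2.1.measure_preimage ((hB.diff hA).inter hTA).nullMeasurableSet,
    T.2.2.measure_preimage (hB.inter hA).nullMeasurableSet]
  ring

/-- The involution `I_{T,A}` of `X`, for measurable `A` disjoint from `T(A)`. -/
def involution (T : mpPerm μ) (A : Set X) (hA : MeasurableSet A) (hd : Disjoint A (T.1 '' A)) :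
    mpPerm μ :=
  ⟨(swapFun_invol T.1 hd).toPerm, swapFun_measurePreserving T hA hd,
    swapFun_measurePreserving T hA hd⟩

/-- `I_{T,A}` as an element of `[T]₁`. -/
def l1Involution [MeasurableEq X] [IsFiniteMeasure μ] (T : mpPerm μ) (A : Set X) (hA : MeasurableSet A)
    (hd : Disjoint A (T.1 '' A)) : l1FullGroup T :=
  ⟨(involution T A hA hd : Aut μ), mem_l1FullGroup_of_step T _ fun x => by
    classical
    change ∃ k : ℤ, k.natAbs ≤ 1 ∧ swapFun T.1 A x = (T.1 ^ k) x
    by_cases h1 : x ∈ A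
    · exact ⟨1, by simp, by simp [swapFun, h1]⟩
    · by_cases h2 : x ∈ T.1 '' A
      · refine ⟨-1, by simp, ?_⟩
        simp only [swapFun, h1, h2, if_true, if_false, zpow_neg, zpow_one]
        rfl
      · refine ⟨0, by simp, ?_⟩
        simp only [swapFun, h1, h2, if_false, zpow_zero, Equiv.Perm.one_apply]⟩

end FullGroup

/-! ### Topological rank -/

/-- The topological rank of `G`: the least number of elements generating a dense subgroup
(`⊤` if no finite set does). -/
def topologicalRank (G : Type*) [Group G] [TopologicalSpace G] : ℕ∞ :=
  ⨅ (s : Set G) (_ : Dense (Subgroup.closure s : Set G)), s.encard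

/-! ### Rotations of the circle `ℝ/ℤ = [0,1[` with its Lebesgue probability measure -/

/-- The rotation `x ↦ α + x` modulo `1`. -/
def rotation (α : ℝ) : mpPerm (volume : Measure UnitAddCircle) :=
  ⟨Equiv.addLeft (α : UnitAddCircle), measurePreserving_add_left volume (α : UnitAddCircle),
    measurePreserving_add_left volume (-(α : UnitAddCircle))⟩

/-- The arc `[0,β[` of the circle. -/
def arc (β : ℝ) : Set UnitAddCircle := (fun t : ℝ => (t : UnitAddCircle)) '' Set.Ico 0 β

theorem measurableSet_arc (β : ℝ) : MeasurableSet (arc β) := by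
  by_cases hβ : 0 < β
  · rw [arc, ← Set.Ioo_insert_left hβ, Set.image_insert_eq]
    refine MeasurableSet.insert ?_ _
    exact (QuotientAddGroup.isOpenMap_coe _ isOpen_Ioo).measurableSet
  · rw [arc, Set.Ico_eq_empty hβ, Set.image_empty]
    exact MeasurableSet.empty

end L1Full

end

/-! Write `T` for the rotation and call a map bounded if it moves every point by at most some fixed
number of steps along its orbit. The L¹ metric is right invariant, and left multiplication by a map
of at most `M` steps is `(2M+1)`-Lipschitz. So the bounded maps that are limits of bounded elements
of a group `H` form a group, closed under limits among bounded maps (`approxGroup`). Let `K` be this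
group for `H` generated by `T` and the involution of `[0,β[`.

Short 3-cycles lie in `K`. Let `I_p` be the involution of the short arc `[p,p+ε[`. Conjugating by
powers of `T`, and using the density of the multiples of `α`, puts the involutions of all translates
of `[0,β[` in `K`. In the product of those of `[0,β[` and `[ε,β+ε[` the overlap cancels, which
leaves `I_p I_{β+p}`. Short involutions commute unless their positions differ by `±α`. Hence for `c
= ±α` the two middle factors of `(I_0 I_β)(I_{c-β} I_c)` commute with everything, and squaring
removes them: `(I_0 I_c)²` lies in `K`. Since `I_0 I_α` has cube 1, it is a power of its square. The
coincidences that break the argument cannot occur for both signs of `c`, because `α` is irrational;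
the case `β = -α` is immediate. A π-λ argument then gives the 3-cycles `(E, TE, T²E)` for all
measurable `E` in a short arc.

Such 3-cycles suffice (`exists_mem_l1Dist_lt`). A short arc `B` is visited with bounded gaps, so the
space is cut into finitely many types of columns over `B`. Conjugates of the 3-cycles by powers of
`T` give every permutation of the levels up to exchanging the two lowest ones, an error of at most
`2μ(B)`. Now let `S` have integrable displacement `c`. The net number of points that `S` carries
across a cut of an orbit is constant along the orbit, hence constant by ergodicity, and composing
with a power of `T` makes it zero. Keep `S` where it stays inside a column, and let `D` be the rest.
Complete `S` to a permutation of each column by the monotone matching of the points that leave with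
the levels not attained. Because the flow is zero, the new arrows on `D` cross each cut at most as
often as the old ones; integrating the number of crossings gives the total displacement, so the
error is at most `2∫_D |c|`, and this is small when `μ(B)` is.

The rank is at most 2 by the density. If the powers of one element were dense, all bounded elements
would commute, but `T` and the involution of an arc do not. -/

noncomputable section

namespace L1Full

/-! ### Free orbits -/

section FreeOrbit

variable {X : Type*}

/-- The orbits of `T` are infinite. -/
def IsFree (T : Equiv.Perm X) : Prop := ∀ (x : X) (n : ℤ), (T ^ n) x = x → n = 0

theorem IsFree.zpow_inj {T : Equiv.Perm X} (h : IsFree T) {x : X} {m n : ℤ}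
    (e : (T ^ m) x = (T ^ n) x) : m = n := by
  have : (T ^ (m - n)) x = x := by
    rw [sub_eq_neg_add, zpow_add, Equiv.Perm.mul_apply, e, ← Equiv.Perm.mul_apply, ← zpow_add,
      neg_add_cancel, zpow_zero, Equiv.Perm.one_apply]
  have := h x _ this
  omega

theorem IsFree.orbDist_zpow {T : Equiv.Perm X} (h : IsFree T) (x : X) (k : ℤ) :
    orbDist T x ((T ^ k) x) = k.natAbs := by
  refine le_antisymm (orbDist_le T k rfl) (le_iInf₂ fun l hl => ?_)
  rw [h.zpow_inj hl]

theorem zpow_add_apply (T : Equiv.Perm X) (m n : ℤ) (x : X) :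
    (T ^ (m + n)) x = (T ^ m) ((T ^ n) x) := by
  rw [zpow_add, Equiv.Perm.mul_apply]

end FreeOrbit

/-! ### Bounded transformations and limits of a subgroup -/

section Bounded

variable {X : Type*} [MeasurableSpace X] {μ : Measure X}

/-- `s` moves every point by at most `M` steps along its `T`-orbit. -/
def StepBounded (T s : mpPerm μ) (M : ℕ) : Prop :=
  ∀ x, ∃ k : ℤ, k.natAbs ≤ M ∧ s.1 x = (T.1 ^ k) x

theorem StepBounded.one (T : mpPerm μ) : StepBounded T 1 0 := fun x => ⟨0, by simp, by simp⟩

theorem StepBounded.self (T : mpPerm μ) : StepBounded T T 1 := fun x => ⟨1, by simp, by simp⟩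

theorem StepBounded.mul {T a b : mpPerm μ} {M N : ℕ} (ha : StepBounded T a M)
    (hb : StepBounded T b N) : StepBounded T (a * b) (M + N) := fun x => by
  obtain ⟨l, hl, el⟩ := hb x
  obtain ⟨k, hk, ek⟩ := ha (b.1 x)
  refine ⟨k + l, by omega, ?_⟩
  change a.1 (b.1 x) = _
  rw [zpow_add_apply, ek, el]

theorem StepBounded.inv {T a : mpPerm μ} {M : ℕ} (ha : StepBounded T a M) :
    StepBounded T a⁻¹ M := fun x => by
  obtain ⟨k, hk, ek⟩ := ha (a.1.symm x)
  refine ⟨-k, by omega, ?_⟩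
  change a.1.symm x = _
  rw [Equiv.apply_symm_apply] at ek
  rw [zpow_neg, eq_comm, Equiv.Perm.inv_eq_iff_eq, ← ek]

/-- A distance changes by at most `2M`, and distinct points of an orbit are at distance at least 1,
so the additive error can be absorbed in a multiplicative constant. -/
theorem StepBounded.orbDist_le {T s : mpPerm μ} {M : ℕ} (hs : StepBounded T s M) (x y : X) :
    orbDist T.1 (s.1 x) (s.1 y) ≤ (2 * M + 1 : ℕ) * orbDist T.1 x y := by
  have key : ∀ k : ℤ, (T.1 ^ k) x = y →
      orbDist T.1 (s.1 x) (s.1 y) ≤ (2 * M + 1 : ℕ) * (k.natAbs : ℝ≥0∞) := by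
    intro k hk
    by_cases hk0 : k = 0
    · subst hk0
      simp only [zpow_zero, Equiv.Perm.one_apply] at hk
      simp [hk, orbDist_self]
    obtain ⟨l, hl, el⟩ := hs x
    obtain ⟨m, hm, em⟩ := hs y
    refine (L1Full.orbDist_le T.1 (m + k - l) ?_).trans ?_
    · rw [el, ← zpow_add_apply, em, ← hk, ← zpow_add_apply]
      congr 2
      ring
    · have h1 : 1 ≤ k.natAbs := by omega
      have h2 : (m + k - l).natAbs ≤ k.natAbs + 2 * M := by omega
      have h3 : (m + k - l).natAbs ≤ (2 * M + 1) * k.natAbs := by nlinarith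
      exact_mod_cast h3
  conv_rhs => unfold orbDist
  have h0 : ((2 * M + 1 : ℕ) : ℝ≥0∞) ≠ 0 := by simp
  have ht : ((2 * M + 1 : ℕ) : ℝ≥0∞) ≠ ⊤ := ENNReal.natCast_ne_top _
  rw [ENNReal.mul_iInf_of_ne h0 ht]
  refine le_iInf fun k => ?_
  rw [ENNReal.mul_iInf_of_ne h0 ht]
  exact le_iInf fun hk => key k hk

/-- The metric is invariant only on the right. This Lipschitz bound replaces left invariance and is
the reason why boundedness is carried along throughout. -/
theorem l1Dist_mul_left_le {T s : mpPerm μ} {M : ℕ} (hs : StepBounded T s M) (a b : Aut μ) :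
    l1Dist T (s * a) (s * b) ≤ (2 * M + 1 : ℕ) * l1Dist T a b := by
  induction a using QuotientGroup.induction_on with
  | H a =>
    induction b using QuotientGroup.induction_on with
    | H b =>
      rw [← QuotientGroup.mk_mul, ← QuotientGroup.mk_mul, l1Dist_mk, l1Dist_mk,
        ← lintegral_const_mul' _ _ (ENNReal.natCast_ne_top _)]
      exact lintegral_mono fun x => hs.orbDist_le _ _

variable [MeasurableEq X]

/-- The bounded transformations that are limits, for the `L¹` metric, of bounded elements
of `H`. -/
def approxGroup (T : mpPerm μ) (H : Subgroup (mpPerm μ)) : Subgroup (mpPerm μ) where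
  carrier := {s | (∃ M, StepBounded T s M) ∧ ∀ ε : ℝ≥0∞, 0 < ε →
    ∃ h ∈ H, (∃ M, StepBounded T h M) ∧ l1Dist T (s : Aut μ) (h : Aut μ) < ε}
  one_mem' := ⟨⟨0, .one T⟩, fun ε hε => ⟨1, one_mem _, ⟨0, .one T⟩, by rwa [l1Dist_self]⟩⟩
  mul_mem' := by
    rintro a b ⟨⟨M, ha⟩, ha'⟩ ⟨⟨N, hb⟩, hb'⟩
    refine ⟨⟨_, ha.mul hb⟩, fun ε hε => ?_⟩
    obtain ⟨g, hg, ⟨L, hgL⟩, hag⟩ := ha' (ε / 2) (ENNReal.half_pos hε.ne')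
    -- The precision for `b` is chosen after the approximant `g` of `a`, since it is the bound `L`
    -- of `g` that enters the Lipschitz constant.
    obtain ⟨h, hh, ⟨L', hhL⟩, hbh⟩ := hb' (ε / 2 / (2 * L + 1 : ℕ))
      (ENNReal.div_pos (ENNReal.half_pos hε.ne').ne' (ENNReal.natCast_ne_top _))
    refine ⟨g * h, mul_mem hg hh, ⟨_, hgL.mul hhL⟩, ?_⟩
    simp only [QuotientGroup.mk_mul]
    refine (l1Dist_triangle T _ (g * b) _).trans_lt ?_
    rw [l1Dist_mul_right, ← ENNReal.add_halves ε]
    refine ENNReal.add_lt_add hag ((l1Dist_mul_left_le hgL _ _).trans_lt ?_)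
    rw [mul_comm]
    exact ENNReal.mul_lt_of_lt_div hbh
  inv_mem' := by
    rintro a ⟨⟨M, ha⟩, ha'⟩
    refine ⟨⟨_, ha.inv⟩, fun ε hε => ?_⟩
    obtain ⟨h, hh, ⟨L', hhL⟩, hbh⟩ := ha' (ε / (2 * M + 1 : ℕ))
      (ENNReal.div_pos hε.ne' (ENNReal.natCast_ne_top _))
    refine ⟨h⁻¹, inv_mem hh, ⟨_, hhL.inv⟩, ?_⟩
    -- By right invariance the distance of the inverses is that of `a⁻¹h` and `1 = a⁻¹a`, to which
    -- the Lipschitz bound for `a⁻¹` applies.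
    rw [← l1Dist_mul_right T _ _ (h : Aut μ), l1Dist_comm]
    have := l1Dist_mul_left_le ha.inv (a : Aut μ) (h : Aut μ)
    simp only [QuotientGroup.mk_inv, inv_mul_cancel] at this ⊢
    refine this.trans_lt ?_
    rw [mul_comm]
    exact ENNReal.mul_lt_of_lt_div hbh

theorem mem_approxGroup_of_mem {T : mpPerm μ} {H : Subgroup (mpPerm μ)} {s : mpPerm μ}
    (hs : s ∈ H) {M : ℕ} (hM : StepBounded T s M) : s ∈ approxGroup T H :=
  ⟨⟨M, hM⟩, fun ε hε => ⟨s, hs, ⟨M, hM⟩, by rwa [l1Dist_self]⟩⟩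

theorem mem_approxGroup_of_approx {T : mpPerm μ} {H : Subgroup (mpPerm μ)} {s : mpPerm μ}
    {M : ℕ} (hM : StepBounded T s M)
    (hs : ∀ ε : ℝ≥0∞, 0 < ε → ∃ g ∈ approxGroup T H, l1Dist T (s : Aut μ) (g : Aut μ) < ε) :
    s ∈ approxGroup T H := by
  refine ⟨⟨M, hM⟩, fun ε hε => ?_⟩
  obtain ⟨g, hg, hsg⟩ := hs (ε / 2) (ENNReal.half_pos hε.ne')
  obtain ⟨h, hh, hb, hgh⟩ := hg.2 (ε / 2) (ENNReal.half_pos hε.ne')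
  refine ⟨h, hh, hb, (l1Dist_triangle T _ (g : Aut μ) _).trans_lt ?_⟩
  rw [← ENNReal.add_halves ε]
  exact ENNReal.add_lt_add hsg hgh

end Bounded

/-! ### Calculus of the involutions -/

section Swap

variable {X : Type*} [MeasurableSpace X] {μ : Measure X}

/-- `A` is measurable and disjoint from `T(A)`, so that `I_{T,A}` makes sense. -/
def Swappable (T : mpPerm μ) (A : Set X) : Prop := MeasurableSet A ∧ Disjoint A (T.1 '' A)

open Classical in
/-- The involution `I_{T,A}`, or the identity if `A` meets `T(A)`. -/
def swapInv (T : mpPerm μ) (A : Set X) : mpPerm μ :=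
  if h : Swappable T A then involution T A h.1 h.2 else 1

theorem swapInv_of {T : mpPerm μ} {A : Set X} (h : Swappable T A) :
    swapInv T A = involution T A h.1 h.2 := dif_pos h

theorem swapInv_apply {T : mpPerm μ} {A : Set X} (h : Swappable T A) (x : X) :
    (swapInv T A).1 x = swapFun T.1 A x := by rw [swapInv_of h]; rfl

theorem Swappable.mono {T : mpPerm μ} {A B : Set X} (h : Swappable T B) (hA : MeasurableSet A)
    (hAB : A ⊆ B) : Swappable T A := ⟨hA, h.2.mono hAB (Set.image_mono hAB)⟩

theorem swapInv_apply_mem {T : mpPerm μ} {A : Set X} (h : Swappable T A) {x : X} (hx : x ∈ A) :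
    (swapInv T A).1 x = T.1 x := by
  rw [swapInv_apply h, swapFun, if_pos hx]

theorem swapInv_apply_image {T : mpPerm μ} {A : Set X} (h : Swappable T A) {x : X} (hx : x ∈ A) :
    (swapInv T A).1 (T.1 x) = x := by
  have h2 : T.1 x ∈ T.1 '' A := ⟨x, hx, rfl⟩
  have h1 : T.1 x ∉ A := fun h1 => Set.disjoint_left.1 h.2 h1 h2
  rw [swapInv_apply h, swapFun, if_neg h1, if_pos h2, Equiv.symm_apply_apply]

theorem swapInv_apply_notMem {T : mpPerm μ} {A : Set X} (h : Swappable T A) {x : X} (hx : x ∉ A)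
    (hx' : x ∉ T.1 '' A) : (swapInv T A).1 x = x := by
  rw [swapInv_apply h, swapFun, if_neg hx, if_neg hx']

theorem swapInv_mul_self (T : mpPerm μ) (A : Set X) : swapInv T A * swapInv T A = 1 := by
  by_cases h : Swappable T A
  · apply Subtype.ext
    ext x
    change (swapInv T A).1 ((swapInv T A).1 x) = x
    rw [swapInv_apply h, swapInv_apply h]
    exact swapFun_invol T.1 h.2 x
  · rw [swapInv, dif_neg h, one_mul]

theorem swapInv_stepBounded (T : mpPerm μ) (A : Set X) : StepBounded T (swapInv T A) 1 := by
  by_cases h : Swappable T A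
  · intro x
    by_cases h1 : x ∈ A
    · exact ⟨1, by simp, by simp [swapInv_apply_mem h h1]⟩
    · by_cases h2 : x ∈ T.1 '' A
      · obtain ⟨y, hy, rfl⟩ := h2
        exact ⟨-1, by simp, by simp [swapInv_apply_image h hy]⟩
      · exact ⟨0, by simp, by simp [swapInv_apply_notMem h h1 h2]⟩
  · rw [swapInv, dif_neg h]
    exact fun x => ⟨0, by simp, by simp⟩

theorem swapInv_empty (T : mpPerm μ) : swapInv T ∅ = 1 := by
  have h : Swappable T ∅ := ⟨MeasurableSet.empty, by simp⟩
  apply Subtype.ext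
  ext x
  rw [swapInv_apply_notMem h (by simp) (by simp)]
  rfl

theorem measurableSet_image (T : mpPerm μ) {A : Set X} (hA : MeasurableSet A) :
    MeasurableSet (T.1 '' A) := by
  rw [Equiv.image_eq_preimage_symm]
  exact T.2.2.measurable hA

theorem measure_image (T : mpPerm μ) {A : Set X} (hA : MeasurableSet A) :
    μ (T.1 '' A) = μ A := by
  rw [Equiv.image_eq_preimage_symm]
  exact T.2.2.measure_preimage hA.nullMeasurableSet

theorem Swappable.image {T : mpPerm μ} {A : Set X} (h : Swappable T A) {g : mpPerm μ}
    (hg : Commute g T) : Swappable T (g.1 '' A) := by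
  refine ⟨measurableSet_image g h.1, ?_⟩
  have : T.1 '' (g.1 '' A) = g.1 '' (T.1 '' A) := by
    have e : g.1 * T.1 = T.1 * g.1 := congrArg Subtype.val hg.eq
    simp only [Set.image_image]
    refine Set.image_congr fun x _ => ?_
    exact (congrArg (fun p : Equiv.Perm X => p x) e).symm
  rw [this]
  exact (Set.disjoint_image_iff g.1.injective).2 h.2

/-- No assumption on `A` is needed: `A` and its image under `g` are swappable together, and
otherwise both involutions are 1 by convention. -/
theorem conj_swapInv {T g : mpPerm μ} (hg : Commute g T) (A : Set X) :
    g * swapInv T A * g⁻¹ = swapInv T (g.1 '' A) := by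
  by_cases h : Swappable T A
  · have h' := h.image hg
    rw [mul_inv_eq_iff_eq_mul]
    apply Subtype.ext
    ext x
    change g.1 ((swapInv T A).1 x) = (swapInv T (g.1 '' A)).1 (g.1 x)
    have e : ∀ x, g.1 (T.1 x) = T.1 (g.1 x) := fun x =>
      congrArg (fun p : mpPerm μ => p.1 x) hg.eq
    by_cases h1 : x ∈ A
    · rw [swapInv_apply_mem h h1, swapInv_apply_mem h' ⟨x, h1, rfl⟩, e]
    · by_cases h2 : x ∈ T.1 '' A
      · obtain ⟨y, hy, rfl⟩ := h2
        rw [swapInv_apply_image h hy, e, swapInv_apply_image h' ⟨y, hy, rfl⟩]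
      · rw [swapInv_apply_notMem h h1 h2, swapInv_apply_notMem h']
        · rwa [g.1.injective.mem_set_image]
        · rintro ⟨_, ⟨y, hy, rfl⟩, hy'⟩
          rw [← e, g.1.injective.eq_iff] at hy'
          exact h2 ⟨y, hy, hy'⟩
  · have h' : ¬ Swappable T (g.1 '' A) := by
      intro h'
      apply h
      have := h'.image (g := g⁻¹) hg.inv_left
      have e : (g⁻¹).1 '' (g.1 '' A) = A := by
        rw [Set.image_image]
        change (fun x => g.1.symm (g.1 x)) '' A = A
        simp
      rwa [e] at this
    rw [swapInv, swapInv, dif_neg h, dif_neg h', mul_one, mul_inv_cancel]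

/-- Involutions whose supports are disjoint commute. -/
theorem commute_swapInv_of_disjoint {T : mpPerm μ} {A B : Set X} (hA : Swappable T A)
    (hB : Swappable T B) (h : Disjoint (A ∪ T.1 '' A) (B ∪ T.1 '' B)) :
    Commute (swapInv T A) (swapInv T B) := by
  have key : ∀ {A B : Set X}, Swappable T A → Swappable T B →
      Disjoint (A ∪ T.1 '' A) (B ∪ T.1 '' B) → ∀ x ∈ A ∪ T.1 '' A,
      (swapInv T A).1 ((swapInv T B).1 x) = (swapInv T B).1 ((swapInv T A).1 x) := by
    intro A B hA hB h x hx
    have hn : ∀ y ∈ A ∪ T.1 '' A, (swapInv T B).1 y = y := fun y hy => by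
      have := Set.disjoint_left.1 h hy
      exact swapInv_apply_notMem hB (fun h => this (Or.inl h)) fun h => this (Or.inr h)
    have hm : (swapInv T A).1 x ∈ A ∪ T.1 '' A := by
      rcases hx with hx | ⟨y, hy, rfl⟩
      · rw [swapInv_apply_mem hA hx]; exact Or.inr ⟨x, hx, rfl⟩
      · rw [swapInv_apply_image hA hy]; exact Or.inl hy
    rw [hn x hx, hn _ hm]
  apply Subtype.ext
  ext x
  change (swapInv T A).1 ((swapInv T B).1 x) = (swapInv T B).1 ((swapInv T A).1 x)
  by_cases h1 : x ∈ A ∪ T.1 '' A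
  · exact key hA hB h x h1
  by_cases h2 : x ∈ B ∪ T.1 '' B
  · exact (key hB hA h.symm x h2).symm
  · have e1 : (swapInv T A).1 x = x :=
      swapInv_apply_notMem hA (fun h => h1 (Or.inl h)) fun h => h1 (Or.inr h)
    have e2 : (swapInv T B).1 x = x :=
      swapInv_apply_notMem hB (fun h => h2 (Or.inl h)) fun h => h2 (Or.inr h)
    rw [e1, e2, e1]

theorem swapInv_union {T : mpPerm μ} {A B : Set X} (hAB : Swappable T (A ∪ B))
    (hA : MeasurableSet A) (hB : MeasurableSet B) (h : Disjoint A B) :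
    swapInv T (A ∪ B) = swapInv T A * swapInv T B := by
  have sA := hAB.mono hA Set.subset_union_left
  have sB := hAB.mono hB Set.subset_union_right
  have hd : Disjoint (T.1 '' A) (T.1 '' B) := (Set.disjoint_image_iff T.1.injective).2 h
  have hd2 := hAB.2
  rw [Set.image_union, Set.disjoint_union_left, Set.disjoint_union_right,
    Set.disjoint_union_right] at hd2
  rw [Set.disjoint_left] at h hd
  simp only [Set.disjoint_left] at hd2
  obtain ⟨⟨hAA, hABd⟩, hBA, hBB⟩ := hd2
  apply Subtype.ext
  ext x
  change _ = (swapInv T A).1 ((swapInv T B).1 x)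
  by_cases h1 : x ∈ A
  · rw [swapInv_apply_mem hAB (Or.inl h1), swapInv_apply_notMem sB (h h1) (hABd h1),
      swapInv_apply_mem sA h1]
  by_cases h2 : x ∈ B
  · rw [swapInv_apply_mem hAB (Or.inr h2), swapInv_apply_mem sB h2, swapInv_apply_notMem sA]
    · intro h3; exact hABd h3 ⟨x, h2, rfl⟩
    · intro h3; exact hd h3 ⟨x, h2, rfl⟩
  by_cases h3 : x ∈ T.1 '' A
  · have h4 := hd h3
    obtain ⟨y, hy, rfl⟩ := h3
    rw [swapInv_apply_image hAB (Or.inl hy), swapInv_apply_notMem sB h2 h4,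
      swapInv_apply_image sA hy]
  by_cases h4 : x ∈ T.1 '' B
  · obtain ⟨y, hy, rfl⟩ := h4
    rw [swapInv_apply_image hAB (Or.inr hy), swapInv_apply_image sB hy,
      swapInv_apply_notMem sA (fun h5 => h h5 hy) (hBA hy)]
  · rw [swapInv_apply_notMem hAB, swapInv_apply_notMem sB h2 h4, swapInv_apply_notMem sA h1 h3]
    · rintro (h | h)
      exacts [h1 h, h2 h]
    · rw [Set.image_union]
      rintro (h | h)
      exacts [h3 h, h4 h]

theorem swapInv_apply_ne_subset {T : mpPerm μ} {A B : Set X} (hA : Swappable T A)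
    (hB : Swappable T B) {x : X} (hx : (swapInv T A).1 x ≠ (swapInv T B).1 x) :
    x ∈ symmDiff A B ∪ T.1 '' symmDiff A B := by
  by_contra hn
  rw [Set.image_symmDiff T.1.injective] at hn
  simp only [Set.mem_union, Set.mem_symmDiff, not_or, not_and, not_not] at hn
  apply hx
  rw [swapInv_apply hA, swapInv_apply hB, swapFun, swapFun]
  have e1 : x ∈ A ↔ x ∈ B := ⟨hn.1.1, hn.1.2⟩
  have e2 : x ∈ T.1 '' A ↔ x ∈ T.1 '' B := ⟨hn.2.1, hn.2.2⟩
  by_cases h1 : x ∈ A <;> by_cases h2 : x ∈ T.1 '' A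
  · rw [if_pos h1, if_pos (e1.1 h1)]
  · rw [if_pos h1, if_pos (e1.1 h1)]
  · rw [if_neg h1, if_neg (mt e1.2 h1), if_pos h2, if_pos (e2.1 h2)]
  · rw [if_neg h1, if_neg (mt e1.2 h1), if_neg h2, if_neg (mt e2.2 h2)]

/-- The two maps differ only on the symmetric difference and on its image under `T`, and there by at
most two steps; hence the constant `2 · 2`. -/
theorem l1Dist_swapInv_le {T : mpPerm μ} {A B : Set X} (hA : Swappable T A)
    (hB : Swappable T B) :
    l1Dist T (swapInv T A : Aut μ) (swapInv T B : Aut μ) ≤ 4 * μ (symmDiff A B) := by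
  have hm : MeasurableSet (symmDiff A B) := hA.1.symmDiff hB.1
  rw [l1Dist_mk]
  calc _ ≤ ∫⁻ x, (symmDiff A B ∪ T.1 '' symmDiff A B).indicator (fun _ => (2 : ℝ≥0∞)) x ∂μ := by
        refine lintegral_mono fun x => ?_
        by_cases hx : (swapInv T A).1 x = (swapInv T B).1 x
        · rw [hx, orbDist_self]; exact zero_le
        · rw [Set.indicator_of_mem (swapInv_apply_ne_subset hA hB hx)]
          obtain ⟨k, hk, ek⟩ := swapInv_stepBounded T A x
          obtain ⟨l, hl, el⟩ := swapInv_stepBounded T B x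
          refine (orbDist_le T.1 (l - k) ?_).trans ?_
          · rw [ek, el, ← zpow_add_apply]; simp
          · have : (l - k).natAbs ≤ 2 := by omega
            exact_mod_cast this
    _ = 2 * μ (symmDiff A B ∪ T.1 '' symmDiff A B) :=
        lintegral_indicator_const (hm.union (measurableSet_image T hm)) _
    _ ≤ 2 * (μ (symmDiff A B) + μ (symmDiff A B)) := by
        gcongr
        refine (measure_union_le _ _).trans ?_
        rw [measure_image T hm]
    _ = 4 * μ (symmDiff A B) := by ring

end Swap

/-! ### Net flow of a bijection of the integers across a cut -/

section Flow

/-- The points that `f` moves to the right across the cut between `p - 1` and `p`. -/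
def rightCross (f : ℤ → ℤ) (p : ℤ) : Set ℤ := {i | i < p ∧ p ≤ f i}

/-- The points that `f` moves to the left across the cut between `p - 1` and `p`. -/
def leftCross (f : ℤ → ℤ) (p : ℤ) : Set ℤ := {i | p ≤ i ∧ f i < p}

/-- Every cut is crossed by finitely many points. -/
def FiniteCross (f : ℤ → ℤ) : Prop := ∀ p, (rightCross f p).Finite ∧ (leftCross f p).Finite

/-- The net number of points that `f` moves to the right across a cut. -/
def flow (f : ℤ → ℤ) (p : ℤ) : ℤ := (rightCross f p).ncard - (leftCross f p).ncard

theorem FiniteCross.shift {f : ℤ → ℤ} (hf : FiniteCross f) (k : ℤ) :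
    FiniteCross fun i => f (i - k) := by
  intro p
  constructor
  · refine (((hf p).1.union (Set.finite_Ico p (p - k))).image (· + k)).subset ?_
    rintro i ⟨h1, h2⟩
    refine ⟨i - k, ?_, by ring⟩
    by_cases h : i - k < p
    · exact Or.inl ⟨h, h2⟩
    · exact Or.inr ⟨by omega, by omega⟩
  · refine (((hf p).2.union (Set.finite_Ico (p - k) p)).image (· + k)).subset ?_
    rintro i ⟨h1, h2⟩
    refine ⟨i - k, ?_, by ring⟩
    by_cases h : p ≤ i - k
    · exact Or.inl ⟨h, h2⟩
    · exact Or.inr ⟨by omega, by omega⟩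

/-- Only the arrow leaving `p - 1` changes sides, its source becoming `p`. If it pointed to the
right of the cut it stops being a right crossing, otherwise it becomes a left crossing; the flow
drops by one in both cases. -/
theorem flow_shift_one {f : ℤ → ℤ} (hf : FiniteCross f) (p : ℤ) :
    flow (fun i => f (i - 1)) p = flow f p - 1 := by
  have hinj : Function.Injective (fun i : ℤ => i + 1) := add_left_injective 1
  have e1 : rightCross (fun i => f (i - 1)) p = (· + 1) '' (rightCross f p \ {p - 1}) := by
    ext i
    simp only [rightCross, Set.mem_ofPred_eq, Set.mem_image, Set.mem_sdiff, Set.mem_singleton_iff]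
    constructor
    · rintro ⟨h1, h2⟩
      exact ⟨i - 1, ⟨⟨by omega, h2⟩, by omega⟩, by ring⟩
    · rintro ⟨j, ⟨⟨h1, h2⟩, h3⟩, rfl⟩
      exact ⟨by omega, by simpa using h2⟩
  by_cases hp : p ≤ f (p - 1)
  · have e2 : leftCross (fun i => f (i - 1)) p = (· + 1) '' leftCross f p := by
      ext i
      simp only [leftCross, Set.mem_ofPred_eq, Set.mem_image]
      constructor
      · rintro ⟨h1, h2⟩
        have : i - 1 ≠ p - 1 := by
          intro h; rw [h] at h2; omega
        exact ⟨i - 1, ⟨by omega, h2⟩, by ring⟩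
      · rintro ⟨j, ⟨h1, h2⟩, rfl⟩
        exact ⟨by omega, by simpa using h2⟩
    have hm : p - 1 ∈ rightCross f p := ⟨by omega, hp⟩
    have := Set.ncard_sdiff_singleton_add_one hm (hf p).1
    rw [flow, flow, e1, e2, Set.ncard_image_of_injective _ hinj,
      Set.ncard_image_of_injective _ hinj]
    omega
  · have e2 : leftCross (fun i => f (i - 1)) p = (· + 1) '' insert (p - 1) (leftCross f p) := by
      ext i
      simp only [leftCross, Set.mem_ofPred_eq, Set.mem_image, Set.mem_insert_iff]
      constructor
      · rintro ⟨h1, h2⟩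
        exact ⟨i - 1, by omega, by ring⟩
      · rintro ⟨j, rfl | ⟨h1, h2⟩, rfl⟩
        · exact ⟨by omega, by simpa using hp⟩
        · exact ⟨by omega, by simpa using h2⟩
    have hm : p - 1 ∉ rightCross f p := fun h => hp h.2
    have hm' : p - 1 ∉ leftCross f p := fun h => by have := h.1; omega
    have := Set.ncard_insert_of_notMem hm' (hf p).2
    rw [flow, flow, e1, e2, Set.ncard_image_of_injective _ hinj,
      Set.ncard_image_of_injective _ hinj, Set.sdiff_singleton_eq_self hm]
    omega

theorem flow_shift {f : ℤ → ℤ} (hf : FiniteCross f) (p k : ℤ) :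
    flow (fun i => f (i - k)) p = flow f p - k := by
  induction k using Int.induction_on with
  | zero => simp
  | succ k ih =>
    have := flow_shift_one (hf.shift k) p
    have e : (fun i => f (i - 1 - (k : ℤ))) = fun i => f (i - ((k : ℤ) + 1)) := by
      funext i; congr 1; ring
    rw [e, ih] at this
    rw [this]; ring
  | pred k ih =>
    have := flow_shift_one (hf.shift (-k - 1)) p
    have e : (fun i => f (i - 1 - (-(k : ℤ) - 1))) = fun i => f (i - (-(k : ℤ))) := by
      funext i; congr 1; ring
    rw [e, ih] at this
    linarith

/-- What enters the point `p` equals what leaves it: exactly one arrow starts at `p` and exactly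
one, from `q`, ends there. -/
theorem flow_succ {f : ℤ → ℤ} (hb : Function.Bijective f) (hf : FiniteCross f) (p : ℤ) :
    flow f (p + 1) = flow f p := by
  obtain ⟨q, hq⟩ := hb.2 p
  have hq' : ∀ i, f i = p → i = q := fun i hi => hb.1 (hi.trans hq.symm)
  -- Right crossings of both cuts are compared with `{i | i ≤ p ≤ f i}`, and left crossings with `{i
  -- | f i ≤ p ≤ i}`. Each of the four sets misses at most one point, `p` or `q`.
  have card_ins : ∀ (S S' : Set ℤ) (a : ℤ) (c : Prop) [Decidable c], S.Finite → a ∉ S →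
      (∀ i, i ∈ S' ↔ i ∈ S ∨ (i = a ∧ c)) → S'.ncard = S.ncard + if c then 1 else 0 := by
    intro S S' a c _ hS ha h
    split_ifs with hc
    · rw [← Set.ncard_insert_of_notMem ha hS]
      congr 1; ext i; rw [h, Set.mem_insert_iff]; tauto
    · rw [add_zero]
      congr 1; ext i; rw [h]; tauto
  have r1 := card_ins (rightCross f p) {i | i ≤ p ∧ p ≤ f i} p (p ≤ f p) (hf p).1
    (fun h => by have := h.1; omega) (fun i => by
      simp only [rightCross, Set.mem_ofPred_eq]
      constructor
      · rintro ⟨h1, h2⟩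
        by_cases h : i = p
        · subst h; exact Or.inr ⟨rfl, h2⟩
        · exact Or.inl ⟨by omega, h2⟩
      · rintro (⟨h1, h2⟩ | ⟨rfl, h2⟩)
        · exact ⟨by omega, h2⟩
        · exact ⟨le_rfl, h2⟩)
  have r2 := card_ins (rightCross f (p + 1)) {i | i ≤ p ∧ p ≤ f i} q (q ≤ p) (hf (p + 1)).1
    (fun h => by have := h.2; omega) (fun i => by
      simp only [rightCross, Set.mem_ofPred_eq]
      constructor
      · rintro ⟨h1, h2⟩
        by_cases h : f i = p
        · have := hq' i h; subst this; exact Or.inr ⟨rfl, h1⟩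
        · exact Or.inl ⟨by omega, by omega⟩
      · rintro (⟨h1, h2⟩ | ⟨rfl, h2⟩)
        · exact ⟨by omega, by omega⟩
        · exact ⟨h2, hq.ge⟩)
  have l1 := card_ins (leftCross f p) {i | p ≤ i ∧ f i ≤ p} q (p ≤ q) (hf p).2
    (fun h => by have := h.2; omega) (fun i => by
      simp only [leftCross, Set.mem_ofPred_eq]
      constructor
      · rintro ⟨h1, h2⟩
        by_cases h : f i = p
        · have := hq' i h; subst this; exact Or.inr ⟨rfl, h1⟩
        · exact Or.inl ⟨by omega, by omega⟩
      · rintro (⟨h1, h2⟩ | ⟨rfl, h2⟩)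
        · exact ⟨by omega, by omega⟩
        · exact ⟨h2, hq.le⟩)
  have l2 := card_ins (leftCross f (p + 1)) {i | p ≤ i ∧ f i ≤ p} p (f p ≤ p) (hf (p + 1)).2
    (fun h => by have := h.1; omega) (fun i => by
      simp only [leftCross, Set.mem_ofPred_eq]
      constructor
      · rintro ⟨h1, h2⟩
        by_cases h : i = p
        · subst h; exact Or.inr ⟨rfl, h2⟩
        · exact Or.inl ⟨by omega, by omega⟩
      · rintro (⟨h1, h2⟩ | ⟨rfl, h2⟩)
        · exact ⟨by omega, by omega⟩
        · exact ⟨le_rfl, h2⟩)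
  have hpq : f p = p ↔ q = p := ⟨fun h => (hq' p h).symm, fun h => by rw [h] at hq; exact hq⟩
  unfold flow
  split_ifs at r1 r2 l1 l2 <;> omega

theorem flow_eq {f : ℤ → ℤ} (hb : Function.Bijective f) (hf : FiniteCross f) (p q : ℤ) :
    flow f p = flow f q := by
  have h : ∀ p, flow f p = flow f 0 := fun p => by
    induction p using Int.induction_on with
    | zero => rfl
    | succ k ih => rw [flow_succ hb hf, ih]
    | pred k ih => rw [← ih, ← flow_succ hb hf]; congr 1; ring
  rw [h p, h q]

end Flow

/-! ### Completing a partial injection of a column economically -/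

section Matching

/-- Finite subsets of the same size of a linear order are in bijection in such a way that the
number of points separated from their image by a cut is the least possible one. -/
theorem exists_matching {α : Type*} [LinearOrder α] (P Q : Finset α) (h : P.card = Q.card) :
    ∃ m : P ≃ Q, ∀ c : α → Prop, [DecidablePred c] → (∀ x y, x ≤ y → c y → c x) →
      (((Finset.univ.filter fun x : P => ¬ (c x ↔ c (m x))).card : ℕ) : ℤ) ≤
        |((P.filter c).card : ℤ) - (Q.filter c).card| := by
  classical
  -- The increasing bijection is optimal for all cuts at once.
  let m : P ≃o Q := (P.orderIsoOfFin rfl).symm.trans (Q.orderIsoOfFin h.symm)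
  refine ⟨m.toEquiv, fun c _ hc => ?_⟩
  set A : Finset P := Finset.univ.filter fun x => c x with hA
  set B : Finset P := Finset.univ.filter fun x => c (m x) with hB
  have cA : (P.filter c).card = A.card := by
    rw [hA, ← Finset.card_map (Function.Embedding.subtype _)]
    congr 1
    ext x
    simp [and_comm]
  have cB : (Q.filter c).card = B.card := by
    have : B.card = (Finset.univ.filter fun y : Q => c y).card := by
      refine Finset.card_equiv m.toEquiv fun x => ?_
      simp [hB]
    rw [this, ← Finset.card_map (Function.Embedding.subtype _)]
    congr 1
    ext x
    simp [and_comm]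
  -- Both are initial segments of `P`, hence nested, so their symmetric difference has exactly the
  -- difference of the cardinalities as its size.
  have nested : A ⊆ B ∨ B ⊆ A := by
    by_contra hn
    rw [not_or] at hn
    obtain ⟨⟨x, hxA, hxB⟩, ⟨y, hyB, hyA⟩⟩ := And.imp Finset.not_subset.1 Finset.not_subset.1 hn
    simp only [hA, hB, Finset.mem_filter, Finset.mem_univ, true_and] at hxA hxB hyA hyB
    rcases le_total x y with hxy | hxy
    · exact hxB (hc _ _ (m.monotone hxy) hyB)
    · exact hyA (hc _ _ hxy hxA)
  rw [cA, cB]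
  rcases nested with hs | hs
  · have : (Finset.univ.filter fun x : P => ¬ (c x ↔ c (m x))) = B \ A := by
      ext x
      have := @hs x
      simp only [hA, hB, Finset.mem_filter, Finset.mem_univ, true_and, Finset.mem_sdiff] at this ⊢
      tauto
    have h2 := Finset.card_sdiff_add_card_eq_card hs
    change (((Finset.univ.filter fun x : P => ¬ (c x ↔ c (m x))).card : ℕ) : ℤ) ≤ _
    rw [this, le_abs]
    omega
  · have : (Finset.univ.filter fun x : P => ¬ (c x ↔ c (m x))) = A \ B := by
      ext x
      have := @hs x
      simp only [hA, hB, Finset.mem_filter, Finset.mem_univ, true_and, Finset.mem_sdiff] at this ⊢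
      tauto
    have h2 := Finset.card_sdiff_add_card_eq_card hs
    change (((Finset.univ.filter fun x : P => ¬ (c x ↔ c (m x))).card : ℕ) : ℤ) ≤ _
    rw [this, le_abs]
    omega

/-- The number of points of the column that `g` moves out of it, minus the number of points of
the column that are not in the image of `g`, below the level `p`. -/
def columnDefect {h : ℕ} (g : Fin h → ℤ) (p : ℤ) : ℤ :=
  ((Finset.univ.filter fun i : Fin h => ¬ (0 ≤ g i ∧ g i < h) ∧ (i : ℤ) < p).card : ℤ) -
    (Finset.univ.filter fun j : Fin h => (∀ i, g i ≠ j) ∧ (j : ℤ) < p).card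

/-- The levels below `p` are counted twice: as sources (leaving or staying) and as targets (not
attained or attained by a staying point). Subtracting leaves the staying arrows that cross `p`, with
a sign. -/
theorem columnDefect_eq {h : ℕ} (g : Fin h → ℤ) (hg : Function.Injective g) (p : ℤ) :
    columnDefect g p =
      ((Finset.univ.filter fun i : Fin h => (0 ≤ g i ∧ g i < h) ∧ p ≤ i ∧ g i < p).card : ℤ) -
      (Finset.univ.filter fun i : Fin h => (0 ≤ g i ∧ g i < h) ∧ (i : ℤ) < p ∧ p ≤ g i).card := by
  classical
  have e1 : (Finset.univ.filter fun i : Fin h => ¬ (0 ≤ g i ∧ g i < h) ∧ (i : ℤ) < p).card +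
      (Finset.univ.filter fun i : Fin h => (0 ≤ g i ∧ g i < h) ∧ (i : ℤ) < p).card =
      (Finset.univ.filter fun i : Fin h => (i : ℤ) < p).card := by
    rw [← Finset.card_filter_add_card_filter_not
      (s := Finset.univ.filter fun i : Fin h => (i : ℤ) < p)
      (fun i => ¬ (0 ≤ g i ∧ g i < h)), Finset.filter_filter, Finset.filter_filter]
    simp only [not_not, and_comm]
  have e2 : (Finset.univ.filter fun j : Fin h => (∀ i, g i ≠ j) ∧ (j : ℤ) < p).card +
      (Finset.univ.filter fun i : Fin h => (0 ≤ g i ∧ g i < h) ∧ g i < p).card =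
      (Finset.univ.filter fun i : Fin h => (i : ℤ) < p).card := by
    rw [← Finset.card_filter_add_card_filter_not
      (s := Finset.univ.filter fun i : Fin h => (i : ℤ) < p)
      (fun j => ∀ i, g i ≠ j), Finset.filter_filter, Finset.filter_filter]
    congr 1
    · simp only [and_comm]
    · refine Finset.card_bij (fun i hi => ⟨(g i).toNat, ?_⟩) ?_ ?_ ?_
      · simp only [Finset.mem_filter] at hi
        omega
      · intro i hi
        simp only [Finset.mem_filter, Finset.mem_univ, true_and, not_forall, not_not] at hi ⊢
        exact ⟨by omega, i, by omega⟩
      · intro i hi j hj hij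
        simp only [Finset.mem_filter, Finset.mem_univ, true_and, Fin.mk.injEq] at hi hj hij
        exact hg (by omega)
      · intro j hj
        simp only [Finset.mem_filter, Finset.mem_univ, true_and, not_forall, not_not] at hj
        obtain ⟨hj, i, hi⟩ := hj
        have := j.2
        refine ⟨i, ?_, ?_⟩
        · simp only [Finset.mem_filter, Finset.mem_univ, true_and]
          omega
        · ext; simp [hi]
  have e3 : (Finset.univ.filter fun i : Fin h => (0 ≤ g i ∧ g i < h) ∧ p ≤ i ∧ g i < p).card +
      (Finset.univ.filter fun i : Fin h => (0 ≤ g i ∧ g i < h) ∧ (i : ℤ) < p ∧ g i < p).card =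
      (Finset.univ.filter fun i : Fin h => (0 ≤ g i ∧ g i < h) ∧ g i < p).card := by
    rw [← Finset.card_filter_add_card_filter_not
      (s := Finset.univ.filter fun i : Fin h => (0 ≤ g i ∧ g i < h) ∧ g i < p)
      (fun i => p ≤ i), Finset.filter_filter, Finset.filter_filter]
    congr 2
    · ext i; simp only [Finset.mem_filter]; tauto
    · ext i; simp only [Finset.mem_filter, not_le]; tauto
  have e4 : (Finset.univ.filter fun i : Fin h =>
        (0 ≤ g i ∧ g i < h) ∧ (i : ℤ) < p ∧ p ≤ g i).card +
      (Finset.univ.filter fun i : Fin h => (0 ≤ g i ∧ g i < h) ∧ (i : ℤ) < p ∧ g i < p).card =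
      (Finset.univ.filter fun i : Fin h => (0 ≤ g i ∧ g i < h) ∧ (i : ℤ) < p).card := by
    rw [← Finset.card_filter_add_card_filter_not
      (s := Finset.univ.filter fun i : Fin h => (0 ≤ g i ∧ g i < h) ∧ (i : ℤ) < p)
      (fun i => p ≤ g i), Finset.filter_filter, Finset.filter_filter]
    congr 2
    · ext i; simp only [Finset.mem_filter]; tauto
    · ext i; simp only [Finset.mem_filter, not_le]; tauto
  unfold columnDefect
  omega

/-- A partial injection of a column extends to a permutation of the column whose new arrows cross
each level as few times as possible. -/
theorem exists_column_perm {h : ℕ} (g : Fin h → ℤ) (hg : Function.Injective g) :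
    ∃ σ : Equiv.Perm (Fin h), (∀ i, 0 ≤ g i ∧ g i < h → ((σ i : ℕ) : ℤ) = g i) ∧
      ∀ p : ℤ, ((Finset.univ.filter fun i : Fin h => ¬ (0 ≤ g i ∧ g i < h) ∧
        ¬ ((i : ℤ) < p ↔ ((σ i : ℕ) : ℤ) < p)).card : ℤ) ≤ |columnDefect g p| := by
  classical
  set P : Finset (Fin h) := Finset.univ.filter fun i => ¬ (0 ≤ g i ∧ g i < h) with hP
  set Q : Finset (Fin h) := Finset.univ.filter fun j => ∀ i, g i ≠ j with hQ
  have hd : ∀ p, columnDefect g p = ((P.filter fun i : Fin h => (i : ℤ) < p).card : ℤ) -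
      (Q.filter fun i : Fin h => (i : ℤ) < p).card := fun p => by
    rw [columnDefect, hP, hQ, Finset.filter_filter, Finset.filter_filter]
  -- At the cut `h` every level lies below and no staying arrow crosses, so the vanishing defect
  -- says that leaving points and unattained levels are equally many.
  have hPQ : P.card = Q.card := by
    have h1 := columnDefect_eq g hg h
    rw [hd, Finset.filter_true_of_mem fun i _ => by have := i.2; omega,
      Finset.filter_true_of_mem fun i _ => by have := i.2; omega,
      Finset.filter_false_of_mem fun i _ => by have := i.2; omega,
      Finset.filter_false_of_mem fun i _ => by omega] at h1
    simp only [Finset.card_empty] at h1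
    omega
  obtain ⟨m, hm⟩ := exists_matching P Q hPQ
  have memP : ∀ {i}, ¬ (0 ≤ g i ∧ g i < h) → i ∈ P := fun hi => by
    simpa only [hP, Finset.mem_filter, Finset.mem_univ, true_and] using hi
  let s : Fin h → Fin h := fun i =>
    if hi : 0 ≤ g i ∧ g i < h then ⟨(g i).toNat, by omega⟩ else m ⟨i, memP hi⟩
  have s1 : ∀ i, 0 ≤ g i ∧ g i < h → ((s i : ℕ) : ℤ) = g i := fun i hi => by
    simp only [s, dif_pos hi]
    omega
  have s2 : ∀ i (hi : ¬ (0 ≤ g i ∧ g i < h)), s i = m ⟨i, memP hi⟩ := fun i hi => by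
    simp only [s, dif_neg hi]
  have sQ : ∀ i, ¬ (0 ≤ g i ∧ g i < h) → ∀ j, g j ≠ (s i : ℕ) := fun i hi => by
    rw [s2 i hi]
    have := (m ⟨i, memP hi⟩).2
    simp only [hQ, Finset.mem_filter] at this
    exact this.2
  have sinj : Function.Injective s := by
    intro i j hij
    by_cases hi : 0 ≤ g i ∧ g i < h <;> by_cases hj : 0 ≤ g j ∧ g j < h
    · apply hg; rw [← s1 i hi, ← s1 j hj, hij]
    · exact absurd (by rw [← hij]; exact (s1 i hi).symm) (sQ j hj i)
    · exact absurd (by rw [hij]; exact (s1 j hj).symm) (sQ i hi j)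
    · rw [s2 i hi, s2 j hj] at hij
      have := m.injective (Subtype.ext hij)
      simpa using this
  refine ⟨Equiv.ofBijective s (Finite.injective_iff_bijective.1 sinj), fun i hi => s1 i hi,
    fun p => ?_⟩
  rw [hd]
  refine le_trans (le_of_eq ?_) (hm (fun i : Fin h => (i : ℤ) < p) fun x y hxy hy => ?_)
  · congr 1
    symm
    refine Finset.card_bij (fun i _ => i.1) ?_ ?_ ?_
    · rintro ⟨i, hi⟩ h2
      have hi' : ¬ (0 ≤ g i ∧ g i < h) := by
        simpa only [hP, Finset.mem_filter, Finset.mem_univ, true_and] using hi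
      simp only [Finset.mem_filter, Finset.mem_univ, true_and, Equiv.ofBijective_apply] at h2 ⊢
      rw [s2 i hi']
      exact ⟨hi', h2⟩
    · intro i _ j _ hij
      exact Subtype.ext hij
    · intro i hi
      simp only [Finset.mem_filter, Finset.mem_univ, true_and, Equiv.ofBijective_apply] at hi
      refine ⟨⟨i, memP hi.1⟩, ?_, rfl⟩
      rw [s2 i hi.1] at hi
      simp only [Finset.mem_filter, Finset.mem_univ, true_and]
      exact hi.2
  · have : (x : ℕ) ≤ y := hxy
    omega

/-- If `f` has zero flow, then the defect of a column is at most the number of arrows of `f` that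
cross the given level and do not stay on one side of, or inside, the column. -/
theorem abs_columnDefect_le {f : ℤ → ℤ} (hb : Function.Bijective f) (hf : FiniteCross f)
    {a p : ℤ} {h : ℕ} (hp : 0 ≤ p) (hph : p ≤ h) (h0 : flow f (a + p) = 0) (D : Set ℤ)
    (hD : ∀ i ∉ D, (i < a ∧ f i < a) ∨ ((a ≤ i ∧ i < a + h) ∧ (a ≤ f i ∧ f i < a + h)) ∨
      (a + h ≤ i ∧ a + h ≤ f i))
    (hD' : ∀ i ∈ D, a ≤ i → i < a + h → ¬ (a ≤ f i ∧ f i < a + h)) :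
    |columnDefect (fun i : Fin h => f (a + i) - a) p| ≤
      ((D ∩ (rightCross f (a + p) ∪ leftCross f (a + p))).ncard : ℤ) := by
  have hinj : Function.Injective fun i : Fin h => f (a + i) - a := by
    intro i j hij
    have : f (a + i) = f (a + j) := by simpa using hij
    have := hb.1 this
    ext; omega
  have emb : Function.Injective fun i : Fin h => a + (i : ℤ) := by
    intro i j hij
    ext
    have : a + (i : ℤ) = a + j := hij
    omega
  -- An arrow outside `D` that crosses the cut must start and end in the column, since the others
  -- stay on one side of it. So the staying arrows of the column account for all crossings outside
  -- `D`.
  have c1 : (Finset.univ.filter fun i : Fin h => (0 ≤ f (a + i) - a ∧ f (a + i) - a < h) ∧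
      p ≤ i ∧ f (a + i) - a < p).card = (leftCross f (a + p) \ D).ncard := by
    rw [← Set.ncard_coe_finset, ← Set.ncard_image_of_injective _ emb]
    congr 1
    ext i
    simp only [Finset.coe_filter, Finset.mem_univ, true_and, Set.mem_image, Set.mem_ofPred_eq,
      Set.mem_sdiff, leftCross]
    constructor
    · rintro ⟨j, hj, rfl⟩
      refine ⟨by omega, fun hmem => hD' _ hmem (by omega) (by have := j.2; omega) (by omega)⟩
    · rintro ⟨h1, h2⟩
      have := hD i h2
      refine ⟨⟨(i - a).toNat, by omega⟩, ?_, by dsimp only; omega⟩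
      have e : a + ((i - a).toNat : ℤ) = i := by omega
      dsimp only
      rw [e]
      omega
  have c2 : (Finset.univ.filter fun i : Fin h => (0 ≤ f (a + i) - a ∧ f (a + i) - a < h) ∧
      (i : ℤ) < p ∧ p ≤ f (a + i) - a).card = (rightCross f (a + p) \ D).ncard := by
    rw [← Set.ncard_coe_finset, ← Set.ncard_image_of_injective _ emb]
    congr 1
    ext i
    simp only [Finset.coe_filter, Finset.mem_univ, true_and, Set.mem_image, Set.mem_ofPred_eq,
      Set.mem_sdiff, rightCross]
    constructor
    · rintro ⟨j, hj, rfl⟩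
      refine ⟨by omega, fun hmem => hD' _ hmem (by omega) (by have := j.2; omega) (by omega)⟩
    · rintro ⟨h1, h2⟩
      have := hD i h2
      refine ⟨⟨(i - a).toNat, by omega⟩, ?_, by dsimp only; omega⟩
      have e : a + ((i - a).toNat : ℤ) = i := by omega
      dsimp only
      rw [e]
      omega
  have d1 := Set.ncard_inter_add_ncard_sdiff_eq_ncard (leftCross f (a + p)) D (hf _).2
  have d2 := Set.ncard_inter_add_ncard_sdiff_eq_ncard (rightCross f (a + p)) D (hf _).1
  have d3 : (D ∩ (rightCross f (a + p) ∪ leftCross f (a + p))).ncard =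
      (rightCross f (a + p) ∩ D).ncard + (leftCross f (a + p) ∩ D).ncard := by
    rw [← Set.ncard_union_eq _ ((hf _).1.inter_of_left D) ((hf _).2.inter_of_left D)]
    · congr 1; ext i; simp only [Set.mem_inter_iff, Set.mem_union]; tauto
    · rw [Set.disjoint_left]
      rintro i ⟨h1, -⟩ ⟨h2, -⟩
      have := h1.1; have := h2.1; omega
  -- As the total flow is zero, the net crossing of the staying arrows is opposite to that of `D`,
  -- which is bounded by the number of crossings from `D`.
  rw [columnDefect_eq _ hinj, d3, abs_le]
  unfold flow at h0
  rw [c1, c2]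
  omega

end Matching

/-! ### Piecewise powers of `T` -/

section Piecewise

variable {X : Type*} [MeasurableSpace X] {μ : Measure X}

theorem measurable_zpow_cocycle (T : mpPerm μ) {c : X → ℤ} (hc : Measurable c) {g : X → X}
    (hg : Measurable g) : Measurable fun x => (T.1 ^ c x) (g x) := by
  have : Measurable fun y : ℤ × X => (T.1 ^ y.1) y.2 :=
    measurable_from_prod_countable_right fun k => measurable_zpow T k
  exact this.comp (hc.prodMk hg)

theorem measurePreserving_zpow (T : mpPerm μ) (k : ℤ) :
    MeasurePreserving (T.1 ^ k : Equiv.Perm X) μ μ := (T ^ k).2.1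

/-- A bijection acting by powers of `T` on the pieces of a countable measurable partition preserves
the measure. -/
theorem mem_mpPerm_of_cocycle (T : mpPerm μ) (g : Equiv.Perm X) {c : X → ℤ} (hc : Measurable c)
    (hg : ∀ x, g x = (T.1 ^ c x) x) : g ∈ mpPerm μ := by
  have hgm : Measurable g := by
    have := measurable_zpow_cocycle T hc measurable_id
    convert this using 1
    funext x; exact hg x
  have img : ∀ S, g '' S = ⋃ k : ℤ, (T ^ k).1 '' (S ∩ c ⁻¹' {k}) := by
    intro S
    ext y
    simp only [Set.mem_image, Set.mem_iUnion]
    constructor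
    · rintro ⟨x, hx, rfl⟩
      exact ⟨c x, x, ⟨hx, rfl⟩, (hg x).symm⟩
    · rintro ⟨k, x, ⟨hx, rfl⟩, rfl⟩
      exact ⟨x, hx, hg x⟩
  have hck : ∀ k, MeasurableSet (c ⁻¹' {k}) := fun k => hc (measurableSet_singleton k)
  have himg : ∀ S, MeasurableSet S → MeasurableSet (g '' S) := by
    intro S hS
    rw [img]
    exact MeasurableSet.iUnion fun k => measurableSet_image _ (hS.inter (hck k))
  have hgs : Measurable g.symm := by
    intro S hS
    rw [← Equiv.image_eq_preimage_symm]
    exact himg S hS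
  have hmeas : ∀ S, MeasurableSet S → μ (g '' S) = μ S := by
    intro S hS
    have e : ∀ k : ℤ, (T ^ k).1 '' (S ∩ c ⁻¹' {k}) = g '' (S ∩ c ⁻¹' {k}) := by
      intro k
      refine Set.image_congr ?_
      rintro x ⟨-, rfl⟩
      exact (hg x).symm
    have hd : Pairwise (Function.onFun Disjoint fun k : ℤ => S ∩ c ⁻¹' {k}) := by
      intro k l hkl
      rw [Function.onFun, Set.disjoint_left]
      rintro x ⟨-, rfl⟩ ⟨-, h⟩
      exact hkl h
    rw [img, measure_iUnion]
    · simp_rw [measure_image _ (hS.inter (hck _))]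
      rw [← measure_iUnion hd fun k => hS.inter (hck k), ← Set.inter_iUnion]
      congr 1
      ext x
      simp
    · intro k l hkl
      rw [Function.onFun, e, e]
      exact (Set.disjoint_image_iff g.injective).2 (hd hkl)
    · exact fun k => measurableSet_image _ (hS.inter (hck k))
  have hmp : MeasurePreserving g.symm μ μ := by
    refine ⟨hgs, ?_⟩
    ext S hS
    rw [Measure.map_apply hgs hS, ← Equiv.image_eq_preimage_symm, hmeas S hS]
  refine ⟨?_, hmp⟩
  exact MeasurePreserving.symm (⟨g.symm, hgs, hgm⟩ : X ≃ᵐ X) hmp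

end Piecewise

/-! ### Columns over a uniformly recurrent set -/

section Tower

variable {X : Type*} [MeasurableSpace X] {μ : Measure X}

/-- Every point enters `B` after at most `N` steps. -/
def Recurrent (T : mpPerm μ) (B : Set X) (N : ℕ) : Prop :=
  ∀ x, ∃ n : ℕ, 1 ≤ n ∧ n ≤ N ∧ (T.1 ^ (n : ℤ)) x ∈ B

/-- The number of steps since the last visit to `B`. -/
def level (T : mpPerm μ) (B : Set X) (x : X) : ℕ := sInf {n : ℕ | (T.1 ^ (-(n : ℤ))) x ∈ B}

/-- The number of steps until the next visit to `B`. -/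
def wait (T : mpPerm μ) (B : Set X) (x : X) : ℕ :=
  sInf {n : ℕ | 1 ≤ n ∧ (T.1 ^ (n : ℤ)) x ∈ B}

/-- The last point of the orbit visited in `B`. -/
def base (T : mpPerm μ) (B : Set X) (x : X) : X := (T.1 ^ (-(level T B x : ℤ))) x

variable {T : mpPerm μ} {B : Set X} {N : ℕ}

theorem Recurrent.base_mem (h : Recurrent T B N) (x : X) : base T B x ∈ B := by
  refine Nat.sInf_mem (s := {n : ℕ | (T.1 ^ (-(n : ℤ))) x ∈ B}) ?_
  -- Recurrence is stated forwards only; starting `N` steps earlier produces a visit no later than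
  -- `x`.
  obtain ⟨n, h1, h2, h3⟩ := h ((T.1 ^ (-(N : ℤ))) x)
  refine ⟨N - n, ?_⟩
  rw [← zpow_add_apply] at h3
  have : -((N - n : ℕ) : ℤ) = n + -(N : ℤ) := by omega
  rwa [Set.mem_ofPred_eq, this]

theorem Recurrent.wait_spec (h : Recurrent T B N) (x : X) :
    1 ≤ wait T B x ∧ (T.1 ^ (wait T B x : ℤ)) x ∈ B := by
  refine Nat.sInf_mem (s := {n : ℕ | 1 ≤ n ∧ (T.1 ^ (n : ℤ)) x ∈ B}) ?_
  obtain ⟨n, h1, h2, h3⟩ := h x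
  exact ⟨n, h1, h3⟩

theorem Recurrent.wait_le (h : Recurrent T B N) (x : X) : wait T B x ≤ N := by
  obtain ⟨n, h1, h2, h3⟩ := h x
  exact (Nat.sInf_le (s := {n : ℕ | 1 ≤ n ∧ (T.1 ^ (n : ℤ)) x ∈ B}) ⟨h1, h3⟩).trans h2

theorem level_eq_of {x : X} {n : ℕ} (h1 : (T.1 ^ (-(n : ℤ))) x ∈ B)
    (h2 : ∀ m : ℕ, m < n → (T.1 ^ (-(m : ℤ))) x ∉ B) : level T B x = n :=
  le_antisymm (Nat.sInf_le h1) (le_csInf ⟨n, h1⟩ fun m hm => not_lt.1 fun h => h2 m h hm)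

theorem wait_eq_of {x : X} {n : ℕ} (h0 : 1 ≤ n) (h1 : (T.1 ^ (n : ℤ)) x ∈ B)
    (h2 : ∀ m : ℕ, 1 ≤ m → m < n → (T.1 ^ (m : ℤ)) x ∉ B) : wait T B x = n :=
  le_antisymm (Nat.sInf_le ⟨h0, h1⟩)
    (le_csInf ⟨n, h0, h1⟩ fun m hm => not_lt.1 fun h => h2 m hm.1 h hm.2)

/-- Minimality of both `level` and `wait`: the column of `x` meets `B` only at its bottom. -/
theorem notMem_of_between {x : X} {j : ℤ} (h1 : -(level T B x : ℤ) < j)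
    (h2 : j < wait T B x) : (T.1 ^ j) x ∉ B := by
  intro h
  rcases le_or_gt j 0 with hj | hj
  · have : level T B x ≤ (-j).toNat := Nat.sInf_le (by
      have e : -((-j).toNat : ℤ) = j := by omega
      rw [Set.mem_ofPred_eq, e]; exact h)
    omega
  · have : wait T B x ≤ j.toNat := Nat.sInf_le ⟨by omega, by
      have e : (j.toNat : ℤ) = j := by omega
      rw [e]; exact h⟩
    omega

theorem Recurrent.level_zpow (h : Recurrent T B N) {x : X} {j : ℤ}
    (h1 : -(level T B x : ℤ) ≤ j) (h2 : j < wait T B x) :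
    (level T B ((T.1 ^ j) x) : ℤ) = level T B x + j := by
  have : level T B ((T.1 ^ j) x) = (level T B x + j).toNat := by
    refine level_eq_of ?_ fun m hm => ?_
    · rw [← zpow_add_apply]
      have e : -((level T B x + j).toNat : ℤ) + j = -(level T B x : ℤ) := by omega
      rw [e]; exact h.base_mem x
    · rw [← zpow_add_apply]
      exact notMem_of_between (by omega) (by omega)
  omega

theorem Recurrent.wait_zpow (h : Recurrent T B N) {x : X} {j : ℤ}
    (h1 : -(level T B x : ℤ) ≤ j) (h2 : j < wait T B x) :
    (wait T B ((T.1 ^ j) x) : ℤ) = wait T B x - j := by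
  have : wait T B ((T.1 ^ j) x) = (wait T B x - j).toNat := by
    refine wait_eq_of (by omega) ?_ fun m hm hm' => ?_
    · rw [← zpow_add_apply]
      have e : ((wait T B x - j).toNat : ℤ) + j = (wait T B x : ℤ) := by omega
      rw [e]; exact (h.wait_spec x).2
    · rw [← zpow_add_apply]
      exact notMem_of_between (by omega) (by omega)
  omega

theorem Recurrent.base_zpow (h : Recurrent T B N) {x : X} {j : ℤ}
    (h1 : -(level T B x : ℤ) ≤ j) (h2 : j < wait T B x) :
    base T B ((T.1 ^ j) x) = base T B x := by
  rw [base, base, h.level_zpow h1 h2, ← zpow_add_apply]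
  congr 2; ring

theorem level_of_mem {b : X} (hb : b ∈ B) : level T B b = 0 :=
  level_eq_of (by simpa using hb) (by simp)

theorem base_of_mem {b : X} (hb : b ∈ B) : base T B b = b := by
  simp [base, level_of_mem hb]

theorem zpow_level_base (x : X) : (T.1 ^ (level T B x : ℤ)) (base T B x) = x := by
  rw [base, ← zpow_add_apply]; simp

theorem Recurrent.wait_base (h : Recurrent T B N) (x : X) :
    wait T B (base T B x) = level T B x + wait T B x := by
  have := h.wait_zpow (x := x) (j := -(level T B x : ℤ)) le_rfl
    (by have := (h.wait_spec x).1; omega)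
  change (wait T B (base T B x) : ℤ) = _ at this
  omega

theorem Recurrent.measurable_level (h : Recurrent T B N) (hB : MeasurableSet B) :
    Measurable (level T B) := by
  refine measurable_to_countable' fun n => ?_
  have : level T B ⁻¹' {n} = {x | (T.1 ^ (-(n : ℤ))) x ∈ B} ∩
      ⋂ m : ℕ, ⋂ _ : m < n, {x | (T.1 ^ (-(m : ℤ))) x ∉ B} := by
    ext x
    simp only [Set.mem_preimage, Set.mem_singleton_iff, Set.mem_inter_iff, Set.mem_ofPred_eq,
      Set.mem_iInter]
    constructor
    · rintro rfl
      exact ⟨h.base_mem x, fun m hm => notMem_of_between (by omega)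
        (by have := (h.wait_spec x).1; omega)⟩
    · rintro ⟨h1, h2⟩
      exact level_eq_of h1 h2
  rw [this]
  refine (measurable_zpow T _ hB).inter (MeasurableSet.iInter fun m => MeasurableSet.iInter
    fun _ => (measurable_zpow T _ hB).compl)

theorem Recurrent.measurable_wait (h : Recurrent T B N) (hB : MeasurableSet B) :
    Measurable (wait T B) := by
  refine measurable_to_countable' fun n => ?_
  by_cases hn : 1 ≤ n
  · have : wait T B ⁻¹' {n} = {x | (T.1 ^ (n : ℤ)) x ∈ B} ∩
        ⋂ m : ℕ, ⋂ _ : 1 ≤ m, ⋂ _ : m < n, {x | (T.1 ^ (m : ℤ)) x ∉ B} := by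
      ext x
      simp only [Set.mem_preimage, Set.mem_singleton_iff, Set.mem_inter_iff, Set.mem_ofPred_eq,
        Set.mem_iInter]
      constructor
      · rintro rfl
        exact ⟨(h.wait_spec x).2, fun m hm hm' => notMem_of_between (by omega) (by omega)⟩
      · rintro ⟨h1, h2⟩
        exact wait_eq_of hn h1 h2
    rw [this]
    refine (measurable_zpow T _ hB).inter (MeasurableSet.iInter fun m => MeasurableSet.iInter
      fun _ => MeasurableSet.iInter fun _ => (measurable_zpow T _ hB).compl)
  · have : wait T B ⁻¹' {n} = ∅ := by
      ext x
      simp only [Set.mem_preimage, Set.mem_singleton_iff, Set.mem_empty_iff_false, iff_false]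
      have := (h.wait_spec x).1
      omega
    rw [this]
    exact MeasurableSet.empty

theorem Recurrent.measurable_base (h : Recurrent T B N) (hB : MeasurableSet B) :
    Measurable (base T B) := by
  refine measurable_zpow_cocycle T (c := fun x => -(level T B x : ℤ)) ?_ measurable_id
  exact (Measurable.of_discrete (f := fun n : ℕ => -(n : ℤ))).comp (h.measurable_level hB)

end Tower

/-! ### Permutations of the levels of a castle -/

section Castle

variable {X : Type*} [MeasurableSpace X] {μ : Measure X}

/-- A measurable labelling of the points of `B` by a countable set that determines the return time:
a base with label `q` carries a column of height `H q + 1`. -/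
structure Castle (T : mpPerm μ) (Q : Type*) [MeasurableSpace Q] where
  B : Set X
  N : ℕ
  H : Q → ℕ
  label : X → Q
  measurableSet_B : MeasurableSet B
  recurrent : Recurrent T B N
  measurable_label : Measurable label
  wait_eq : ∀ b ∈ B, wait T B b = H (label b) + 1

variable {T : mpPerm μ} {Q : Type*} [MeasurableSpace Q] (C : Castle T Q)

namespace Castle

/-- The bases with label `q`. -/
def part (q : Q) : Set X := {b | b ∈ C.B ∧ C.label b = q}

theorem level_zpow {b : X} (hb : b ∈ C.B) {i : ℕ} (hi : i < C.H (C.label b) + 1) :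
    level T C.B ((T.1 ^ (i : ℤ)) b) = i := by
  have := C.recurrent.level_zpow (x := b) (j := i) (by omega) (by rw [C.wait_eq b hb]; omega)
  rw [level_of_mem hb] at this
  omega

theorem base_zpow {b : X} (hb : b ∈ C.B) {i : ℕ} (hi : i < C.H (C.label b) + 1) :
    base T C.B ((T.1 ^ (i : ℤ)) b) = b := by
  have := C.recurrent.base_zpow (x := b) (j := i) (by omega) (by rw [C.wait_eq b hb]; omega)
  rwa [base_of_mem hb] at this

theorem level_lt (x : X) : level T C.B x < C.H (C.label (base T C.B x)) + 1 := by
  rw [← C.wait_eq _ (C.recurrent.base_mem x), C.recurrent.wait_base]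
  have := (C.recurrent.wait_spec x).1
  omega

/-- The map sending a base and a level of its column to the corresponding point. -/
def point (y : Σ q, C.part q × Fin (C.H q + 1)) : X := (T.1 ^ ((y.2.2 : ℕ) : ℤ)) y.2.1.1

theorem point_bijective : Function.Bijective C.point := by
  constructor
  · rintro ⟨q, ⟨b, hb, rfl⟩, i⟩ ⟨q', ⟨b', hb', rfl⟩, i'⟩ h
    have h1 := C.level_zpow hb i.2
    have h2 := C.level_zpow hb' i'.2
    have h3 := C.base_zpow hb i.2
    have h4 := C.base_zpow hb' i'.2
    simp only [point] at h
    rw [h] at h1 h3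
    obtain rfl : b = b' := h3.symm.trans h4
    have : i = i' := Fin.ext (h1.symm.trans h2)
    rw [this]
  · intro x
    refine ⟨⟨C.label (base T C.B x), ⟨base T C.B x, C.recurrent.base_mem x, rfl⟩,
      ⟨level T C.B x, C.level_lt x⟩⟩, ?_⟩
    exact zpow_level_base x

/-- Permutations of the levels of the columns act on the space. -/
def permHom : (∀ q, Equiv.Perm (Fin (C.H q + 1))) →* Equiv.Perm X where
  toFun σ := (Equiv.ofBijective _ C.point_bijective).permCongr
    (Equiv.sigmaCongrRight fun q => (Equiv.refl _).prodCongr (σ q))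
  map_one' := by
    ext x
    obtain ⟨y, rfl⟩ := C.point_bijective.2 x
    have e : C.point y = Equiv.ofBijective _ C.point_bijective y := rfl
    rw [e, Equiv.permCongr_apply, Equiv.symm_apply_apply]
    rfl
  map_mul' σ τ := by
    ext x
    obtain ⟨y, rfl⟩ := C.point_bijective.2 x
    have e : C.point y = Equiv.ofBijective _ C.point_bijective y := rfl
    simp only [e, Equiv.Perm.mul_apply, Equiv.permCongr_apply, Equiv.symm_apply_apply]
    rfl

theorem permHom_apply (σ : ∀ q, Equiv.Perm (Fin (C.H q + 1))) {b : X} (hb : b ∈ C.B)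
    (i : Fin (C.H (C.label b) + 1)) :
    C.permHom σ ((T.1 ^ ((i : ℕ) : ℤ)) b) = (T.1 ^ ((σ (C.label b) i : ℕ) : ℤ)) b := by
  have e : (T.1 ^ ((i : ℕ) : ℤ)) b =
      Equiv.ofBijective _ C.point_bijective ⟨C.label b, ⟨b, hb, rfl⟩, i⟩ := rfl
  rw [e]
  simp only [permHom, MonoidHom.coe_mk, OneHom.coe_mk, Equiv.permCongr_apply,
    Equiv.symm_apply_apply]
  rfl

/-- The number of steps by which a permutation of the levels moves a point. -/
def cocycle (σ : ∀ q, Equiv.Perm (Fin (C.H q + 1))) (x : X) : ℤ :=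
  ((σ _ ⟨level T C.B x, C.level_lt x⟩ : ℕ) : ℤ) - level T C.B x

theorem permHom_apply_cocycle (σ : ∀ q, Equiv.Perm (Fin (C.H q + 1))) (x : X) :
    C.permHom σ x = (T.1 ^ C.cocycle σ x) x := by
  conv_lhs => rw [← zpow_level_base (T := T) (B := C.B) x]
  refine (C.permHom_apply σ (C.recurrent.base_mem x) ⟨level T C.B x, C.level_lt x⟩).trans ?_
  conv_rhs => rw [cocycle, sub_eq_add_neg, zpow_add_apply]
  rfl

theorem cocycle_zpow (σ : ∀ q, Equiv.Perm (Fin (C.H q + 1))) {b : X} (hb : b ∈ C.B)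
    (i : Fin (C.H (C.label b) + 1)) :
    C.cocycle σ ((T.1 ^ ((i : ℕ) : ℤ)) b) = ((σ (C.label b) i : ℕ) : ℤ) - (i : ℕ) := by
  have h1 := C.level_zpow hb i.2
  have h2 := C.base_zpow hb i.2
  -- The type of a level depends on the label of its base, so base and level are generalized before
  -- substituting.
  have key : ∀ (b' : X) (n : ℕ) (hn : n < C.H (C.label b') + 1), b' = b → n = i →
      ((σ (C.label b') ⟨n, hn⟩ : ℕ) : ℤ) - n = ((σ (C.label b) i : ℕ) : ℤ) - (i : ℕ) := by
    rintro b' n hn rfl rfl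
    rfl
  exact key _ _ _ h2 h1

theorem exists_eq_zpow (x : X) :
    ∃ b ∈ C.B, ∃ i : Fin (C.H (C.label b) + 1), x = (T.1 ^ ((i : ℕ) : ℤ)) b :=
  ⟨base T C.B x, C.recurrent.base_mem x, ⟨level T C.B x, C.level_lt x⟩,
    (zpow_level_base x).symm⟩

theorem mem_image_part_iff {q : Q} {n : ℕ} (hn : n < C.H q + 1) {b : X} (hb : b ∈ C.B)
    (i : Fin (C.H (C.label b) + 1)) :
    (T.1 ^ ((i : ℕ) : ℤ)) b ∈ (T ^ (n : ℤ)).1 '' C.part q ↔ C.label b = q ∧ (i : ℕ) = n := by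
  constructor
  · rintro ⟨b', ⟨hb', rfl⟩, h⟩
    change (T.1 ^ (n : ℤ)) b' = _ at h
    have h1 := C.level_zpow hb i.2
    have h2 := C.level_zpow hb' hn
    have h3 := C.base_zpow hb i.2
    have h4 := C.base_zpow hb' hn
    rw [h] at h2 h4
    exact ⟨by rw [← h4, h3], h1.symm.trans h2⟩
  · rintro ⟨h1, rfl⟩
    exact ⟨b, ⟨hb, h1⟩, rfl⟩

theorem image_image_part (q : Q) (n : ℕ) :
    T.1 '' ((T ^ (n : ℤ)).1 '' C.part q) = (T ^ ((n + 1 : ℕ) : ℤ)).1 '' C.part q := by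
  rw [Set.image_image]
  refine Set.image_congr fun x _ => ?_
  change _ = (T.1 ^ ((n + 1 : ℕ) : ℤ)) x
  rw [Nat.cast_succ, add_comm, zpow_add_apply, zpow_one]
  rfl

section

variable [DiscreteMeasurableSpace Q]

theorem measurableSet_part (q : Q) : MeasurableSet (C.part q) :=
  C.measurableSet_B.inter (C.measurable_label (MeasurableSet.of_discrete (s := {q})))

theorem swappable_part {q : Q} {n : ℕ} (hn : n < C.H q) :
    Swappable T ((T ^ (n : ℤ)).1 '' C.part q) := by
  refine ⟨measurableSet_image _ (C.measurableSet_part q), ?_⟩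
  rw [image_image_part, Set.disjoint_left]
  intro x h1 h2
  obtain ⟨b, hb, i, rfl⟩ := C.exists_eq_zpow x
  rw [C.mem_image_part_iff (by omega) hb] at h1 h2
  omega

end

variable [DiscreteMeasurableSpace Q] [Countable Q]

theorem measurable_cocycle (σ : ∀ q, Equiv.Perm (Fin (C.H q + 1))) :
    Measurable (C.cocycle σ) := by
  classical
  let F : Q × ℕ → ℤ := fun y =>
    if h : y.2 < C.H y.1 + 1 then ((σ y.1 ⟨y.2, h⟩ : ℕ) : ℤ) - y.2 else 0
  have : C.cocycle σ = fun x => F (C.label (base T C.B x), level T C.B x) := by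
    funext x
    simp only [F, dif_pos (C.level_lt x), cocycle]
  rw [this]
  exact (Measurable.of_discrete (f := F)).comp
    ((C.measurable_label.comp (C.recurrent.measurable_base C.measurableSet_B)).prodMk
      (C.recurrent.measurable_level C.measurableSet_B))

theorem permHom_mem (σ : ∀ q, Equiv.Perm (Fin (C.H q + 1))) : C.permHom σ ∈ mpPerm μ :=
  mem_mpPerm_of_cocycle T _ (C.measurable_cocycle σ) (C.permHom_apply_cocycle σ)

/-- The action of the permutations of the levels of the columns, in `Aut`. -/
def mpHom : (∀ q, Equiv.Perm (Fin (C.H q + 1))) →* mpPerm μ :=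
  C.permHom.codRestrict (mpPerm μ) C.permHom_mem

theorem mpHom_apply (σ : ∀ q, Equiv.Perm (Fin (C.H q + 1))) {b : X} (hb : b ∈ C.B)
    (i : Fin (C.H (C.label b) + 1)) :
    (C.mpHom σ).1 ((T.1 ^ ((i : ℕ) : ℤ)) b) = (T.1 ^ ((σ (C.label b) i : ℕ) : ℤ)) b :=
  C.permHom_apply σ hb i

variable [DecidableEq Q]

/-- This translates between finite permutations and involutions of the space: exchanging adjacent
levels above the bases with label `q` is the involution of the lower level. -/
theorem mpHom_mulSingle_swap (q : Q) (i : Fin (C.H q)) :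
    C.mpHom (Pi.mulSingle q (Equiv.swap i.castSucc i.succ)) =
      swapInv T ((T ^ ((i : ℕ) : ℤ)).1 '' C.part q) := by
  apply Subtype.ext
  ext x
  obtain ⟨b, hb, j, rfl⟩ := C.exists_eq_zpow x
  rw [C.mpHom_apply _ hb]
  have hS := C.swappable_part i.2
  by_cases hq : C.label b = q
  · subst hq
    rw [Pi.mulSingle_eq_same]
    by_cases h1 : j = i.castSucc
    · subst h1
      rw [Equiv.swap_apply_left, swapInv_apply_mem hS]
      · simp only [Fin.val_succ, Fin.val_castSucc, Nat.cast_succ]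
        rw [add_comm, zpow_add_apply, zpow_one]
      · rw [C.mem_image_part_iff (by omega) hb]
        exact ⟨rfl, rfl⟩
    by_cases h2 : j = i.succ
    · subst h2
      rw [Equiv.swap_apply_right]
      have e : (T.1 ^ ((i.succ : ℕ) : ℤ)) b = T.1 ((T.1 ^ ((i : ℕ) : ℤ)) b) := by
        simp only [Fin.val_succ, Nat.cast_succ]
        rw [add_comm, zpow_add_apply, zpow_one]
      rw [e, swapInv_apply_image hS]
      · rfl
      · exact ⟨b, ⟨hb, rfl⟩, rfl⟩
    · rw [Equiv.swap_apply_of_ne_of_ne h1 h2, swapInv_apply_notMem hS]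
      · rw [C.mem_image_part_iff (by omega) hb]
        exact fun h => h1 (Fin.ext h.2)
      · rw [image_image_part, C.mem_image_part_iff (by omega) hb]
        exact fun h => h2 (Fin.ext (by simpa using h.2))
  · rw [Pi.mulSingle_eq_of_ne hq, swapInv_apply_notMem hS]
    · rfl
    · rw [C.mem_image_part_iff (by omega) hb]
      exact fun h => hq h.1
    · rw [image_image_part, C.mem_image_part_iff (by omega) hb]
      exact fun h => hq h.1

end Castle

/-- A group of permutations containing the cycles `(i, i + 1, i + 2)` contains each permutation up
to the transposition `(0, 1)`. -/
theorem exists_mem_of_adjacent_cycles {n : ℕ} (L : Subgroup (Equiv.Perm (Fin (n + 1))))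
    (hL : ∀ i j : Fin n, (i : ℕ) + 1 = j →
      Equiv.swap i.castSucc i.succ * Equiv.swap j.castSucc j.succ ∈ L)
    (σ : Equiv.Perm (Fin (n + 1))) :
    ∃ τ ∈ L, ∀ i, τ i = σ i ∨ ((σ i : ℕ) ≤ 1 ∧ (τ i : ℕ) ≤ 1) := by
  -- A column with a single level has only the trivial permutation.
  rcases n with _ | n
  · exact ⟨1, one_mem _, fun i => Or.inl (Fin.ext (by omega))⟩
  set s : Fin (n + 1) → Equiv.Perm (Fin (n + 1 + 1)) :=
    fun i => Equiv.swap i.castSucc i.succ with hs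
  have ss : ∀ i, s i * s i = 1 := fun i => Equiv.swap_mul_self _ _
  have h0 : ∀ i, s 0 * s i ∈ L := by
    intro i
    induction i using Fin.induction with
    | zero => rw [ss]; exact one_mem _
    | succ i ih =>
      have := mul_mem ih (hL i.castSucc i.succ (by simp))
      change s 0 * s i.castSucc * (s i.castSucc * s i.succ) ∈ L at this
      rwa [mul_assoc, ← mul_assoc (s i.castSucc), ss, one_mul] at this
  have hi0 : ∀ i, s i * s 0 ∈ L := by
    intro i
    have := inv_mem (h0 i)
    rwa [mul_inv_rev, inv_eq_of_mul_eq_one_left (ss i), inv_eq_of_mul_eq_one_left (ss 0)] at this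
  -- Adjacent transpositions generate, and each is congruent to `s 0` modulo `L` on either side; so
  -- `L` and its coset by `s 0` exhaust the group.
  have key : ∀ σ : Equiv.Perm (Fin (n + 1 + 1)), σ ∈ L ∨ s 0 * σ ∈ L := by
    intro σ
    have hσ : σ ∈ Submonoid.closure (Set.range s) := by
      rw [hs, Equiv.Perm.mclosure_swap_castSucc_succ]; trivial
    induction hσ using Submonoid.closure_induction_left with
    | one => exact Or.inl (one_mem _)
    | mul_left x hx y hy ih =>
      obtain ⟨i, rfl⟩ := hx
      rcases ih with ih | ih
      · right
        rw [← mul_assoc]; exact mul_mem (h0 i) ih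
      · left
        have := mul_mem (hi0 i) ih
        rwa [mul_assoc, ← mul_assoc (s 0), ss, one_mul] at this
  rcases key σ with h | h
  · exact ⟨σ, h, fun i => Or.inl rfl⟩
  -- The factor `s 0` alters only the values 0 and 1.
  · refine ⟨_, h, fun i => ?_⟩
    rw [Equiv.Perm.mul_apply]
    have e : s 0 = Equiv.swap 0 1 := rfl
    rw [e]
    by_cases h1 : σ i = 0
    · right; rw [h1]; simp
    by_cases h2 : σ i = 1
    · right; rw [h2]; simp
    · left; exact Equiv.swap_apply_of_ne_of_ne h1 h2

namespace Castle

variable {T : mpPerm μ} {Q : Type*} [MeasurableSpace Q] [DiscreteMeasurableSpace Q]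

/-- The cycle on three consecutive levels starting at level `i` is the conjugate by `T ^ i` of the
cycle on the lowest three, which is in `K` by assumption. -/
theorem mpHom_mulSingle_cycle_mem [Countable Q] [DecidableEq Q] (C : Castle T Q)
    (K : Subgroup (mpPerm μ)) (hT : T ∈ K)
    (hK : ∀ E ⊆ C.B, MeasurableSet E → swapInv T E * swapInv T (T.1 '' E) ∈ K)
    (q : Q) (i j : Fin (C.H q)) (hij : (i : ℕ) + 1 = j) :
    C.mpHom (Pi.mulSingle q (Equiv.swap i.castSucc i.succ * Equiv.swap j.castSucc j.succ)) ∈ K := by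
  rw [Pi.mulSingle_mul, map_mul, mpHom_mulSingle_swap, mpHom_mulSingle_swap, ← hij,
    ← image_image_part]
  have hc : Commute (T ^ ((i : ℕ) : ℤ)) T := (Commute.refl T).zpow_left _
  have e : T.1 '' ((T ^ ((i : ℕ) : ℤ)).1 '' C.part q) =
      (T ^ ((i : ℕ) : ℤ)).1 '' (T.1 '' C.part q) := by
    rw [Set.image_image, Set.image_image]
    exact Set.image_congr fun x _ => (congrArg (fun p : mpPerm μ => p.1 x) hc.eq).symm
  rw [e, ← conj_swapInv hc, ← conj_swapInv hc, conj_mul]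
  exact mul_mem (mul_mem (zpow_mem hT ((i : ℕ) : ℤ))
    (hK (C.part q) (fun b hb => hb.1) (C.measurableSet_part q)))
    (inv_mem (zpow_mem hT ((i : ℕ) : ℤ)))

/-- The maps differ only where `σ` sends a point into one of the two lowest levels, and there by at
most one step. By invariance of the measure these points have the measure of `B ∪ T(B)`. -/
theorem l1Dist_mpHom_le [Countable Q] (C : Castle T Q)
    (σ τ : ∀ q, Equiv.Perm (Fin (C.H q + 1)))
    (h : ∀ q i, τ q i = σ q i ∨ ((σ q i : ℕ) ≤ 1 ∧ (τ q i : ℕ) ≤ 1)) :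
    l1Dist T (C.mpHom σ : Aut μ) (C.mpHom τ : Aut μ) ≤ 2 * μ C.B := by
  have hTB := measurableSet_image T C.measurableSet_B
  have hU := C.measurableSet_B.union hTB
  rw [l1Dist_mk]
  calc _ ≤ ∫⁻ x, ((C.mpHom σ).1 ⁻¹' (C.B ∪ T.1 '' C.B)).indicator (fun _ => (1 : ℝ≥0∞)) x ∂μ := by
        refine lintegral_mono fun x => ?_
        obtain ⟨b, hb, i, rfl⟩ := C.exists_eq_zpow x
        rw [C.mpHom_apply _ hb, C.mpHom_apply _ hb]
        rcases h (C.label b) i with h | ⟨h1, h2⟩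
        · rw [h, orbDist_self]; exact zero_le
        · rw [Set.indicator_of_mem]
          · refine (orbDist_le T.1 ((τ (C.label b) i : ℕ) - (σ (C.label b) i : ℕ) : ℤ)
              (by rw [← zpow_add_apply]; simp)).trans ?_
            have : ((τ (C.label b) i : ℕ) - (σ (C.label b) i : ℕ) : ℤ).natAbs ≤ 1 := by omega
            exact_mod_cast this
          · rw [Set.mem_preimage, C.mpHom_apply _ hb]
            rcases Nat.le_one_iff_eq_zero_or_eq_one.1 h1 with h | h
            · rw [h]; left; simpa using hb
            · rw [h]; right; exact ⟨b, hb, by simp⟩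
    _ = μ (C.B ∪ T.1 '' C.B) := by
        rw [lintegral_indicator_const ((C.mpHom σ).2.1.measurable hU), one_mul,
          (C.mpHom σ).2.1.measure_preimage hU.nullMeasurableSet]
    _ ≤ 2 * μ C.B := by
        refine (measure_union_le _ _).trans ?_
        rw [measure_image T C.measurableSet_B, two_mul]

/-- If a group contains `T` and the cycles `(E, T E, T² E)` for `E ⊆ B`, then it approximates the
permutations of the columns over `B`. -/
theorem exists_mem_l1Dist_le [Finite Q] (C : Castle T Q)
    (K : Subgroup (mpPerm μ)) (hT : T ∈ K)
    (hK : ∀ E ⊆ C.B, MeasurableSet E → swapInv T E * swapInv T (T.1 '' E) ∈ K)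
    (σ : ∀ q, Equiv.Perm (Fin (C.H q + 1))) :
    ∃ k ∈ K, l1Dist T (C.mpHom σ : Aut μ) (k : Aut μ) ≤ 2 * μ C.B := by
  classical
  have hτ : ∀ q, ∃ τ : Equiv.Perm (Fin (C.H q + 1)), C.mpHom (Pi.mulSingle q τ) ∈ K ∧
      ∀ i, τ i = σ q i ∨ ((σ q i : ℕ) ≤ 1 ∧ (τ i : ℕ) ≤ 1) := fun q => by
    obtain ⟨τ, h1, h2⟩ := exists_mem_of_adjacent_cycles
      ((K.comap C.mpHom).comap (MonoidHom.mulSingle (fun q => Equiv.Perm (Fin (C.H q + 1))) q))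
      (fun i j hij => by
        rw [Subgroup.mem_comap, Subgroup.mem_comap]
        exact C.mpHom_mulSingle_cycle_mem K hT hK q i j hij) (σ q)
    rw [Subgroup.mem_comap, Subgroup.mem_comap] at h1
    exact ⟨τ, h1, h2⟩
  choose τ hτ1 hτ2 using hτ
  have hmem : τ ∈ K.comap C.mpHom :=
    Subgroup.pi_mem_of_mulSingle_mem τ fun q => Subgroup.mem_comap.2 (hτ1 q)
  exact ⟨C.mpHom τ, Subgroup.mem_comap.1 hmem, C.l1Dist_mpHom_le σ τ hτ2⟩

end Castle

end Castle

/-! ### Displacement cocycles, crossings and constancy of the flow -/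

section Cocycle

variable {X : Type*} [MeasurableSpace X] {μ : Measure X}

/-- Freeness makes the displacement unique where it exists, so its level sets are coincidence sets
of measurable maps. Elsewhere it is set to 0, which is why the value 0 is treated apart. -/
theorem exists_cocycle [MeasurableEq X] {T : mpPerm μ} (hT : IsFree T.1) (s : mpPerm μ) :
    ∃ c : X → ℤ, Measurable c ∧ ∀ x, (∃ k : ℤ, s.1 x = (T.1 ^ k) x) → s.1 x = (T.1 ^ c x) x := by
  classical
  let c : X → ℤ := fun x => if h : ∃ k : ℤ, s.1 x = (T.1 ^ k) x then h.choose else 0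
  have hc : ∀ x, (∃ k : ℤ, s.1 x = (T.1 ^ k) x) → s.1 x = (T.1 ^ c x) x := fun x h => by
    simp only [c, dif_pos h]
    exact h.choose_spec
  refine ⟨c, measurable_to_countable' fun k => ?_, hc⟩
  have hm : ∀ k : ℤ, MeasurableSet {x | s.1 x = (T.1 ^ k) x} := fun k =>
    measurableSet_eq_fun s.2.1.measurable (measurable_zpow T k)
  have key : ∀ x (k : ℤ), s.1 x = (T.1 ^ k) x → c x = k := fun x k h =>
    hT.zpow_inj ((hc x ⟨k, h⟩).symm.trans h)
  by_cases hk : k = 0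
  · have : c ⁻¹' {k} = {x | s.1 x = (T.1 ^ k) x} ∪ ⋂ l : ℤ, {x | s.1 x = (T.1 ^ l) x}ᶜ := by
      ext x
      simp only [Set.mem_preimage, Set.mem_singleton_iff, Set.mem_union, Set.mem_ofPred_eq,
        Set.mem_iInter, Set.mem_compl_iff]
      constructor
      · rintro h
        by_cases hx : ∃ k : ℤ, s.1 x = (T.1 ^ k) x
        · left; rw [← h]; exact hc x hx
        · right; exact not_exists.1 hx
      · rintro (h | h)
        · exact key x k h
        · simp only [c]
          rw [dif_neg (not_exists.2 h), hk]
    rw [this]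
    exact (hm k).union (MeasurableSet.iInter fun l => (hm l).compl)
  · have : c ⁻¹' {k} = {x | s.1 x = (T.1 ^ k) x} := by
      ext x
      simp only [Set.mem_preimage, Set.mem_singleton_iff, Set.mem_ofPred_eq]
      constructor
      · rintro h
        by_cases hx : ∃ k : ℤ, s.1 x = (T.1 ^ k) x
        · rw [← h]; exact hc x hx
        · simp only [c, dif_neg hx] at h
          exact absurd h.symm hk
      · exact key x k
    rw [this]
    exact hm k

/-- The positions on the orbit of `x` of the points of `D` whose displacement by the cocycle `c`
crosses the cut just before `x`. -/
def crossSet (T : mpPerm μ) (D : Set X) (c : X → ℤ) (x : X) : Set ℤ :=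
  {i | (T.1 ^ i) x ∈ D ∧ ¬ (i < 0 ↔ i + c ((T.1 ^ i) x) < 0)}

theorem encard_eq_tsum {ι : Type*} (S : Set ι) :
    ((S.encard : ℕ∞) : ℝ≥0∞) = ∑' i, S.indicator (fun _ => (1 : ℝ≥0∞)) i := by
  rw [← ENNReal.tsum_set_one]
  exact tsum_subtype S fun _ => (1 : ℝ≥0∞)

theorem encard_cross (k : ℤ) : ({i : ℤ | ¬ (i < 0 ↔ i + k < 0)}.encard : ℕ∞) = k.natAbs := by
  rcases le_total 0 k with hk | hk
  · have : {i : ℤ | ¬ (i < 0 ↔ i + k < 0)} = ((Finset.Ico (-k) 0 : Finset ℤ) : Set ℤ) := by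
      ext i
      simp only [Set.mem_ofPred_eq, Finset.coe_Ico, Set.mem_Ico]
      omega
    rw [this, Set.encard_coe_eq_coe_finsetCard, Int.card_Ico]
    congr 1; omega
  · have : {i : ℤ | ¬ (i < 0 ↔ i + k < 0)} = ((Finset.Ico 0 (-k) : Finset ℤ) : Set ℤ) := by
      ext i
      simp only [Set.mem_ofPred_eq, Finset.coe_Ico, Set.mem_Ico]
      omega
    rw [this, Set.encard_coe_eq_coe_finsetCard, Int.card_Ico]
    congr 1; omega

theorem measurableSet_cross {D : Set X} (hD : MeasurableSet D) {c : X → ℤ}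
    (hc : Measurable c) (i : ℤ) : MeasurableSet {y | y ∈ D ∧ ¬ (i < 0 ↔ i + c y < 0)} :=
  hD.inter (hc (MeasurableSet.of_discrete (s := {k : ℤ | ¬ (i < 0 ↔ i + k < 0)})))

/-- The total displacement on `D` is the integral of the number of arrows crossing a cut. -/
theorem lintegral_encard_crossSet (T : mpPerm μ) {D : Set X} (hD : MeasurableSet D) {c : X → ℤ}
    (hc : Measurable c) :
    ∫⁻ x, ((crossSet T D c x).encard : ℕ∞) ∂μ = ∫⁻ x in D, ((c x).natAbs : ℝ≥0∞) ∂μ := by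
  have hm : ∀ i : ℤ, Measurable ({y | y ∈ D ∧ ¬ (i < 0 ↔ i + c y < 0)}.indicator
      fun _ => (1 : ℝ≥0∞)) := fun i => measurable_const.indicator (measurableSet_cross hD hc i)
  -- Mass transport: invariance under `T ^ i` moves the `i`-th term to the point `x` itself, and the
  -- sum over `i` then counts the cuts crossed by the single arrow of `x`, of which there are `|c
  -- x|`.
  calc _ = ∫⁻ x, ∑' i : ℤ, {y | y ∈ D ∧ ¬ (i < 0 ↔ i + c y < 0)}.indicator
        (fun _ => (1 : ℝ≥0∞)) ((T.1 ^ i) x) ∂μ := by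
        refine lintegral_congr fun x => ?_
        rw [encard_eq_tsum]
        rfl
    _ = ∑' i : ℤ, ∫⁻ x, {y | y ∈ D ∧ ¬ (i < 0 ↔ i + c y < 0)}.indicator
        (fun _ => (1 : ℝ≥0∞)) x ∂μ := by
        refine (lintegral_tsum fun i =>
          ((hm i).comp (measurable_zpow T i)).aemeasurable).trans ?_
        exact tsum_congr fun i => (measurePreserving_zpow T i).lintegral_comp (hm i)
    _ = ∫⁻ x, ∑' i : ℤ, {y | y ∈ D ∧ ¬ (i < 0 ↔ i + c y < 0)}.indicator
        (fun _ => (1 : ℝ≥0∞)) x ∂μ := (lintegral_tsum fun i => (hm i).aemeasurable).symm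
    _ = ∫⁻ x, D.indicator (fun x => ((c x).natAbs : ℝ≥0∞)) x ∂μ := by
        refine lintegral_congr fun x => ?_
        by_cases hx : x ∈ D
        · rw [Set.indicator_of_mem hx]
          have h1 := encard_eq_tsum {i : ℤ | ¬ (i < 0 ↔ i + c x < 0)}
          rw [encard_cross] at h1
          rw [← ENat.toENNReal_coe, h1]
          refine tsum_congr fun i => ?_
          simp [Set.indicator, hx]
        · rw [Set.indicator_of_notMem hx]
          simp [Set.indicator, hx]
    _ = _ := lintegral_indicator hD _

/-- The displacement along the orbit of `x` induced by the cocycle `c`. -/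
def orbitMap (T : mpPerm μ) (c : X → ℤ) (x : X) (i : ℤ) : ℤ := i + c ((T.1 ^ i) x)

theorem orbitMap_zpow (T : mpPerm μ) (c : X → ℤ) (x : X) (p i : ℤ) :
    orbitMap T c ((T.1 ^ p) x) i = orbitMap T c x (i + p) - p := by
  simp only [orbitMap, ← zpow_add_apply]
  ring

theorem crossSet_eq (T : mpPerm μ) (D : Set X) (c : X → ℤ) (x : X) :
    crossSet T D c x = {i | (T.1 ^ i) x ∈ D} ∩
      (rightCross (orbitMap T c x) 0 ∪ leftCross (orbitMap T c x) 0) := by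
  ext i
  simp only [crossSet, rightCross, leftCross, orbitMap, Set.mem_inter_iff, Set.mem_union,
    Set.mem_ofPred_eq, and_congr_right_iff]
  intro _
  omega

theorem rightCross_translate (f : ℤ → ℤ) (p q : ℤ) :
    rightCross f (q + p) = (· + p) '' rightCross (fun i => f (i + p) - p) q := by
  ext i
  simp only [rightCross, Set.mem_ofPred_eq, Set.mem_image]
  constructor
  · rintro ⟨h1, h2⟩
    exact ⟨i - p, ⟨by omega, by rw [sub_add_cancel]; omega⟩, by ring⟩
  · rintro ⟨j, ⟨h1, h2⟩, rfl⟩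
    exact ⟨by omega, by omega⟩

theorem leftCross_translate (f : ℤ → ℤ) (p q : ℤ) :
    leftCross f (q + p) = (· + p) '' leftCross (fun i => f (i + p) - p) q := by
  ext i
  simp only [leftCross, Set.mem_ofPred_eq, Set.mem_image]
  constructor
  · rintro ⟨h1, h2⟩
    exact ⟨i - p, ⟨by omega, by rw [sub_add_cancel]; omega⟩, by ring⟩
  · rintro ⟨j, ⟨h1, h2⟩, rfl⟩
    exact ⟨by omega, by omega⟩

theorem flow_translate (f : ℤ → ℤ) (p q : ℤ) :
    flow (fun i => f (i + p) - p) q = flow f (q + p) := by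
  rw [flow, flow, rightCross_translate f p, leftCross_translate f p,
    Set.ncard_image_of_injective _ (add_left_injective p),
    Set.ncard_image_of_injective _ (add_left_injective p)]

/-- On the orbit of `x`, the cocycle `c` describes a bijection `s` for which every cut is crossed
finitely often. -/
structure GoodPoint (T s : mpPerm μ) (c : X → ℤ) (x : X) : Prop where
  eq : ∀ i : ℤ, s.1 ((T.1 ^ i) x) = (T.1 ^ c ((T.1 ^ i) x)) ((T.1 ^ i) x)
  bij : Function.Bijective (orbitMap T c x)
  fin : FiniteCross (orbitMap T c x)

/-- Each property is a countable intersection of conull conditions along the orbit. Injectivity and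
surjectivity on the orbit come from those of `s`; finiteness of the crossings comes from
integrability, as the number of crossings has finite integral. -/
theorem ae_goodPoint {T s : mpPerm μ} (hT : IsFree T.1) {c : X → ℤ} (hc : Measurable c)
    (hs : ∀ᵐ x ∂μ, s.1 x = (T.1 ^ c x) x)
    (hint : ∫⁻ x, ((c x).natAbs : ℝ≥0∞) ∂μ ≠ ∞) : ∀ᵐ x ∂μ, GoodPoint T s c x := by
  have h1 : ∀ᵐ x ∂μ, ∀ i : ℤ, s.1 ((T.1 ^ i) x) = (T.1 ^ c ((T.1 ^ i) x)) ((T.1 ^ i) x) :=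
    ae_all_iff.2 fun i => (measurePreserving_zpow T i).quasiMeasurePreserving.ae hs
  have h2 : ∀ᵐ x ∂μ, s.1 (s.1.symm x) = (T.1 ^ c (s.1.symm x)) (s.1.symm x) :=
    s.2.2.quasiMeasurePreserving.ae hs
  -- The preimage under `s` of each point of the orbit again lies on the orbit; this gives
  -- surjectivity.
  have h3 : ∀ᵐ x ∂μ, ∀ i : ℤ, (T.1 ^ i) x =
      (T.1 ^ c (s.1.symm ((T.1 ^ i) x))) (s.1.symm ((T.1 ^ i) x)) := by
    refine ae_all_iff.2 fun i => (measurePreserving_zpow T i).quasiMeasurePreserving.ae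
      (p := fun y => y = (T.1 ^ c (s.1.symm y)) (s.1.symm y)) ?_
    filter_upwards [h2] with x hx
    rwa [Equiv.apply_symm_apply] at hx
  have h4 : ∀ᵐ x ∂μ, (crossSet T Set.univ c x).Finite := by
    have h := lintegral_encard_crossSet T MeasurableSet.univ hc
    rw [setLIntegral_univ] at h
    rw [← h] at hint
    have hm : Measurable fun x => (((crossSet T Set.univ c x).encard : ℕ∞) : ℝ≥0∞) := by
      simp_rw [encard_eq_tsum]
      refine Measurable.tsum fun i => ?_
      exact (measurable_const.indicator (measurableSet_cross MeasurableSet.univ hc i)).comp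
        (measurable_zpow T i)
    filter_upwards [ae_lt_top hm hint] with x hx
    rw [← Set.encard_lt_top_iff]
    exact ENat.toENNReal_lt_top.1 hx
  have h5 : ∀ᵐ x ∂μ, ∀ i : ℤ, (crossSet T Set.univ c ((T.1 ^ i) x)).Finite :=
    ae_all_iff.2 fun i => (measurePreserving_zpow T i).quasiMeasurePreserving.ae h4
  filter_upwards [h1, h3, h5] with x e1 e3 e5
  refine ⟨e1, ⟨fun i j hij => ?_, fun j => ?_⟩, fun p => ?_⟩
  · apply hT.zpow_inj (x := x)
    apply s.1.injective
    rw [e1, e1, ← zpow_add_apply, ← zpow_add_apply]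
    congr 2
    have : i + c ((T.1 ^ i) x) = j + c ((T.1 ^ j) x) := hij
    linarith
  · set y := s.1.symm ((T.1 ^ j) x) with hy
    have h6 := e3 j
    refine ⟨j - c y, ?_⟩
    have h7 : (T.1 ^ (j - c y)) x = y := by
      rw [sub_eq_neg_add, zpow_add_apply, h6, ← zpow_add_apply, neg_add_cancel, zpow_zero,
        Equiv.Perm.one_apply]
    rw [orbitMap, h7]
    ring
  · have h6 := e5 p
    rw [crossSet_eq] at h6
    have : orbitMap T c ((T.1 ^ p) x) = fun i => orbitMap T c x (i + p) - p := by
      funext i; exact orbitMap_zpow T c x p i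
    have e : {i : ℤ | (T.1 ^ i) ((T.1 ^ p) x) ∈ Set.univ} = Set.univ := by ext; simp
    rw [e, Set.univ_inter, Set.finite_union, this] at h6
    rw [← zero_add p, rightCross_translate, leftCross_translate]
    exact ⟨h6.1.image _, h6.2.image _⟩

/-- The flow is taken with real values so that ergodicity applies. Where a crossing set is infinite
the formula persists, since both `ncard` and `toReal` of `∞` are 0. -/
theorem measurable_flow (T : mpPerm μ) {c : X → ℤ} (hc : Measurable c) :
    Measurable fun x => ((flow (orbitMap T c x) 0 : ℤ) : ℝ) := by
  have hn : ∀ S : Set ℤ, (S.ncard : ℝ) =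
      (∑' i, S.indicator (fun _ => (1 : ℝ≥0∞)) i).toReal := fun S => by
    rw [← encard_eq_tsum, Set.ncard]
    by_cases h : S.Finite
    · rw [h.encard_eq_coe_toFinset_card]; simp
    · rw [Set.Infinite.encard_eq h]; simp
  simp only [flow, Int.cast_sub, Int.cast_natCast, hn]
  have hm : ∀ (i : ℤ) (P : ℤ → Prop), Measurable fun x =>
      {y | P (i + c y)}.indicator (fun _ => (1 : ℝ≥0∞)) ((T.1 ^ i) x) := fun i P =>
    (measurable_const.indicator
      (hc (MeasurableSet.of_discrete (s := {k : ℤ | P (i + k)})))).comp (measurable_zpow T i)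
  refine (Measurable.tsum fun i => ?_).ennreal_toReal.sub
    (Measurable.tsum fun i => ?_).ennreal_toReal
  · exact hm i fun k => i < 0 ∧ 0 ≤ k
  · exact hm i fun k => 0 ≤ i ∧ k < 0

/-- The flow of an element of the `L¹` full group of an ergodic transformation is constant. -/
theorem exists_flow_eq [NeZero μ] {T s : mpPerm μ} (herg : Ergodic T.1 μ)
    {c : X → ℤ} (hc : Measurable c) (hgood : ∀ᵐ x ∂μ, GoodPoint T s c x) :
    ∃ k : ℤ, ∀ᵐ x ∂μ, flow (orbitMap T c x) 0 = k := by
  have hinv : (fun x => ((flow (orbitMap T c x) 0 : ℤ) : ℝ)) ∘ T.1 =ᵐ[μ]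
      fun x => ((flow (orbitMap T c x) 0 : ℤ) : ℝ) := by
    filter_upwards [hgood] with x hx
    have h1 : orbitMap T c (T.1 x) = fun i => orbitMap T c x (i + 1) - 1 := by
      funext i
      have := orbitMap_zpow T c x 1 i
      rwa [zpow_one] at this
    simp only [Function.comp_apply]
    -- Passing from `x` to `T x` only moves the cut along the same orbit, so the flow is an
    -- invariant function.
    rw [h1, flow_translate, flow_eq hx.bij hx.fin]
  obtain ⟨r, hr⟩ := herg.ae_eq_const_of_ae_eq_comp₀ (measurable_flow T hc).nullMeasurable hinv
  obtain ⟨x, hx⟩ := hr.exists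
  refine ⟨flow (orbitMap T c x) 0, ?_⟩
  filter_upwards [hr] with y hy
  have : ((flow (orbitMap T c y) 0 : ℤ) : ℝ) = (flow (orbitMap T c x) 0 : ℤ) := hy.trans hx.symm
  exact_mod_cast this

end Cocycle

/-! ### Approximation by permutations of columns -/

section Approximation

variable {X : Type*} [MeasurableSpace X] {μ : Measure X}

/-- Labels of columns: a height and a permutation of the levels. -/
structure ColumnType (N : ℕ) where
  height : Fin (N + 1)
  perm : Equiv.Perm (Fin ((height : ℕ) + 1))

instance (N : ℕ) : Finite (ColumnType N) := by
  refine Finite.of_injective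
    (fun q => (⟨q.1, q.2⟩ : Σ h : Fin (N + 1), Equiv.Perm (Fin ((h : ℕ) + 1)))) ?_
  rintro ⟨h, σ⟩ ⟨h', σ'⟩ e
  simp only [Sigma.mk.injEq] at e
  obtain ⟨rfl, e⟩ := e
  rw [eq_of_heq e]

instance (N : ℕ) : MeasurableSpace (ColumnType N) := ⊤

instance (N : ℕ) : DiscreteMeasurableSpace (ColumnType N) := ⟨fun _ => trivial⟩

/-- The displacements `v` on a column of height `h + 1`, as a map on levels. -/
def columnMap {N : ℕ} (h : Fin (N + 1)) (v : Fin (N + 1) → ℤ) (i : Fin ((h : ℕ) + 1)) : ℤ :=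
  i + v (i.castLE h.2)

open Classical in
/-- The label of a column with given return time and displacements. -/
def columnType (N : ℕ) (y : ℕ × (Fin (N + 1) → ℤ)) : ColumnType N :=
  -- The truncation keeps the set of labels finite; return times are at most `N`, so it changes
  -- nothing on actual columns.
  ⟨⟨min (y.1 - 1) N, by omega⟩,
    if hg : Function.Injective (columnMap ⟨min (y.1 - 1) N, by omega⟩ y.2) then
      (exists_column_perm _ hg).choose else 1⟩

theorem columnType_spec {N : ℕ} {y : ℕ × (Fin (N + 1) → ℤ)}
    (hg : Function.Injective (columnMap (columnType N y).1 y.2)) :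
    (∀ i, 0 ≤ columnMap (columnType N y).1 y.2 i ∧
        columnMap (columnType N y).1 y.2 i < ((columnType N y).1 : ℕ) + 1 →
        (((columnType N y).2 i : ℕ) : ℤ) = columnMap (columnType N y).1 y.2 i) ∧
      ∀ p : ℤ, ((Finset.univ.filter fun i => ¬ (0 ≤ columnMap (columnType N y).1 y.2 i ∧
        columnMap (columnType N y).1 y.2 i < ((columnType N y).1 : ℕ) + 1) ∧
        ¬ ((i : ℤ) < p ↔ (((columnType N y).2 i : ℕ) : ℤ) < p)).card : ℤ) ≤
          |columnDefect (columnMap (columnType N y).1 y.2) p| := by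
  have h := (exists_column_perm _ hg).choose_spec
  have e : (columnType N y).2 = (exists_column_perm _ hg).choose := dif_pos hg
  rw [e]
  push_cast at h
  exact h

variable {T : mpPerm μ} {B : Set X} {N : ℕ}

/-- The castle over `B` whose columns are permuted as suggested by the cocycle `c`. -/
def cocycleCastle (T : mpPerm μ) (hB : MeasurableSet B) (hr : Recurrent T B N) {c : X → ℤ}
    (hc : Measurable c) : Castle T (ColumnType N) where
  B := B
  N := N
  H q := q.1
  label x := columnType N (wait T B x, fun i => c ((T.1 ^ ((i : ℕ) : ℤ)) x))
  measurableSet_B := hB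
  recurrent := hr
  measurable_label := (Measurable.of_discrete (f := columnType N)).comp
    ((hr.measurable_wait hB).prodMk
      (measurable_pi_lambda _ fun i => hc.comp (measurable_zpow T _)))
  wait_eq b _ := by
    have h1 := hr.wait_le b
    have h2 := (hr.wait_spec b).1
    change _ = min (wait T B b - 1) N + 1
    omega

/-- The points of a column that the cocycle moves out of the column. -/
def leavers (T : mpPerm μ) (B : Set X) (c : X → ℤ) : Set X :=
  {x | ¬ (-(level T B x : ℤ) ≤ c x ∧ c x < wait T B x)}

theorem measurableSet_leavers (hB : MeasurableSet B) (hr : Recurrent T B N) {c : X → ℤ}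
    (hc : Measurable c) : MeasurableSet (leavers T B c) := by
  have : Measurable fun x => (level T B x, wait T B x, c x) :=
    (hr.measurable_level hB).prodMk ((hr.measurable_wait hB).prodMk hc)
  exact this (MeasurableSet.of_discrete
    (s := {y : ℕ × ℕ × ℤ | ¬ (-(y.1 : ℤ) ≤ y.2.2 ∧ y.2.2 < y.2.1)}))

/-- A point moved by fewer than `M` steps can leave its column only if `B` is met within `M` steps
forwards or backwards, one of `2M + 1` translates of `B`. -/
theorem measure_leavers_le (hB : MeasurableSet B) (hr : Recurrent T B N) (c : X → ℤ)
    (M : ℕ) : μ (leavers T B c) ≤ μ {x | M ≤ (c x).natAbs} + (2 * M + 1 : ℕ) * μ B := by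
  have hsub : leavers T B c ⊆ {x | M ≤ (c x).natAbs} ∪
      ⋃ j ∈ Finset.Icc (-M : ℤ) M, (T.1 ^ j) ⁻¹' B := by
    intro x hx
    by_cases hM : M ≤ (c x).natAbs
    · exact Or.inl hM
    right
    simp only [leavers, Set.mem_ofPred_eq, not_and_or, not_le, not_lt] at hx
    simp only [Set.mem_iUnion, Set.mem_preimage, Finset.mem_Icc]
    rcases hx with hx | hx
    · exact ⟨-(level T B x : ℤ), by omega, hr.base_mem x⟩
    · exact ⟨wait T B x, by omega, (hr.wait_spec x).2⟩
  refine (measure_mono hsub).trans ((measure_union_le _ _).trans ?_)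
  gcongr
  refine (measure_biUnion_finset_le _ _).trans ?_
  simp_rw [fun j : ℤ => (measurePreserving_zpow T j).measure_preimage hB.nullMeasurableSet]
  rw [Finset.sum_const, Int.card_Icc, nsmul_eq_mul]
  gcongr
  omega

/-- A displacement confined to the column of its starting point does not enter or leave any other
column: that would mean passing a point of `B`. Here the columns of the orbit are read in
coordinates centred at `x`. -/
theorem Recurrent.stays (hr : Recurrent T B N) {x : X} {i k : ℤ}
    (h1 : -(level T B ((T.1 ^ i) x) : ℤ) ≤ k) (h2 : k < wait T B ((T.1 ^ i) x)) :
    (i < -(level T B x : ℤ) ∧ i + k < -(level T B x : ℤ)) ∨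
      ((-(level T B x : ℤ) ≤ i ∧ i < wait T B x) ∧
        (-(level T B x : ℤ) ≤ i + k ∧ i + k < wait T B x)) ∨
      ((wait T B x : ℤ) ≤ i ∧ (wait T B x : ℤ) ≤ i + k) := by
  rcases lt_or_ge i (-(level T B x : ℤ)) with hi | hi
  · left
    refine ⟨hi, ?_⟩
    by_contra hn
    refine notMem_of_between (T := T) (B := B) (x := (T.1 ^ i) x)
      (j := -(level T B x : ℤ) - i) (by omega) (by omega) ?_
    rw [← zpow_add_apply, sub_add_cancel]
    exact hr.base_mem x
  rcases lt_or_ge i (wait T B x : ℤ) with hi' | hi'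
  · right; left
    rw [hr.level_zpow hi hi'] at h1
    rw [hr.wait_zpow hi hi'] at h2
    omega
  · right; right
    refine ⟨hi', ?_⟩
    by_contra hn
    have := (hr.wait_spec ((T.1 ^ i) x)).1
    refine notMem_of_between (T := T) (B := B) (x := (T.1 ^ i) x)
      (j := (wait T B x : ℤ) - i) (by omega) (by omega) ?_
    rw [← zpow_add_apply, sub_add_cancel]
    exact (hr.wait_spec x).2

section

/-- The displacement under the castle permutation suggested by `c`. -/
def newCocycle (hB : MeasurableSet B) (hr : Recurrent T B N) {c : X → ℤ} (hc : Measurable c) :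
    X → ℤ := (cocycleCastle T hB hr hc).cocycle fun q => q.2

theorem zpow_base (n : ℤ) (x : X) :
    (T.1 ^ n) (base T B x) = (T.1 ^ (-(level T B x : ℤ) + n)) x := by
  rw [base, ← zpow_add_apply, add_comm]

theorem columnMap_eq (c : X → ℤ) (x : X) :
    columnMap (columnType N (wait T B (base T B x),
      fun i => c ((T.1 ^ ((i : ℕ) : ℤ)) (base T B x)))).1
      (fun i => c ((T.1 ^ ((i : ℕ) : ℤ)) (base T B x))) =
    fun i : Fin _ => orbitMap T c x (-(level T B x : ℤ) + i) - -(level T B x : ℤ) := by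
  funext i
  simp only [columnMap, orbitMap, Fin.val_castLE]
  rw [zpow_base]
  ring

theorem columnType_height (hr : Recurrent T B N) (c : X → ℤ) (x : X) :
    (((columnType N (wait T B (base T B x),
      fun i => c ((T.1 ^ ((i : ℕ) : ℤ)) (base T B x)))).1 : ℕ) : ℤ) + 1 =
      level T B x + wait T B x := by
  change ((min (wait T B (base T B x) - 1) N : ℕ) : ℤ) + 1 = _
  have h1 := hr.wait_le (base T B x)
  have h2 := hr.wait_base x
  have h3 := (hr.wait_spec x).1
  omega

variable (hB : MeasurableSet B) (hr : Recurrent T B N) {c : X → ℤ} (hc : Measurable c)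

theorem newCocycle_bounds (x : X) :
    -(level T B x : ℤ) ≤ newCocycle hB hr hc x ∧ newCocycle hB hr hc x < wait T B x := by
  have h := columnType_height hr c x
  have h2 := ((columnType N (wait T B (base T B x),
      fun i => c ((T.1 ^ ((i : ℕ) : ℤ)) (base T B x)))).2
        ⟨level T B x, (cocycleCastle T hB hr hc).level_lt x⟩).2
  have h3 : newCocycle hB hr hc x = (((columnType N (wait T B (base T B x),
      fun i => c ((T.1 ^ ((i : ℕ) : ℤ)) (base T B x)))).2
        ⟨level T B x, (cocycleCastle T hB hr hc).level_lt x⟩ : ℕ) : ℤ) - level T B x := rfl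
  rw [h3]
  omega

theorem newCocycle_zpow (x : X) (i : ℕ)
    (hi : i < ((columnType N (wait T B (base T B x),
      fun i => c ((T.1 ^ ((i : ℕ) : ℤ)) (base T B x)))).1 : ℕ) + 1) :
    newCocycle hB hr hc ((T.1 ^ (-(level T B x : ℤ) + i)) x) =
      (((columnType N (wait T B (base T B x),
      fun i => c ((T.1 ^ ((i : ℕ) : ℤ)) (base T B x)))).2 ⟨i, hi⟩ : ℕ) : ℤ) - i := by
  have := (cocycleCastle T hB hr hc).cocycle_zpow (fun q => q.2) (hr.base_mem x) ⟨i, hi⟩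
  rw [← zpow_base]
  exact this

variable {s : mpPerm μ} {x : X}

theorem orbitMap_column_injective (hx : Function.Injective (orbitMap T c x)) (n : ℕ) :
    Function.Injective fun i : Fin n =>
      orbitMap T c x (-(level T B x : ℤ) + i) - -(level T B x : ℤ) := by
  intro i j hij
  have h : orbitMap T c x (-(level T B x : ℤ) + i) = orbitMap T c x (-(level T B x : ℤ) + j) := by
    simpa using hij
  have := hx h
  ext; omega

/-- The completed permutation extends the partial injection, so nothing changes at points that stay
in their column. -/
theorem newCocycle_eq (hx : Function.Injective (orbitMap T c x)) (hD : x ∉ leavers T B c) :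
    newCocycle hB hr hc x = c x := by
  have hcm := columnMap_eq (T := T) (B := B) (N := N) c x
  have hinj := orbitMap_column_injective (B := B) hx
    (((columnType N (wait T B (base T B x),
      fun i => c ((T.1 ^ ((i : ℕ) : ℤ)) (base T B x)))).1 : ℕ) + 1)
  have hspec := (columnType_spec (N := N) (y := (wait T B (base T B x),
      fun i => c ((T.1 ^ ((i : ℕ) : ℤ)) (base T B x)))) (by rw [hcm]; exact hinj)).1
  simp only [hcm] at hspec
  have hh := columnType_height hr c x
  have hl := (cocycleCastle T hB hr hc).level_lt x
  have h1 := hspec ⟨level T B x, hl⟩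
  simp only [leavers, Set.mem_ofPred_eq, not_not] at hD
  have e : orbitMap T c x (-(level T B x : ℤ) + (level T B x : ℤ)) = c x := by
    simp [orbitMap]
  simp only [e] at h1
  have h2 := h1 (by omega)
  have h3 : newCocycle hB hr hc x = (((columnType N (wait T B (base T B x),
      fun i => c ((T.1 ^ ((i : ℕ) : ℤ)) (base T B x)))).2 ⟨level T B x, hl⟩ : ℕ) : ℤ)
        - level T B x := rfl
  rw [h3, h2]
  ring

/-- The heart of the estimate. New arrows remain in the column of `x`, so those from `D` that cross
the cut before `x` are counted by the monotone matching: at most the absolute defect, which zero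
flow bounds by the number of old crossings from `D`. -/
theorem encard_crossSet_newCocycle_le (hx : GoodPoint T s c x)
    (hflow : flow (orbitMap T c x) 0 = 0) :
    (crossSet T (leavers T B c) (newCocycle hB hr hc) x).encard ≤
      (crossSet T (leavers T B c) c x).encard := by
  classical
  set D := leavers T B c with hDdef
  have hcm := columnMap_eq (T := T) (B := B) (N := N) c x
  have hinj := orbitMap_column_injective (B := B) hx.bij.1
    (((columnType N (wait T B (base T B x),
      fun i => c ((T.1 ^ ((i : ℕ) : ℤ)) (base T B x)))).1 : ℕ) + 1)
  have hspec := (columnType_spec (N := N) (y := (wait T B (base T B x),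
      fun i => c ((T.1 ^ ((i : ℕ) : ℤ)) (base T B x)))) (by rw [hcm]; exact hinj)).2
      (level T B x)
  simp only [hcm] at hspec
  have hh := columnType_height hr c x
  set q := columnType N (wait T B (base T B x),
    fun i => c ((T.1 ^ ((i : ℕ) : ℤ)) (base T B x))) with hq
  have hnew : ∀ (i : ℕ) (hi : i < (q.1 : ℕ) + 1),
      newCocycle hB hr hc ((T.1 ^ (-(level T B x : ℤ) + i)) x) = ((q.2 ⟨i, hi⟩ : ℕ) : ℤ) - i :=
    newCocycle_zpow hB hr hc x
  set a : ℤ := -(level T B x : ℤ) with ha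
  have hw := (hr.wait_spec x).1
  -- In coordinates centred at `x` the column starts at `a`, and the cut at height `level T B x` of
  -- the column is the cut at 0.
  have habs := abs_columnDefect_le hx.bij hx.fin (a := a) (p := level T B x) (h := (q.1 : ℕ) + 1)
    (by omega) (by push_cast; omega) (by rw [ha, neg_add_cancel]; exact hflow)
    {i | (T.1 ^ i) x ∈ D} (fun i hi => by
      simp only [hDdef, leavers, Set.mem_ofPred_eq, not_not] at hi
      have := hr.stays hi.1 hi.2
      simp only [orbitMap]
      push_cast
      omega) (fun i hi h1 h2 h3 => by
      apply hi
      push_cast at h2 h3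
      rw [hr.level_zpow (by omega) (by omega), hr.wait_zpow (by omega) (by omega)]
      simp only [orbitMap] at h3
      omega)
  have hz : a + (level T B x : ℤ) = 0 := by omega
  rw [hz, ← crossSet_eq] at habs
  have hsub : crossSet T D (newCocycle hB hr hc) x ⊆
      (fun i : Fin ((q.1 : ℕ) + 1) => a + (i : ℤ)) '' ((Finset.univ.filter fun i =>
        ¬ (0 ≤ orbitMap T c x (a + (i : ℤ)) - a ∧
          orbitMap T c x (a + (i : ℤ)) - a < (q.1 : ℕ) + 1) ∧
        ¬ ((i : ℤ) < level T B x ↔ ((q.2 i : ℕ) : ℤ) < level T B x) :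
        Finset (Fin ((q.1 : ℕ) + 1))) : Set (Fin ((q.1 : ℕ) + 1))) := by
    rintro i ⟨h1, h2⟩
    have hb := newCocycle_bounds hB hr hc ((T.1 ^ i) x)
    have hst := hr.stays hb.1 hb.2
    have hcol : a ≤ i ∧ i < wait T B x := by omega
    obtain ⟨j, hj⟩ : ∃ j : ℕ, i = a + j := ⟨(i - a).toNat, by omega⟩
    subst hj
    have hj' : j < (q.1 : ℕ) + 1 := by omega
    refine ⟨⟨j, hj'⟩, ?_, rfl⟩
    rw [hnew j hj'] at h2
    simp only [Finset.coe_filter, Finset.mem_univ, true_and, Set.mem_ofPred_eq]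
    simp only [hDdef, leavers, Set.mem_ofPred_eq] at h1
    rw [hr.level_zpow hcol.1 hcol.2, hr.wait_zpow hcol.1 hcol.2] at h1
    simp only [orbitMap]
    omega
  have hfin : (crossSet T D c x).Finite := by
    rw [crossSet_eq]
    exact ((hx.fin 0).1.union (hx.fin 0).2).inter_of_right _
  refine (Set.encard_le_encard hsub).trans ?_
  refine (Set.encard_image_le _ _).trans ?_
  rw [Set.encard_coe_eq_coe_finsetCard, ← hfin.cast_ncard_eq]
  exact_mod_cast hspec.trans habs

end

/-- Off `leavers` nothing changes; on it the error is at most the old plus the new displacement. The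
pointwise comparison of crossings, integrated, bounds the new displacement by the old one. The
remaining `2 * μ B` pays for odd permutations. -/
theorem exists_castle_perm (hB : MeasurableSet B) (hr : Recurrent T B N)
    {c : X → ℤ} (hc : Measurable c) {s : mpPerm μ} (hgood : ∀ᵐ x ∂μ, GoodPoint T s c x)
    (hflow : ∀ᵐ x ∂μ, flow (orbitMap T c x) 0 = 0) (K : Subgroup (mpPerm μ)) (hTK : T ∈ K)
    (hK : ∀ E ⊆ B, MeasurableSet E → swapInv T E * swapInv T (T.1 '' E) ∈ K)
    [MeasurableEq X] :
    ∃ k ∈ K, l1Dist T (s : Aut μ) (k : Aut μ) ≤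
      2 * ∫⁻ x in leavers T B c, ((c x).natAbs : ℝ≥0∞) ∂μ + 2 * μ B := by
  set C := cocycleCastle T hB hr hc with hC
  obtain ⟨k, hk, hkd⟩ := C.exists_mem_l1Dist_le K hTK hK fun q => q.2
  refine ⟨k, hk, (l1Dist_triangle T _ (C.mpHom fun q => q.2 : Aut μ) _).trans
    (add_le_add ?_ hkd)⟩
  have hD := measurableSet_leavers hB hr hc
  have hc' : Measurable (newCocycle hB hr hc) := C.measurable_cocycle _
  rw [l1Dist_mk]
  calc _ ≤ ∫⁻ x, (leavers T B c).indicator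
        (fun x => ((c x).natAbs : ℝ≥0∞) + ((newCocycle hB hr hc x).natAbs : ℝ≥0∞)) x ∂μ := by
        refine lintegral_mono_ae ?_
        filter_upwards [hgood] with x hx
        have e1 : s.1 x = (T.1 ^ c x) x := by
          have := hx.eq 0
          simpa only [zpow_zero, Equiv.Perm.one_apply] using this
        have e2 : (C.mpHom fun q => q.2).1 x = (T.1 ^ newCocycle hB hr hc x) x :=
          C.permHom_apply_cocycle _ x
        by_cases hxD : x ∈ leavers T B c
        · rw [Set.indicator_of_mem hxD, e1, e2]
          refine (orbDist_le T.1 (newCocycle hB hr hc x - c x) ?_).trans ?_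
          · rw [← zpow_add_apply, sub_add_cancel]
          · have : (newCocycle hB hr hc x - c x).natAbs ≤
                (c x).natAbs + (newCocycle hB hr hc x).natAbs := by omega
            exact_mod_cast this
        · rw [e1, e2, newCocycle_eq hB hr hc hx.bij.1 hxD, orbDist_self]
          exact zero_le
    _ = ∫⁻ x in leavers T B c, ((c x).natAbs : ℝ≥0∞) ∂μ +
        ∫⁻ x in leavers T B c, ((newCocycle hB hr hc x).natAbs : ℝ≥0∞) ∂μ := by
        rw [lintegral_indicator hD, lintegral_add_left]
        exact (Measurable.of_discrete (f := fun k : ℤ => ((k.natAbs : ℕ) : ℝ≥0∞))).comp hc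
    _ ≤ _ := by
        rw [two_mul]
        gcongr ?_ + ?_
        · exact le_rfl
        · rw [← lintegral_encard_crossSet T hD hc', ← lintegral_encard_crossSet T hD hc]
          refine lintegral_mono_ae ?_
          filter_upwards [hgood, hflow] with x hx hf
          exact ENat.toENNReal_le.2 (encard_crossSet_newCocycle_le hB hr hc hx hf)

/-- A subgroup containing `T` and the cycles `(E, T E, T² E)`, for all small sets `E` over uniformly
recurrent bases of arbitrarily small measure, is dense in the `L¹` full group. -/
theorem exists_mem_l1Dist_lt [MeasurableEq X] [IsFiniteMeasure μ] [NeZero μ]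
    (hT : IsFree T.1) (herg : Ergodic T.1 μ)
    (K : Subgroup (mpPerm μ)) (hTK : T ∈ K)
    (hK : ∀ δ : ℝ≥0∞, 0 < δ → ∃ (B : Set X) (N : ℕ), MeasurableSet B ∧ μ B < δ ∧
      Recurrent T B N ∧ ∀ E ⊆ B, MeasurableSet E → swapInv T E * swapInv T (T.1 '' E) ∈ K)
    (s : mpPerm μ) (hs : ∀ᵐ x ∂μ, ∃ k : ℤ, s.1 x = (T.1 ^ k) x)
    (hint : l1Dist T 1 (s : Aut μ) ≠ ∞) (ε : ℝ≥0∞) (hε : 0 < ε) :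
    ∃ k ∈ K, l1Dist T (s : Aut μ) (k : Aut μ) < ε := by
  have main : ∀ (s : mpPerm μ) (c : X → ℤ), Measurable c → (∀ᵐ x ∂μ, GoodPoint T s c x) →
      (∀ᵐ x ∂μ, flow (orbitMap T c x) 0 = 0) → ∫⁻ x, ((c x).natAbs : ℝ≥0∞) ∂μ ≠ ∞ →
      ∃ k ∈ K, l1Dist T (s : Aut μ) (k : Aut μ) < ε := by
    intro s c hc hgood hflow hint
    have h0 : 0 < ε / 2 / 2 := ENNReal.half_pos (ENNReal.half_pos hε.ne').ne'
    -- Absolute continuity of the integral reduces the estimate to `leavers` having measure below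
    -- `δ`. Half of `δ` covers displacements of size at least `M`, by Markov's inequality; the other
    -- half is obtained by shrinking `B`.
    obtain ⟨δ, hδ, hδ'⟩ := exists_pos_setLIntegral_lt_of_measure_lt hint h0.ne'
    obtain ⟨M, hM0, hM⟩ := ENNReal.exists_nat_pos_mul_gt (ENNReal.half_pos hδ.ne').ne' hint
    have hM1 : μ {x | M ≤ (c x).natAbs} < δ / 2 := by
      have h1 := meas_ge_le_lintegral_div (μ := μ)
        (Measurable.of_discrete (f := fun k : ℤ => ((k.natAbs : ℕ) : ℝ≥0∞)) |>.comp hc).aemeasurable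
        (ε := (M : ℝ≥0∞)) (by exact_mod_cast hM0.ne') (ENNReal.natCast_ne_top M)
      have e : {x | M ≤ (c x).natAbs} =
          {x | (M : ℝ≥0∞) ≤ ((fun k : ℤ => ((k.natAbs : ℕ) : ℝ≥0∞)) ∘ c) x} := by
        ext x; simp
      rw [e]
      refine h1.trans_lt (ENNReal.div_lt_of_lt_mul' hM)
    obtain ⟨B, N, hB, hBμ, hr, hBK⟩ := hK (min (ε / 2 / 2) (δ / 2 / (2 * M + 1 : ℕ)))
      (lt_min h0 (ENNReal.div_pos (ENNReal.half_pos hδ.ne').ne' (ENNReal.natCast_ne_top _)))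
    obtain ⟨k, hk, hkd⟩ := exists_castle_perm hB hr hc hgood hflow K hTK hBK
    refine ⟨k, hk, hkd.trans_lt ?_⟩
    have hDδ : μ (leavers T B c) < δ := by
      refine (measure_leavers_le hB hr c M).trans_lt ?_
      rw [← ENNReal.add_halves δ]
      refine ENNReal.add_lt_add hM1 ?_
      rw [mul_comm]
      exact ENNReal.mul_lt_of_lt_div (hBμ.trans_le (min_le_right _ _))
    have two : ∀ t : ℝ≥0∞, t < ε / 2 / 2 → 2 * t < ε / 2 := fun t ht => by
      rw [mul_comm]
      exact ENNReal.mul_lt_of_lt_div ht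
    rw [← ENNReal.add_halves ε]
    exact ENNReal.add_lt_add (two _ (hδ' _ hDδ)) (two _ (hBμ.trans_le (min_le_left _ _)))
  obtain ⟨c, hc, hcs⟩ := exists_cocycle hT s
  have hs' : ∀ᵐ x ∂μ, s.1 x = (T.1 ^ c x) x := by
    filter_upwards [hs] with x hx using hcs x hx
  have hintc : ∫⁻ x, ((c x).natAbs : ℝ≥0∞) ∂μ ≠ ∞ := by
    rw [← QuotientGroup.mk_one, l1Dist_mk] at hint
    convert hint using 1
    refine lintegral_congr_ae ?_
    filter_upwards [hs'] with x hx
    rw [hx, ← hT.orbDist_zpow]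
    rfl
  have hgood := ae_goodPoint hT hc hs' hintc
  obtain ⟨m, hm⟩ := exists_flow_eq herg hc hgood
  -- The cocycle of `s * T ^ (-m)`, whose flow is zero; the power of `T` is put back at the end by
  -- right invariance.
  set c' : X → ℤ := fun x => c ((T.1 ^ (-m)) x) - m with hc'def
  have hc' : Measurable c' := (hc.comp (measurable_zpow T (-m))).sub_const m
  have hs2 : ∀ᵐ x ∂μ, (s * T ^ (-m)).1 x = (T.1 ^ c' x) x := by
    filter_upwards [(measurePreserving_zpow T (-m)).quasiMeasurePreserving.ae hs'] with x hx
    have e : c' x = c ((T.1 ^ (-m)) x) + -m := sub_eq_add_neg _ _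
    rw [e, zpow_add_apply, ← hx]
    rfl
  have hint' : ∫⁻ x, ((c' x).natAbs : ℝ≥0∞) ∂μ ≠ ∞ := by
    have hle : ∫⁻ x, ((c' x).natAbs : ℝ≥0∞) ∂μ ≤
        ∫⁻ x, (((c ((T.1 ^ (-m)) x)).natAbs : ℝ≥0∞) + (m.natAbs : ℝ≥0∞)) ∂μ := by
      refine lintegral_mono fun x => ?_
      have : (c' x).natAbs ≤ (c ((T.1 ^ (-m)) x)).natAbs + m.natAbs := by
        simp only [hc'def]; omega
      rw [← Nat.cast_add]
      exact Nat.cast_le.2 this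
    refine ne_top_of_le_ne_top ?_ hle
    rw [lintegral_add_right _ measurable_const, lintegral_const,
      (measurePreserving_zpow T (-m)).lintegral_comp (f := fun x => ((c x).natAbs : ℝ≥0∞))
        ((Measurable.of_discrete (f := fun k : ℤ => ((k.natAbs : ℕ) : ℝ≥0∞))).comp hc)]
    exact ENNReal.add_ne_top.2 ⟨hintc, ENNReal.mul_ne_top (ENNReal.natCast_ne_top _)
      (measure_ne_top μ _)⟩
  have hflow : ∀ᵐ x ∂μ, flow (orbitMap T c' x) 0 = 0 := by
    filter_upwards [hgood, hm] with x hx hmx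
    have e : orbitMap T c' x = fun i => orbitMap T c x (i - m) := by
      funext i
      simp only [orbitMap, hc'def, ← zpow_add_apply]
      rw [neg_add_eq_sub]
      ring
    rw [e, flow_shift hx.fin, hmx, sub_self]
  obtain ⟨k, hk, hkd⟩ := main _ c' hc' (ae_goodPoint hT hc' hs2 hint') hflow hint'
  refine ⟨k * T ^ m, mul_mem hk (zpow_mem hTK m), ?_⟩
  rw [← l1Dist_mul_right T _ _ ((T ^ m : mpPerm μ) : Aut μ), ← QuotientGroup.mk_mul,
    ← QuotientGroup.mk_mul] at hkd
  rwa [mul_assoc, ← zpow_add, neg_add_cancel, zpow_zero, mul_one] at hkd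

end Approximation

/-! ### Cycles of length three -/

section Cycle

variable {X : Type*} [MeasurableSpace X] {μ : Measure X}

/-- The cycle `(E, T E, T² E)`. -/
def cycle (T : mpPerm μ) (E : Set X) : mpPerm μ := swapInv T E * swapInv T (T.1 '' E)

/-- `E`, `T E` and `T² E` are pairwise disjoint. -/
structure Cyclable (T : mpPerm μ) (E : Set X) : Prop where
  meas : MeasurableSet E
  disj : ∀ x ∈ E, T.1 x ∉ E
  disj2 : ∀ x ∈ E, T.1 (T.1 x) ∉ E

variable {T : mpPerm μ} {E F : Set X}

theorem Cyclable.mono (h : Cyclable T F) (hE : MeasurableSet E) (hEF : E ⊆ F) : Cyclable T E :=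
  ⟨hE, fun x hx hx' => h.disj x (hEF hx) (hEF hx'),
    fun x hx hx' => h.disj2 x (hEF hx) (hEF hx')⟩

theorem Cyclable.swappable (h : Cyclable T E) : Swappable T E :=
  ⟨h.meas, Set.disjoint_left.2 fun _ hx ⟨y, hy, e⟩ => h.disj y hy (e ▸ hx)⟩

theorem Cyclable.swappable' (h : Cyclable T E) : Swappable T (T.1 '' E) :=
  h.swappable.image (Commute.refl T)

theorem cycle_apply_zero (h : Cyclable T E) {x : X} (hx : x ∈ E) : (cycle T E).1 x = T.1 x := by
  change (swapInv T E).1 ((swapInv T (T.1 '' E)).1 x) = _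
  rw [swapInv_apply_notMem h.swappable', swapInv_apply_mem h.swappable hx]
  · rintro ⟨y, hy, rfl⟩; exact h.disj y hy hx
  · rintro ⟨_, ⟨y, hy, rfl⟩, rfl⟩; exact h.disj2 y hy hx

theorem cycle_apply_one (h : Cyclable T E) {x : X} (hx : x ∈ E) :
    (cycle T E).1 (T.1 x) = T.1 (T.1 x) := by
  change (swapInv T E).1 ((swapInv T (T.1 '' E)).1 (T.1 x)) = _
  rw [swapInv_apply_mem h.swappable' ⟨x, hx, rfl⟩, swapInv_apply_notMem h.swappable (h.disj2 x hx)]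
  rintro ⟨y, hy, e⟩
  exact h.disj x hx (T.1.injective e ▸ hy)

theorem cycle_apply_two (h : Cyclable T E) {x : X} (hx : x ∈ E) :
    (cycle T E).1 (T.1 (T.1 x)) = x := by
  change (swapInv T E).1 ((swapInv T (T.1 '' E)).1 (T.1 (T.1 x))) = _
  rw [swapInv_apply_image h.swappable' ⟨x, hx, rfl⟩, swapInv_apply_image h.swappable hx]

theorem cycle_apply_notMem (h : Cyclable T E) {x : X} (h0 : x ∉ E) (h1 : x ∉ T.1 '' E)
    (h2 : x ∉ T.1 '' (T.1 '' E)) : (cycle T E).1 x = x := by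
  change (swapInv T E).1 ((swapInv T (T.1 '' E)).1 x) = _
  rw [swapInv_apply_notMem h.swappable' h1 h2, swapInv_apply_notMem h.swappable h0 h1]

theorem cycle_pow_three (h : Cyclable T E) : cycle T E ^ 3 = 1 := by
  apply Subtype.ext
  ext x
  change (cycle T E).1 ((cycle T E).1 ((cycle T E).1 x)) = x
  by_cases h0 : x ∈ E
  · rw [cycle_apply_zero h h0, cycle_apply_one h h0, cycle_apply_two h h0]
  by_cases h1 : x ∈ T.1 '' E
  · obtain ⟨y, hy, rfl⟩ := h1
    rw [cycle_apply_one h hy, cycle_apply_two h hy, cycle_apply_zero h hy]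
  by_cases h2 : x ∈ T.1 '' (T.1 '' E)
  · obtain ⟨_, ⟨y, hy, rfl⟩, rfl⟩ := h2
    rw [cycle_apply_two h hy, cycle_apply_zero h hy, cycle_apply_one h hy]
  · rw [cycle_apply_notMem h h0 h1 h2, cycle_apply_notMem h h0 h1 h2,
      cycle_apply_notMem h h0 h1 h2]

theorem cycle_empty (T : mpPerm μ) : cycle T ∅ = 1 := by
  rw [cycle, Set.image_empty, swapInv_empty, one_mul]

theorem cycle_stepBounded (T : mpPerm μ) (E : Set X) : StepBounded T (cycle T E) (1 + 1) :=
  (swapInv_stepBounded T _).mul (swapInv_stepBounded T _)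

/-- Splitting both involutions leaves the factors of `F` and of `T(E)` in the wrong order; their
supports `F ∪ T(F)` and `T(E) ∪ T²(E)` are disjoint because `E ∪ F` is cyclable. -/
theorem cycle_union (h : Cyclable T (E ∪ F)) (hE : MeasurableSet E) (hF : MeasurableSet F)
    (hd : Disjoint E F) : cycle T (E ∪ F) = cycle T E * cycle T F := by
  have cE := h.mono hE Set.subset_union_left
  have cF := h.mono hF Set.subset_union_right
  have h' := h.swappable'
  rw [Set.image_union] at h'
  have hd' : Disjoint (T.1 '' E) (T.1 '' F) := (Set.disjoint_image_iff T.1.injective).2 hd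
  have hcomm : Commute (swapInv T (T.1 '' E)) (swapInv T F) := by
    refine commute_swapInv_of_disjoint cE.swappable' cF.swappable ?_
    rw [Set.disjoint_union_left, Set.disjoint_union_right, Set.disjoint_union_right]
    refine ⟨⟨?_, hd'⟩, ?_, ?_⟩
    · rw [Set.disjoint_left]
      rintro _ ⟨x, hx, rfl⟩ hx'
      exact h.disj x (Or.inl hx) (Or.inr hx')
    · rw [Set.disjoint_left]
      rintro _ ⟨_, ⟨x, hx, rfl⟩, rfl⟩ hx'
      exact h.disj2 x (Or.inl hx) (Or.inr hx')
    · rw [Set.disjoint_image_iff T.1.injective, Set.disjoint_left]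
      rintro _ ⟨x, hx, rfl⟩ hx'
      exact h.disj x (Or.inl hx) (Or.inr hx')
  rw [cycle, Set.image_union, swapInv_union h.swappable hE hF hd,
    swapInv_union h' (measurableSet_image T hE) (measurableSet_image T hF) hd', cycle, cycle]
  simp only [mul_assoc]
  rw [← mul_assoc (swapInv T F), ← hcomm.eq, mul_assoc]

/-- Changing the right factor costs `3 · 4`, the 3 being the Lipschitz constant of the left
involution, and changing the left factor costs 4. -/
theorem l1Dist_cycle_le [MeasurableEq X] (hE : Cyclable T E) (hF : Cyclable T F) :
    l1Dist T (cycle T E : Aut μ) (cycle T F : Aut μ) ≤ 16 * μ (symmDiff E F) := by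
  simp only [cycle, QuotientGroup.mk_mul]
  refine (l1Dist_triangle T _ ((swapInv T E : Aut μ) * (swapInv T (T.1 '' F) : Aut μ)) _).trans ?_
  rw [l1Dist_mul_right]
  have h1 := l1Dist_mul_left_le (swapInv_stepBounded T E) (swapInv T (T.1 '' E) : Aut μ)
    (swapInv T (T.1 '' F) : Aut μ)
  have h2 := l1Dist_swapInv_le hE.swappable' hF.swappable'
  rw [← Set.image_symmDiff T.1.injective, measure_image T (hE.meas.symmDiff hF.meas)] at h2
  have h3 := l1Dist_swapInv_le hE.swappable hF.swappable
  calc _ ≤ ((2 * 1 + 1 : ℕ) : ℝ≥0∞) * (4 * μ (symmDiff E F)) + 4 * μ (symmDiff E F) := by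
        gcongr
        exact h1.trans (by gcongr)
    _ = 16 * μ (symmDiff E F) := by push_cast; ring

/-- An element with trivial cube is the square of its square. -/
theorem cycle_mem_of_sq_mem {K : Subgroup (mpPerm μ)} (h : Cyclable T E)
    (hK : cycle T E ^ 2 ∈ K) : cycle T E ∈ K := by
  have : cycle T E = (cycle T E ^ 2) ^ 2 := by
    rw [← pow_mul, show 2 * 2 = 3 + 1 by norm_num, pow_succ, cycle_pow_three h, one_mul]
  rw [this]
  exact pow_mem hK 2

theorem cycle_image_mem {K : Subgroup (mpPerm μ)} {g : mpPerm μ} (hg : Commute g T)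
    (hgK : g ∈ K) (h : cycle T E ∈ K) : cycle T (g.1 '' E) ∈ K := by
  have e : T.1 '' (g.1 '' E) = g.1 '' (T.1 '' E) := by
    rw [Set.image_image, Set.image_image]
    exact Set.image_congr fun x _ => (congrArg (fun p : mpPerm μ => p.1 x) hg.eq).symm
  rw [cycle, e, ← conj_swapInv hg, ← conj_swapInv hg, conj_mul]
  exact mul_mem (mul_mem hgK h) (inv_mem hgK)

/-- If a closed group contains the cycle on `B ∩ r⁻¹(]-∞, a[)` for every `a`, then it contains the
cycles on all subsets of `B` that are measurable with respect to `r`. -/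
theorem cycle_mem_of_Iio [MeasurableEq X] [IsFiniteMeasure μ] {H : Subgroup (mpPerm μ)}
    {B : Set X} (hB : Cyclable T B) {r : X → ℝ} (hr : Measurable r)
    (h : ∀ a : ℝ, cycle T (B ∩ r ⁻¹' Set.Iio a) ∈ approxGroup T H)
    {S : Set ℝ} (hS : MeasurableSet S) : cycle T (B ∩ r ⁻¹' S) ∈ approxGroup T H := by
  -- The whole of `B` is exhausted by the sublevel sets `r < n`, as `r` is finite; it is needed for
  -- complements.
  have hBK : cycle T B ∈ approxGroup T H := by
    refine mem_approxGroup_of_approx (cycle_stepBounded T B) fun ε hε => ?_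
    have ht : Filter.Tendsto (fun n : ℕ => μ (B \ r ⁻¹' Set.Iio (n : ℝ))) Filter.atTop
        (nhds (μ (⋂ n : ℕ, B \ r ⁻¹' Set.Iio (n : ℝ)))) := by
      refine tendsto_measure_iInter_atTop (fun n => ?_) ?_ ⟨0, measure_ne_top μ _⟩
      · exact (hB.meas.diff (hr measurableSet_Iio)).nullMeasurableSet
      · intro m n hmn
        refine Set.sdiff_subset_sdiff_right (Set.preimage_mono (Set.Iio_subset_Iio ?_))
        exact_mod_cast hmn
    have he : (⋂ n : ℕ, B \ r ⁻¹' Set.Iio (n : ℝ)) = ∅ := by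
      rw [Set.eq_empty_iff_forall_notMem]
      intro x hx
      obtain ⟨n, hn⟩ := exists_nat_gt (r x)
      exact (Set.mem_iInter.1 hx n).2 hn
    rw [he, measure_empty] at ht
    obtain ⟨n, hn⟩ := (ht.eventually (gt_mem_nhds (ENNReal.div_pos hε.ne'
      (ENNReal.natCast_ne_top 16)))).exists
    refine ⟨_, h n, (l1Dist_cycle_le hB (hB.mono (hB.meas.inter (hr measurableSet_Iio))
      Set.inter_subset_left)).trans_lt ?_⟩
    have e : symmDiff B (B ∩ r ⁻¹' Set.Iio (n : ℝ)) = B \ r ⁻¹' Set.Iio (n : ℝ) := by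
      ext x; simp only [Set.mem_symmDiff, Set.mem_inter_iff, Set.mem_sdiff]; tauto
    rw [e, mul_comm]
    exact ENNReal.mul_lt_of_lt_div (by exact_mod_cast hn)
  have hm : ∀ S, MeasurableSet S → MeasurableSet (B ∩ r ⁻¹' S) := fun S hS => hB.meas.inter (hr hS)
  have hc : ∀ S, MeasurableSet S → Cyclable T (B ∩ r ⁻¹' S) := fun S hS =>
    hB.mono (hm S hS) Set.inter_subset_left
  -- The sets whose cycle lies in the group form a λ-system: complements and finite disjoint unions
  -- by multiplicativity, countable ones by continuity in measure. It contains the π-system of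
  -- half-lines.
  induction S, hS using MeasurableSpace.induction_on_inter (borel_eq_generateFrom_Iio ℝ ▸
      BorelSpace.measurable_eq) isPiSystem_Iio with
  | empty => rw [Set.preimage_empty, Set.inter_empty, cycle_empty]; exact one_mem _
  | basic S hS => obtain ⟨a, rfl⟩ := hS; exact h a
  | compl S hS ih =>
    have e : B ∩ r ⁻¹' Sᶜ ∪ B ∩ r ⁻¹' S = B := by
      ext x; simp only [Set.mem_union, Set.mem_inter_iff, Set.mem_preimage, Set.mem_compl_iff]
      tauto
    have := cycle_union (T := T) (E := B ∩ r ⁻¹' Sᶜ) (F := B ∩ r ⁻¹' S) (by rwa [e])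
      (hm _ hS.compl) (hm _ hS) (by
        rw [Set.disjoint_left]
        rintro x ⟨-, h1⟩ ⟨-, h2⟩
        exact h1 h2)
    rw [e] at this
    rw [← mul_inv_eq_iff_eq_mul] at this
    rw [← this]
    exact mul_mem hBK (inv_mem ih)
  | iUnion f hd hf ih =>
    have hpart : ∀ n : ℕ, cycle T (B ∩ r ⁻¹' ⋃ i ∈ Finset.range n, f i) ∈ approxGroup T H := by
      intro n
      induction n with
      | zero => simp only [Finset.range_zero, Finset.notMem_empty, Set.iUnion_of_empty,
          Set.iUnion_empty, Set.preimage_empty, Set.inter_empty, cycle_empty]; exact one_mem _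
      | succ n ihn =>
        have e : B ∩ r ⁻¹' ⋃ i ∈ Finset.range (n + 1), f i =
            B ∩ r ⁻¹' f n ∪ B ∩ r ⁻¹' ⋃ i ∈ Finset.range n, f i := by
          rw [Finset.range_add_one, Finset.set_biUnion_insert, Set.preimage_union,
            Set.inter_union_distrib_left]
        have hmn : MeasurableSet (⋃ i ∈ Finset.range n, f i) :=
          Finset.measurableSet_biUnion _ fun i _ => hf i
        rw [e, cycle_union _ (hm _ (hf n)) (hm _ hmn)]
        · exact mul_mem (ih n) ihn
        · rw [Set.disjoint_left]
          rintro x ⟨-, h1⟩ ⟨-, h2⟩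
          simp only [Set.mem_preimage, Set.mem_iUnion, Finset.mem_range] at h1 h2
          obtain ⟨i, hi, h2⟩ := h2
          exact Set.disjoint_left.1 (hd hi.ne') h1 h2
        · rw [← Set.inter_union_distrib_left, ← Set.preimage_union]
          exact hc _ ((hf n).union hmn)
    have hU : MeasurableSet (⋃ i, f i) := MeasurableSet.iUnion hf
    have hUn : ∀ n, MeasurableSet (⋃ i ∈ Finset.range n, f i) := fun n =>
      Finset.measurableSet_biUnion _ fun i _ => hf i
    refine mem_approxGroup_of_approx (cycle_stepBounded T _) fun ε hε => ?_
    have ht : Filter.Tendsto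
        (fun n : ℕ => μ (r ⁻¹' (⋃ i, f i) \ r ⁻¹' ⋃ i ∈ Finset.range n, f i)) Filter.atTop
        (nhds (μ (⋂ n : ℕ, r ⁻¹' (⋃ i, f i) \ r ⁻¹' ⋃ i ∈ Finset.range n, f i))) := by
      refine tendsto_measure_iInter_atTop (fun n => ?_) ?_ ⟨0, measure_ne_top μ _⟩
      · exact ((hr hU).diff (hr (hUn n))).nullMeasurableSet
      · intro m n hmn
        refine Set.sdiff_subset_sdiff_right (Set.preimage_mono ?_)
        exact Set.biUnion_subset_biUnion_left (Finset.range_mono hmn)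
    have he : (⋂ n : ℕ, r ⁻¹' (⋃ i, f i) \ r ⁻¹' ⋃ i ∈ Finset.range n, f i) = ∅ := by
      rw [Set.eq_empty_iff_forall_notMem]
      intro x hx
      obtain ⟨n, hn⟩ := Set.mem_iUnion.1 (Set.mem_iInter.1 hx 0).1
      apply (Set.mem_iInter.1 hx (n + 1)).2
      simp only [Set.mem_preimage, Set.mem_iUnion, Finset.mem_range]
      exact ⟨n, by omega, hn⟩
    rw [he, measure_empty] at ht
    obtain ⟨n, hn⟩ := (ht.eventually (gt_mem_nhds (ENNReal.div_pos hε.ne'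
      (ENNReal.natCast_ne_top 16)))).exists
    refine ⟨_, hpart n, (l1Dist_cycle_le (hc _ hU) (hc _ (hUn n))).trans_lt ?_⟩
    rw [mul_comm]
    refine ENNReal.mul_lt_of_lt_div ((measure_mono ?_).trans_lt (by exact_mod_cast hn))
    intro x hx
    have hsub : (⋃ i ∈ Finset.range n, f i) ⊆ ⋃ i, f i :=
      Set.iUnion₂_subset fun i _ => Set.subset_iUnion f i
    rcases hx with ⟨⟨h1, h2⟩, h3⟩ | ⟨⟨h1, h2⟩, h3⟩
    · exact ⟨h2, fun h => h3 ⟨h1, h⟩⟩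
    · exact absurd ⟨h1, hsub h2⟩ h3

end Cycle

/-! ### Extracting short cycles from the rotation and one involution -/

section Rotation

open Filter Topology

/-- The translation by `θ` of the circle. -/
def translation (θ : UnitAddCircle) : mpPerm (volume : Measure UnitAddCircle) :=
  ⟨Equiv.addLeft θ, measurePreserving_add_left volume θ, measurePreserving_add_left volume (-θ)⟩

theorem rotation_eq (α : ℝ) : rotation α = translation (α : UnitAddCircle) := rfl

theorem translation_apply (θ x : UnitAddCircle) : (translation θ).1 x = θ + x := rfl

theorem translation_mul (θ η : UnitAddCircle) :
    translation θ * translation η = translation (θ + η) := by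
  apply Subtype.ext
  ext x
  exact (add_assoc θ η x).symm

theorem translation_zero : translation 0 = 1 := by
  apply Subtype.ext
  ext x
  exact zero_add x

theorem translation_commute (θ η : UnitAddCircle) : Commute (translation θ) (translation η) := by
  rw [Commute, SemiconjBy, translation_mul, translation_mul, add_comm]

theorem translation_zpow (θ : UnitAddCircle) (n : ℤ) : translation θ ^ n = translation (n • θ) := by
  have h : ∀ n : ℕ, translation θ ^ n = translation (n • θ) := fun n => by
    induction n with
    | zero => rw [pow_zero, zero_smul, translation_zero]
    | succ n ih => rw [pow_succ, ih, translation_mul, succ_nsmul]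
  obtain ⟨n, rfl | rfl⟩ := n.eq_nat_or_neg
  · rw [zpow_natCast, h, natCast_zsmul]
  · rw [zpow_neg, zpow_natCast, h, neg_smul, natCast_zsmul]
    refine inv_eq_of_mul_eq_one_right ?_
    rw [translation_mul, add_neg_cancel, translation_zero]

theorem translation_image_image (θ η : UnitAddCircle) (A : Set UnitAddCircle) :
    (translation θ).1 '' ((translation η).1 '' A) = (translation (θ + η)).1 '' A := by
  rw [Set.image_image]
  exact Set.image_congr fun x _ => (add_assoc θ η x).symm

theorem translation_zero_image (A : Set UnitAddCircle) : (translation 0).1 '' A = A := by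
  rw [translation_zero]
  exact Set.image_id A

/-- The representative in `[0, 1[` of a point of the circle. -/
def rep (x : UnitAddCircle) : ℝ := (AddCircle.equivIco 1 0 x : ℝ)

theorem rep_mem (x : UnitAddCircle) : 0 ≤ rep x ∧ rep x < 1 := by
  have := (AddCircle.equivIco 1 0 x).2
  exact ⟨this.1, this.2.trans_eq (zero_add 1)⟩

theorem coe_rep (x : UnitAddCircle) : ((rep x : ℝ) : UnitAddCircle) = x :=
  (AddCircle.equivIco 1 0).symm_apply_apply x

theorem rep_coe {t : ℝ} (h0 : 0 ≤ t) (h1 : t < 1) : rep (t : UnitAddCircle) = t :=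
  congrArg Subtype.val ((AddCircle.equivIco 1 0).apply_symm_apply ⟨t, by simpa using ⟨h0, h1⟩⟩)

theorem measurable_rep : Measurable rep :=
  measurable_subtype_coe.comp (AddCircle.measurableEquivIco 1 0).measurable

theorem mem_translation_arc {δ β : ℝ} (h0 : 0 ≤ δ) (h1 : δ + β ≤ 1) (x : UnitAddCircle) :
    x ∈ (translation (δ : UnitAddCircle)).1 '' arc β ↔ δ ≤ rep x ∧ rep x < δ + β := by
  constructor
  · rintro ⟨_, ⟨t, ⟨ht0, ht1⟩, rfl⟩, rfl⟩
    rw [translation_apply, ← AddCircle.coe_add, rep_coe (by linarith) (by linarith)]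
    constructor <;> linarith
  · rintro ⟨h2, h3⟩
    refine ⟨((rep x - δ : ℝ) : UnitAddCircle), ⟨rep x - δ, ⟨by linarith, by linarith⟩, rfl⟩, ?_⟩
    rw [translation_apply, ← AddCircle.coe_add, add_sub_cancel, coe_rep]

theorem mem_arc {β : ℝ} (h1 : β ≤ 1) (x : UnitAddCircle) : x ∈ arc β ↔ rep x < β := by
  have := mem_translation_arc le_rfl (by linarith : 0 + β ≤ 1) x
  rw [AddCircle.coe_zero, translation_zero_image, zero_add] at this
  rw [this]
  exact ⟨fun h => h.2, fun h => ⟨(rep_mem x).1, h⟩⟩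

theorem measure_arc_le (ε : ℝ) :
    volume (arc ε : Set UnitAddCircle) ≤ ENNReal.ofReal (2 * ε) := by
  have hsub : arc ε ⊆ Metric.closedBall (0 : UnitAddCircle) ε := by
    rintro _ ⟨t, ⟨h0, h1⟩, rfl⟩
    rw [mem_closedBall_zero_iff]
    refine (QuotientAddGroup.norm_mk_le_norm).trans ?_
    rw [Real.norm_of_nonneg h0]; exact h1.le
  refine (measure_mono hsub).trans ?_
  rw [AddCircle.volume_closedBall]
  exact ENNReal.ofReal_le_ofReal (min_le_right _ _)

theorem isOpen_image_Ioo (ε : ℝ) :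
    IsOpen ((fun t : ℝ => (t : UnitAddCircle)) '' Set.Ioo 0 ε) :=
  QuotientAddGroup.isOpenMap_coe _ isOpen_Ioo

theorem image_Ioo_subset_arc (ε : ℝ) :
    (fun t : ℝ => (t : UnitAddCircle)) '' Set.Ioo 0 ε ⊆ arc ε :=
  Set.image_mono Set.Ioo_subset_Ico_self

theorem measure_arc_pos {ε : ℝ} (hε : 0 < ε) : 0 < volume (arc ε : Set UnitAddCircle) := by
  refine lt_of_lt_of_le ?_ (measure_mono (image_Ioo_subset_arc ε))
  exact (isOpen_image_Ioo ε).measure_pos volume ((Set.nonempty_Ioo.2 hε).image _)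

variable {α : ℝ}

theorem denseRange_zsmul (hα : Irrational α) :
    DenseRange fun n : ℤ => n • (α : UnitAddCircle) :=
  AddCircle.denseRange_zsmul_coe_iff.2 (by simpa using hα)

theorem zsmul_eq_zero (hα : Irrational α) {n : ℤ} (h : n • (α : UnitAddCircle) = 0) : n = 0 := by
  have h1 := AddCircle.denseRange_zsmul_iff.1 (denseRange_zsmul hα)
  have := addOrderOf_dvd_iff_zsmul_eq_zero.2 h
  rw [h1] at this
  simpa using this

theorem isFree_rotation (hα : Irrational α) : IsFree (rotation α).1 := by
  intro x n h
  have h2 : ((rotation α) ^ n).1 x = x := h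
  rw [rotation_eq, translation_zpow, translation_apply, add_eq_right] at h2
  exact zsmul_eq_zero hα h2

theorem ergodic_rotation (hα : Irrational α) : Ergodic (rotation α).1 volume :=
  AddCircle.ergodic_add_left.2 (AddCircle.denseRange_zsmul_iff.1 (denseRange_zsmul hα))

/-- Every orbit meets the open arc, so by compactness finitely many times of absolute value at most
`M` suffice. Applying this to the point `M + 1` steps ahead makes the times positive, between 1 and
`2M + 1`. -/
theorem recurrent_arc (hα : Irrational α) {ε : ℝ} (hε : 0 < ε) :
    ∃ N, Recurrent (rotation α) (arc ε) N := by
  set V := (fun t : ℝ => (t : UnitAddCircle)) '' Set.Ioo 0 ε with hV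
  have hVo : IsOpen V := isOpen_image_Ioo ε
  have hVn : V.Nonempty := (Set.nonempty_Ioo.2 hε).image _
  have hcov : (Set.univ : Set UnitAddCircle) ⊆
      ⋃ n : ℤ, (fun x => n • (α : UnitAddCircle) + x) ⁻¹' V := by
    intro x _
    have hd : DenseRange fun n : ℤ => n • (α : UnitAddCircle) + x :=
      (Homeomorph.addRight x).surjective.denseRange.comp (denseRange_zsmul hα)
        (Homeomorph.addRight x).continuous
    obtain ⟨n, hn⟩ := hd.exists_mem_open hVo hVn
    exact Set.mem_iUnion.2 ⟨n, hn⟩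
  obtain ⟨F, hF⟩ := isCompact_univ.elim_finite_subcover _
    (fun n => hVo.preimage (continuous_const.add continuous_id)) hcov
  set M := F.sup Int.natAbs with hM
  refine ⟨2 * M + 1, fun x => ?_⟩
  obtain ⟨n, hnF, hn⟩ := Set.mem_iUnion₂.1
    (hF (Set.mem_univ (((M + 1 : ℕ) : ℤ) • (α : UnitAddCircle) + x)))
  have hnM : n.natAbs ≤ M := Finset.le_sup hnF
  refine ⟨(n + (M + 1 : ℕ)).toNat, by omega, by omega, image_Ioo_subset_arc ε ?_⟩
  have e : (((n + (M + 1 : ℕ)).toNat : ℕ) : ℤ) = n + (M + 1 : ℕ) := by omega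
  have h2 : ((rotation α) ^ (n + ((M + 1 : ℕ) : ℤ))).1 x ∈ V := by
    rw [rotation_eq, translation_zpow, translation_apply, add_smul, add_assoc]
    exact hn
  rw [e]
  exact h2

/-- A closed group containing the rotation and an involution `I_{T,A}` contains the involutions of
the translates of `A`. -/
theorem swapInv_translation_mem (hα : Irrational α)
    {H : Subgroup (mpPerm (volume : Measure UnitAddCircle))}
    (hT : rotation α ∈ approxGroup (rotation α) H) {A : Set UnitAddCircle}
    (hA : Swappable (rotation α) A) (hAK : swapInv (rotation α) A ∈ approxGroup (rotation α) H)
    (θ : UnitAddCircle) :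
    swapInv (rotation α) ((translation θ).1 '' A) ∈ approxGroup (rotation α) H := by
  have hc : ∀ η, Commute (translation η) (rotation α) := fun η => translation_commute _ _
  refine mem_approxGroup_of_approx (swapInv_stepBounded _ _) fun ε hε => ?_
  -- Powers of `T` give exactly the translates by multiples of `α`. These are dense, and the measure
  -- of the symmetric difference of two translates depends continuously on the translation.
  let f : UnitAddCircle → C(UnitAddCircle, UnitAddCircle) := fun η =>
    ⟨fun x => -η + x, continuous_const.add continuous_id⟩
  have hf : Continuous f :=
    ContinuousMap.continuous_of_continuous_uncurry _
      ((continuous_fst.neg).add continuous_snd)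
  have himg : ∀ η, f η ⁻¹' A = (translation η).1 '' A := fun η => by
    rw [Equiv.image_eq_preimage_symm]; rfl
  have ht := tendsto_measure_symmDiff_preimage_nhds_zero (μ := (volume : Measure UnitAddCircle))
    (ν := volume) (hf.tendsto θ)
    (Eventually.of_forall fun η => measurePreserving_add_left volume (-η))
    (measurePreserving_add_left volume (-θ)) hA.1.nullMeasurableSet (measure_ne_top _ _)
  have hev := ht.eventually (gt_mem_nhds (ENNReal.div_pos hε.ne' (ENNReal.natCast_ne_top 4)))
  obtain ⟨n, hn⟩ := (denseRange_zsmul hα).mem_nhds hev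
  simp only [himg] at hn
  refine ⟨swapInv (rotation α) ((translation (n • (α : UnitAddCircle))).1 '' A), ?_, ?_⟩
  · rw [← conj_swapInv (hc _), ← translation_zpow, ← rotation_eq]
    exact mul_mem (mul_mem (zpow_mem hT n) hAK) (inv_mem (zpow_mem hT n))
  · refine (l1Dist_swapInv_le (hA.image (hc _)) (hA.image (hc _))).trans_lt ?_
    rw [symmDiff_comm, mul_comm]
    exact ENNReal.mul_lt_of_lt_div (by exact_mod_cast hn)

/-- Distinct translates of a short enough arc are disjoint. -/
theorem eventually_disjoint_arc {d : UnitAddCircle} (hd : d ≠ 0) :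
    ∀ᶠ ε in 𝓝[>] (0 : ℝ), ∀ p : UnitAddCircle,
      Disjoint ((translation p).1 '' arc ε) ((translation (d + p)).1 '' arc ε) := by
  have hpos : 0 < rep d := lt_of_le_of_ne (rep_mem d).1 fun h => hd (by
    rw [← coe_rep d, ← h, AddCircle.coe_zero])
  have hlt := (rep_mem d).2
  filter_upwards [Ioo_mem_nhdsGT (lt_min hpos (sub_pos.2 hlt))] with ε hε p
  have h1 := hε.2.trans_le (min_le_left _ _)
  have h2 := hε.2.trans_le (min_le_right _ _)
  rw [add_comm, ← translation_image_image, Set.disjoint_image_iff (translation p).1.injective,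
    Set.disjoint_left]
  intro x hx hx'
  rw [mem_arc (by linarith)] at hx
  rw [← coe_rep d, mem_translation_arc hpos.le (by linarith)] at hx'
  linarith

/-- The involution of a translated arc. -/
def arcInv (α ε : ℝ) (p : UnitAddCircle) : mpPerm (volume : Measure UnitAddCircle) :=
  swapInv (rotation α) ((translation p).1 '' arc ε)

theorem rotation_image_translation (p : UnitAddCircle) (A : Set UnitAddCircle) :
    (rotation α).1 '' ((translation p).1 '' A) = (translation (α + p)).1 '' A :=
  translation_image_image _ _ _

theorem eventually_swappable_arc (hα : Irrational α) :
    ∀ᶠ ε in 𝓝[>] (0 : ℝ), ∀ p, Swappable (rotation α) ((translation p).1 '' arc ε) := by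
  have h0 : (α : UnitAddCircle) ≠ 0 := fun h => by
    have := zsmul_eq_zero hα (n := 1) (by rwa [one_zsmul])
    omega
  filter_upwards [eventually_disjoint_arc h0] with ε h p
  refine ⟨measurableSet_image _ (measurableSet_arc ε), ?_⟩
  rw [rotation_image_translation]
  exact h p

/-- The supports consist of the arcs at `p`, `α + p` and at `d + p`, `α + d + p`; for `d` different
from `0` and `±α` they are disjoint once the arcs are short. For `d = 0` the involutions coincide.
-/
theorem eventually_arcInv_commute (hα : Irrational α) {d : UnitAddCircle} (h1 : d ≠ α)
    (h2 : d ≠ -α) : ∀ᶠ ε in 𝓝[>] (0 : ℝ), ∀ p, Commute (arcInv α ε p) (arcInv α ε (d + p)) := by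
  by_cases h0 : d = 0
  · subst h0
    refine Eventually.of_forall fun ε p => ?_
    rw [zero_add]
  have h3 : (α : UnitAddCircle) + d ≠ 0 := fun h => h2 (neg_eq_of_add_eq_zero_right h).symm
  have h4 : d - α ≠ 0 := sub_ne_zero.2 h1
  filter_upwards [eventually_swappable_arc hα, eventually_disjoint_arc h0,
    eventually_disjoint_arc h3, eventually_disjoint_arc h4] with ε hs e0 e3 e4 p
  refine commute_swapInv_of_disjoint (hs _) (hs _) ?_
  simp only [rotation_image_translation]
  rw [Set.disjoint_union_left, Set.disjoint_union_right, Set.disjoint_union_right]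
  refine ⟨⟨e0 p, ?_⟩, ?_, ?_⟩
  · rw [← add_assoc]; exact e3 p
  · have := e4 (α + p)
    rwa [← add_assoc, sub_add_cancel] at this
  · have := e0 (α + p)
    rwa [add_left_comm] at this

theorem eventually_cyclable_arc (hα : Irrational α) :
    ∀ᶠ ε in 𝓝[>] (0 : ℝ), ∀ p, Cyclable (rotation α) ((translation p).1 '' arc ε) := by
  have h1 : (α : UnitAddCircle) ≠ 0 := fun h => by
    have := zsmul_eq_zero hα (n := 1) (by rwa [one_zsmul])
    omega
  have h2 : (α + α : UnitAddCircle) ≠ 0 := fun h => by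
    have := zsmul_eq_zero hα (n := 2) (by rwa [two_zsmul])
    omega
  filter_upwards [eventually_disjoint_arc h1, eventually_disjoint_arc h2] with ε e1 e2 p
  refine ⟨measurableSet_image _ (measurableSet_arc ε), fun x hx hx' => ?_, fun x hx hx' => ?_⟩
  · refine Set.disjoint_left.1 (e1 p) hx' ?_
    rw [← rotation_image_translation]
    exact ⟨x, hx, rfl⟩
  · refine Set.disjoint_left.1 (e2 p) hx' ?_
    rw [add_assoc, ← rotation_image_translation, ← rotation_image_translation]
    exact ⟨_, ⟨x, hx, rfl⟩, rfl⟩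

/-- Of the four elements only `a` and `c` may fail to commute, so the involutions `b` and `d` can be
gathered and vanish in the square. -/
theorem commute_sq_of_involutive {G : Type*} [Group G] {a b c d : G} (hb : b * b = 1)
    (hd : d * d = 1) (hab : Commute a b) (hbc : Commute b c) (hbd : Commute b d)
    (had : Commute a d) (hcd : Commute c d) : (a * b * (d * c)) ^ 2 = (a * c) ^ 2 := by
  have h1 : a * b * (d * c) = (b * d) * (a * c) := by
    rw [hab.eq, mul_assoc, ← mul_assoc a, had.eq, mul_assoc, mul_assoc]
  have h2 : Commute (b * d) (a * c) :=
    ((hab.symm.mul_right hbc)).mul_left (had.symm.mul_right hcd.symm)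
  rw [h1, h2.mul_pow, hbd.mul_pow, pow_two b, pow_two d, hb, hd, one_mul, one_mul]

/-- Multiplying the involutions of `[0,β[` and `[ε,β+ε[` cancels the common part `[ε,β[` and leaves
the two short end arcs. -/
theorem arcInv_mul_arcInv_mem (hα : Irrational α)
    {H : Subgroup (mpPerm (volume : Measure UnitAddCircle))}
    (hT : rotation α ∈ approxGroup (rotation α) H) {β : ℝ} (hβ : 0 < β) (hβ1 : β < 1)
    (hA : Swappable (rotation α) (arc β))
    (hAK : swapInv (rotation α) (arc β) ∈ approxGroup (rotation α) H) :
    ∀ᶠ ε in 𝓝[>] (0 : ℝ), ∀ p,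
      arcInv α ε p * arcInv α ε (β + p) ∈ approxGroup (rotation α) H := by
  filter_upwards [Ioo_mem_nhdsGT (lt_min hβ (sub_pos.2 hβ1))] with ε hε p
  have h0 := hε.1
  have h1 := hε.2.trans_le (min_le_left _ _)
  have h2 := hε.2.trans_le (min_le_right _ _)
  set A := arc β
  set A' := (translation (ε : UnitAddCircle)).1 '' arc β with hA'
  have hc : ∀ η, Commute (translation η) (rotation α) := fun η => translation_commute _ _
  have hAs : Swappable (rotation α) A' := hA.image (hc _)
  have mA : MeasurableSet A := hA.1
  have mA' : MeasurableSet A' := hAs.1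
  have mE := measurableSet_arc ε
  have mE' := measurableSet_image (translation (β : UnitAddCircle)) mE
  have eA : A = arc ε ∪ (A ∩ A') := by
    ext x
    simp only [A, Set.mem_union, Set.mem_inter_iff]
    rw [mem_arc (by linarith), mem_arc (by linarith),
      hA', mem_translation_arc h0.le (by linarith)]
    constructor
    · intro h
      rcases lt_or_ge (rep x) ε with h' | h'
      · exact Or.inl h'
      · exact Or.inr ⟨h, h', by linarith⟩
    · rintro (h | h)
      · linarith
      · exact h.1
  have eA' : A' = (A ∩ A') ∪ (translation (β : UnitAddCircle)).1 '' arc ε := by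
    ext x
    simp only [A, Set.mem_union, Set.mem_inter_iff]
    rw [mem_arc (by linarith), hA', mem_translation_arc h0.le (by linarith),
      mem_translation_arc hβ.le (by linarith)]
    constructor
    · intro h
      rcases lt_or_ge (rep x) β with h' | h'
      · exact Or.inl ⟨h', h⟩
      · exact Or.inr ⟨h', by linarith⟩
    · rintro (h | h)
      · exact h.2
      · exact ⟨by linarith, by linarith⟩
  have d1 : Disjoint (arc ε) (A ∩ A') := by
    rw [Set.disjoint_left]
    rintro x hx ⟨-, hx'⟩
    rw [mem_arc (by linarith)] at hx
    rw [hA', mem_translation_arc h0.le (by linarith)] at hx'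
    linarith
  have d2 : Disjoint (A ∩ A') ((translation (β : UnitAddCircle)).1 '' arc ε) := by
    rw [Set.disjoint_left]
    rintro x ⟨hx, -⟩ hx'
    rw [mem_arc (by linarith)] at hx
    rw [mem_translation_arc hβ.le (by linarith)] at hx'
    linarith
  have f1 : swapInv (rotation α) A = swapInv (rotation α) (arc ε) *
      swapInv (rotation α) (A ∩ A') := by
    conv_lhs => rw [eA]
    exact swapInv_union (by rwa [← eA]) mE (mA.inter mA') d1
  have f2 : swapInv (rotation α) A' = swapInv (rotation α) (A ∩ A') *
      swapInv (rotation α) ((translation (β : UnitAddCircle)).1 '' arc ε) := by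
    conv_lhs => rw [eA']
    exact swapInv_union (by rwa [← eA']) (mA.inter mA') mE' d2
  have f3 : swapInv (rotation α) A * swapInv (rotation α) A' =
      swapInv (rotation α) (arc ε) *
        swapInv (rotation α) ((translation (β : UnitAddCircle)).1 '' arc ε) := by
    rw [f1, f2, mul_assoc, ← mul_assoc (swapInv (rotation α) (A ∩ A')), swapInv_mul_self, one_mul]
  have f4 : arcInv α ε p * arcInv α ε (β + p) =
      swapInv (rotation α) ((translation p).1 '' A) *
        swapInv (rotation α) ((translation p).1 '' A') := by
    rw [← conj_swapInv (hc p), ← conj_swapInv (hc p), conj_mul, f3, ← conj_mul,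
      conj_swapInv (hc p), conj_swapInv (hc p), translation_image_image, add_comm p]
    rfl
  rw [f4, hA', translation_image_image]
  exact mul_mem (swapInv_translation_mem hα hT hA hAK _) (swapInv_translation_mem hα hT hA hAK _)

/-- In `(I_0 I_β)(I_{c-β} I_c)` the exclusions on `β` say precisely that no pair other than `I_0`,
`I_c` has positions differing by `±α`; the square is therefore `(I_0 I_c)²`. -/
theorem eventually_arcInv_sq_mem (hα : Irrational α)
    {H : Subgroup (mpPerm (volume : Measure UnitAddCircle))}
    (hT : rotation α ∈ approxGroup (rotation α) H) {β : ℝ} (hβ : 0 < β) (hβ1 : β < 1)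
    (hA : Swappable (rotation α) (arc β))
    (hAK : swapInv (rotation α) (arc β) ∈ approxGroup (rotation α) H)
    (h1 : (β : UnitAddCircle) ≠ α) (h2 : (β : UnitAddCircle) ≠ -α)
    (h3 : (β : UnitAddCircle) ≠ 0) (h4 : (β + β : UnitAddCircle) ≠ 0)
    {c : UnitAddCircle} (hc : c = α ∨ c = -α)
    (h5 : (β : UnitAddCircle) ≠ c + c) (h6 : (β + β : UnitAddCircle) ≠ c + c) :
    ∀ᶠ ε in 𝓝[>] (0 : ℝ), (arcInv α ε 0 * arcInv α ε c) ^ 2 ∈ approxGroup (rotation α) H := by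
  have key : ∀ d : UnitAddCircle, d ≠ c → d ≠ -c → ∀ᶠ ε in 𝓝[>] (0 : ℝ),
      ∀ p, Commute (arcInv α ε p) (arcInv α ε (d + p)) := by
    intro d hd hd'
    rcases hc with rfl | rfl
    · exact eventually_arcInv_commute hα hd hd'
    · exact eventually_arcInv_commute hα (by rwa [neg_neg] at hd') hd
  have e1 := eventually_arcInv_commute hα h1 h2
  have e2 := key (c - β) (fun h => h3 (sub_eq_self.1 h))
    (fun h => h5 (by linear_combination (norm := module) (-1 : ℤ) • h))
  have e3 := key (c - (β + β)) (fun h => h4 (sub_eq_self.1 h))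
    (fun h => h6 (by linear_combination (norm := module) (-1 : ℤ) • h))
  filter_upwards [arcInv_mul_arcInv_mem hα hT hβ hβ1 hA hAK, e1, e2, e3] with ε hX c1 c2 c3
  have i1 := hX 0
  have i2 := hX (c - β)
  rw [add_zero] at i1
  rw [add_sub_cancel] at i2
  have sq : ∀ p, arcInv α ε p * arcInv α ε p = 1 := fun p => swapInv_mul_self _ _
  rw [← commute_sq_of_involutive (b := arcInv α ε β) (d := arcInv α ε (c - β)) (sq _) (sq _)]
  · exact pow_mem (mul_mem i1 i2) 2
  · have := c1 0; rwa [add_zero] at this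
  · have := c2 β; rwa [sub_add_cancel] at this
  · have := c3 β
    rwa [sub_add_eq_sub_sub, sub_add_cancel] at this
  · have := c2 0; rwa [add_zero] at this
  · have := c1 (c - β); rw [add_sub_cancel] at this; exact this.symm

/-- A closed group containing the rotation and the involution `I_{T,[0,β[}` contains the cycles on
all short arcs. -/
theorem eventually_cycle_arc_mem (hα : Irrational α) (hα1 : α < 1)
    {H : Subgroup (mpPerm (volume : Measure UnitAddCircle))}
    (hT : rotation α ∈ approxGroup (rotation α) H) {β : ℝ} (hβ : 0 < β) (hβα : β < α)
    (hA : Swappable (rotation α) (arc β))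
    (hAK : swapInv (rotation α) (arc β) ∈ approxGroup (rotation α) H) :
    ∀ᶠ ε in 𝓝[>] (0 : ℝ), cycle (rotation α) (arc ε) ∈ approxGroup (rotation α) H := by
  have hβ1 : β < 1 := hβα.trans hα1
  have hcyc : ∀ ε p, cycle (rotation α) ((translation p).1 '' arc ε) =
      arcInv α ε p * arcInv α ε (α + p) := fun ε p => by
    rw [cycle, rotation_image_translation]; rfl
  have hinv : ∀ ε p, (arcInv α ε p)⁻¹ = arcInv α ε p := fun ε p =>
    inv_eq_of_mul_eq_one_right (swapInv_mul_self _ _)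
  have hneg : ∀ ε, cycle (rotation α) ((translation (-(α : UnitAddCircle))).1 '' arc ε) ∈
      approxGroup (rotation α) H → cycle (rotation α) (arc ε) ∈ approxGroup (rotation α) H := by
    intro ε h
    have := cycle_image_mem (Commute.refl _) hT h
    rwa [rotation_image_translation, add_neg_cancel, translation_zero_image] at this
  have hinj : ∀ s t : ℝ, 0 ≤ s → s < 1 → 0 ≤ t → t < 1 → (s : UnitAddCircle) = t → s = t := by
    intro s t hs hs' ht ht' h
    rw [← rep_coe hs hs', h, rep_coe ht ht']
  have hle : β ≤ 1 - α := by
    by_contra hlt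
    rw [not_le] at hlt
    have m0 : ((0 : ℝ) : UnitAddCircle) ∈ arc β := ⟨0, ⟨le_rfl, hβ⟩, rfl⟩
    have m1 : ((1 - α : ℝ) : UnitAddCircle) ∈ arc β := ⟨1 - α, ⟨by linarith, hlt⟩, rfl⟩
    refine Set.disjoint_left.1 hA.2 m0 ⟨_, m1, ?_⟩
    rw [rotation_eq, translation_apply, ← AddCircle.coe_add, add_sub_cancel]
    exact (AddCircle.coe_period 1).trans (AddCircle.coe_zero 1).symm
  have h1 : (β : UnitAddCircle) ≠ α := fun h =>
    hβα.ne (hinj _ _ hβ.le hβ1 (hβ.trans hβα).le hα1 h)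
  have h3 : (β : UnitAddCircle) ≠ 0 := fun h => hβ.ne' (hinj _ _ hβ.le hβ1 le_rfl one_pos h)
  -- From `β < α` and `β ≤ 1 - α` one gets `2β < 1`.
  have h4 : (β + β : UnitAddCircle) ≠ 0 := fun h => by
    rw [← AddCircle.coe_add] at h
    have := hinj _ _ (by linarith) (by linarith) le_rfl one_pos h
    linarith
  have hz : ∀ n : ℤ, n ≠ 0 → n • (α : UnitAddCircle) ≠ 0 := fun n hn h => hn (zsmul_eq_zero hα h)
  have hX := arcInv_mul_arcInv_mem hα hT hβ hβ1 hA hAK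
  -- Here the pair of end arcs based at `α` already is the inverse of the cycle on the arc at 0.
  by_cases h2 : (β : UnitAddCircle) = -α
  · filter_upwards [hX] with ε hε
    have := inv_mem (hε α)
    rw [h2, neg_add_cancel, mul_inv_rev, hinv, hinv] at this
    have h0 := hcyc ε 0
    rw [translation_zero_image, add_zero] at h0
    rwa [h0]
  by_cases h5 : (β : UnitAddCircle) ≠ α + α ∧ (β + β : UnitAddCircle) ≠ α + α
  · filter_upwards [eventually_arcInv_sq_mem hα hT hβ hβ1 hA hAK h1 h2 h3 h4 (Or.inl rfl)
      h5.1 h5.2, eventually_cyclable_arc hα] with ε hε hcy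
    have h0 := hcyc ε 0
    have hcy0 := hcy 0
    rw [translation_zero_image] at h0 hcy0
    rw [add_zero] at h0
    refine cycle_mem_of_sq_mem hcy0 ?_
    rwa [h0]
  -- If the exclusions failed for both `c = α` and `c = -α`, eliminating `β` would give `4α = 0` or
  -- `6α = 0` on the circle.
  · have h6 : (β : UnitAddCircle) ≠ -α + -α ∧ (β + β : UnitAddCircle) ≠ -α + -α := by
      by_contra h6
      rw [not_and_or, not_not, not_not] at h5 h6
      rcases h5 with h5 | h5 <;> rcases h6 with h6 | h6
      · refine hz 4 (by norm_num) ?_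
        linear_combination (norm := module) h6 - h5
      · refine hz 6 (by norm_num) ?_
        linear_combination (norm := module) h6 - (2 : ℤ) • h5
      · refine hz 6 (by norm_num) ?_
        linear_combination (norm := module) (2 : ℤ) • h6 - h5
      · refine hz 4 (by norm_num) ?_
        linear_combination (norm := module) h6 - h5
    filter_upwards [eventually_arcInv_sq_mem hα hT hβ hβ1 hA hAK h1 h2 h3 h4 (Or.inr rfl)
      h6.1 h6.2, eventually_cyclable_arc hα] with ε hε hcy
    -- With `c = -α` one obtains the inverse of the squared cycle based at `-α`; conjugation by `T`
    -- brings it back to the arc at 0.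
    refine hneg ε (cycle_mem_of_sq_mem (hcy _) ?_)
    have := inv_mem hε
    rwa [← inv_pow, mul_inv_rev, hinv, hinv, ← add_neg_cancel (α : UnitAddCircle), ← hcyc] at this

end Rotation

/-! ### Density of the generated subgroup -/

section Generation

variable {α β : ℝ}

/-- Sublevel sets of `rep` inside a short arc starting at 0 are again such arcs, so the cycles on
arcs are exactly the input of the π-λ argument. -/
theorem exists_arc_cycle_mem {H : Subgroup (mpPerm (volume : Measure UnitAddCircle))}
    (hα : Irrational α)
    (h : ∀ᶠ ε in nhdsWithin (0 : ℝ) (Set.Ioi 0),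
      cycle (rotation α) (arc ε) ∈ approxGroup (rotation α) H) :
    ∃ ε₀ > 0, ∀ E ⊆ arc ε₀, MeasurableSet E →
      cycle (rotation α) E ∈ approxGroup (rotation α) H := by
  obtain ⟨u, hu, hsub⟩ := mem_nhdsGT_iff_exists_Ioo_subset.1 (h.and (eventually_cyclable_arc hα))
  have hu' : (0 : ℝ) < u := hu
  -- Halving `u` puts the chosen length strictly inside the admissible interval; the bound 1/2 keeps
  -- the arc inside `[0,1[`.
  have hlt : min (u / 2) (1 / 2) < u := (min_le_left _ _).trans_lt (by linarith)
  have hpos : 0 < min (u / 2) (1 / 2) := lt_min (by linarith) (by norm_num)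
  have hle : min (u / 2) (1 / 2) ≤ 1 := (min_le_right _ _).trans (by norm_num)
  set ε₀ := min (u / 2) (1 / 2) with hε₀
  refine ⟨ε₀, hpos, fun E hE hEm => ?_⟩
  have hB : Cyclable (rotation α) (arc ε₀) := by
    have := (hsub ⟨hpos, hlt⟩).2 0
    rwa [translation_zero_image] at this
  have e : E = arc ε₀ ∩ rep ⁻¹' ((fun t : ℝ => (t : UnitAddCircle)) ⁻¹' E) := by
    ext x
    simp only [Set.mem_inter_iff, Set.mem_preimage, coe_rep]
    exact ⟨fun hx => ⟨hE hx, hx⟩, fun hx => hx.2⟩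
  rw [e]
  refine cycle_mem_of_Iio hB measurable_rep (fun a => ?_) (AddCircle.measurable_mk' hEm)
  rcases le_or_gt a 0 with ha | ha
  · have : arc ε₀ ∩ rep ⁻¹' Set.Iio a = ∅ := by
      rw [Set.eq_empty_iff_forall_notMem]
      rintro x ⟨-, hx⟩
      exact absurd ((rep_mem x).1.trans_lt hx) (not_lt.2 ha)
    rw [this, cycle_empty]
    exact one_mem _
  · have : arc ε₀ ∩ rep ⁻¹' Set.Iio a = arc (min ε₀ a) := by
      ext x
      rw [mem_arc ((min_le_left _ _).trans hle), Set.mem_inter_iff, mem_arc hle]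
      exact (lt_min_iff (b := ε₀) (c := a)).symm
    rw [this]
    exact (hsub ⟨lt_min hpos ha, (min_le_left _ _).trans_lt hlt⟩).1

theorem swapInv_eq_involution (hd : Disjoint (arc β) ((rotation α).1 '' arc β)) :
    swapInv (rotation α) (arc β) = involution (rotation α) (arc β) (measurableSet_arc β) hd :=
  swapInv_of ⟨measurableSet_arc β, hd⟩

theorem disjoint_arc (hα1 : α < 1) (h0 : 0 < β) (h1 : β ≤ α) (h2 : β ≤ 1 - α) :
    Disjoint (arc β) ((rotation α).1 '' arc β) := by
  rw [Set.disjoint_left, rotation_eq]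
  intro x hx hx'
  rw [mem_arc (by linarith)] at hx
  rw [mem_translation_arc (by linarith) (by linarith)] at hx'
  linarith

/-- Two approximations of error `ε / 2`: by an element of `approxGroup`, from the castles over short
arcs, and then by a word in the generators. -/
theorem dense_closure (hα : Irrational α) (hα1 : α < 1) (hβ : 0 < β) (hβα : β < α)
    (hd : Disjoint (arc β) ((rotation α).1 '' arc β)) :
    Dense (Subgroup.closure {l1Self (rotation α),
      l1Involution (rotation α) (arc β) (measurableSet_arc β) hd} :
        Set (l1FullGroup (rotation α))) := by
  set T := rotation α with hT
  set I := swapInv T (arc β) with hI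
  set H := Subgroup.closure {T, I} with hH
  have hTH : T ∈ approxGroup T H :=
    mem_approxGroup_of_mem (Subgroup.subset_closure (by simp)) (StepBounded.self T)
  have hIH : I ∈ approxGroup T H :=
    mem_approxGroup_of_mem (Subgroup.subset_closure (by simp)) (swapInv_stepBounded T _)
  obtain ⟨ε₀, hε₀, hcyc⟩ := exists_arc_cycle_mem hα (eventually_cycle_arc_mem hα hα1 hTH hβ hβα
    ⟨measurableSet_arc β, hd⟩ hIH)
  -- The approximation lives among genuine transformations; words are carried to their classes in
  -- the L¹ full group.
  have hlift : ∀ h ∈ H, ∃ g ∈ Subgroup.closure {l1Self T,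
      l1Involution T (arc β) (measurableSet_arc β) hd},
        (g : Aut (volume : Measure UnitAddCircle)) = (h : Aut (volume : Measure UnitAddCircle)) := by
    intro h hh
    induction hh using Subgroup.closure_induction with
    | mem x hx =>
      rcases hx with rfl | rfl
      · exact ⟨l1Self T, Subgroup.subset_closure (by simp), rfl⟩
      · refine ⟨l1Involution T (arc β) (measurableSet_arc β) hd,
          Subgroup.subset_closure (by simp), ?_⟩
        rw [hI, swapInv_eq_involution hd]; rfl
    | one => exact ⟨1, one_mem _, rfl⟩
    | mul x y _ _ hx hy =>
      obtain ⟨a, ha, ea⟩ := hx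
      obtain ⟨b, hb, eb⟩ := hy
      exact ⟨a * b, mul_mem ha hb, by rw [Subgroup.coe_mul, ea, eb, QuotientGroup.mk_mul]⟩
    | inv x _ hx =>
      obtain ⟨a, ha, ea⟩ := hx
      exact ⟨a⁻¹, inv_mem ha, by rw [Subgroup.coe_inv, ea, QuotientGroup.mk_inv]⟩
  intro S
  rw [EMetric.mem_closure_iff]
  intro ε hε
  obtain ⟨⟨s, hs, hsS⟩, hint⟩ := S.2
  have hsS' : (s : Aut (volume : Measure UnitAddCircle)) = S.1 := hsS
  obtain ⟨k, hk, hsk⟩ := exists_mem_l1Dist_lt (isFree_rotation hα) (ergodic_rotation hα)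
    (approxGroup T H) hTH (fun δ hδ => by
      obtain ⟨ε₁, hε₁, hδ₁⟩ : ∃ ε₁ : ℝ, 0 < ε₁ ∧ ENNReal.ofReal (2 * ε₁) < δ := by
        have ht : Filter.Tendsto (fun t : ℝ => ENNReal.ofReal (2 * t))
            (nhdsWithin 0 (Set.Ioi 0)) (nhds 0) := by
          have hc : Continuous fun t : ℝ => ENNReal.ofReal (2 * t) :=
            ENNReal.continuous_ofReal.comp (continuous_const.mul continuous_id)
          have := hc.tendsto 0
          simp only [mul_zero, ENNReal.ofReal_zero] at this
          exact this.mono_left nhdsWithin_le_nhds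
        obtain ⟨t, ht1, ht2⟩ := ((ht.eventually (gt_mem_nhds hδ)).and
          self_mem_nhdsWithin).exists
        exact ⟨t, ht2, ht1⟩
      obtain ⟨N, hN⟩ := recurrent_arc hα (lt_min hε₁ hε₀)
      refine ⟨arc (min ε₁ ε₀), N, measurableSet_arc _, ?_, hN, fun E hE hEm =>
        hcyc E (hE.trans (Set.image_mono (Set.Ico_subset_Ico_right (min_le_right _ _)))) hEm⟩
      refine (measure_arc_le _).trans_lt (lt_of_le_of_lt (ENNReal.ofReal_le_ofReal ?_) hδ₁)
      linarith [min_le_left ε₁ ε₀])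
    s hs (by rw [hsS']; exact hint.ne) (ε / 2) (ENNReal.half_pos hε.ne')
  obtain ⟨h, hh, -, hkh⟩ := hk.2 (ε / 2) (ENNReal.half_pos hε.ne')
  obtain ⟨g, hg, eg⟩ := hlift h hh
  refine ⟨g, hg, ?_⟩
  change l1Dist T S.1 g.1 < ε
  rw [← hsS', eg, ← ENNReal.add_halves ε]
  exact (l1Dist_triangle T _ (k : Aut (volume : Measure UnitAddCircle)) _).trans_lt
    (ENNReal.add_lt_add hsk hkh)

theorem involution_ne_one (hα : Irrational α) (hβ : 0 < β)
    (hd : Disjoint (arc β) ((rotation α).1 '' arc β)) :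
    l1Involution (rotation α) (arc β) (measurableSet_arc β) hd ≠ 1 := by
  intro h
  have h1 : (involution (rotation α) (arc β) (measurableSet_arc β) hd :
      Aut (volume : Measure UnitAddCircle)) =
      ((1 : mpPerm (volume : Measure UnitAddCircle)) : Aut (volume : Measure UnitAddCircle)) :=
    congrArg Subtype.val h
  rw [← swapInv_eq_involution hd, aut_mk_eq_iff] at h1
  have h2 : ∀ᵐ x, x ∉ arc β := by
    filter_upwards [h1] with x hx hxA
    rw [swapInv_apply_mem ⟨measurableSet_arc β, hd⟩ hxA] at hx
    have := isFree_rotation hα x 1 (by rw [zpow_one]; exact hx)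
    omega
  exact (measure_arc_pos hβ).ne' (by simpa [ae_iff] using h2)

theorem orderOf_involution (hα : Irrational α) (hβ : 0 < β)
    (hd : Disjoint (arc β) ((rotation α).1 '' arc β)) :
    orderOf (l1Involution (rotation α) (arc β) (measurableSet_arc β) hd) = 2 := by
  refine orderOf_eq_prime (Subtype.ext ?_) (involution_ne_one hα hβ hd)
  rw [pow_two]
  change (involution (rotation α) (arc β) (measurableSet_arc β) hd :
      Aut (volume : Measure UnitAddCircle)) *
    (involution (rotation α) (arc β) (measurableSet_arc β) hd :
      Aut (volume : Measure UnitAddCircle)) = 1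
  rw [← QuotientGroup.mk_mul, ← swapInv_eq_involution hd, swapInv_mul_self, QuotientGroup.mk_one]

/-- On the arc one composition is `T²` and the other is the identity, which differ by freeness, and
the arc has positive measure. -/
theorem not_commute_involution (hα : Irrational α) (hβ : 0 < β)
    (hd : Disjoint (arc β) ((rotation α).1 '' arc β)) :
    (rotation α : Aut (volume : Measure UnitAddCircle)) *
        (swapInv (rotation α) (arc β) : Aut (volume : Measure UnitAddCircle)) ≠
      (swapInv (rotation α) (arc β) : Aut (volume : Measure UnitAddCircle)) *
        (rotation α : Aut (volume : Measure UnitAddCircle)) := by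
  intro h
  rw [← QuotientGroup.mk_mul, ← QuotientGroup.mk_mul, aut_mk_eq_iff] at h
  have h2 : ∀ᵐ x, x ∉ arc β := by
    filter_upwards [h] with x hx hxA
    change (rotation α).1 ((swapInv (rotation α) (arc β)).1 x) =
      (swapInv (rotation α) (arc β)).1 ((rotation α).1 x) at hx
    have hS : Swappable (rotation α) (arc β) := ⟨measurableSet_arc β, hd⟩
    rw [swapInv_apply_mem hS hxA, swapInv_apply_image hS hxA] at hx
    have := isFree_rotation hα x 2 (by rw [zpow_two]; exact hx)
    omega
  exact (measure_arc_pos hβ).ne' (by simpa [ae_iff] using h2)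

end Generation

/-! ### Topological rank -/

/-- If the powers of one element are dense in an `L¹` full group, then bounded elements commute. -/
theorem mul_comm_of_dense_zpowers {X : Type*} [MeasurableSpace X] {μ : Measure X}
    [MeasurableEq X] {T a b : mpPerm μ} {M N : ℕ} (ha : StepBounded T a M)
    (hb : StepBounded T b N) (ha1 : (a : Aut μ) ∈ l1FullGroup T) (hb1 : (b : Aut μ) ∈ l1FullGroup T)
    (g : l1FullGroup T) (hg : Dense (Subgroup.zpowers g : Set (l1FullGroup T))) :
    (a : Aut μ) * (b : Aut μ) = (b : Aut μ) * (a : Aut μ) := by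
  have approx : ∀ (s : Aut μ), s ∈ l1FullGroup T → ∀ δ : ℝ≥0∞, 0 < δ →
      ∃ n : ℤ, l1Dist T s (g.1 ^ n) < δ := by
    intro s hs δ hδ
    obtain ⟨y, ⟨n, rfl⟩, hy⟩ := EMetric.mem_closure_iff.1 (hg ⟨s, hs⟩) δ hδ
    exact ⟨n, hy⟩
  -- If powers `g ^ m`, `g ^ n` approximate `a`, `b`, then both products `ab` and `ba` are close to
  -- the same power `g ^ (m + n)`.
  have key : ∀ {a : mpPerm μ} {M : ℕ} (b : Aut μ), StepBounded T a M → ∀ m n : ℤ,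
      l1Dist T ((a : Aut μ) * b) (g.1 ^ (m + n)) ≤
        (2 * M + 1 : ℕ) * l1Dist T b (g.1 ^ n) + l1Dist T (a : Aut μ) (g.1 ^ m) := by
    intro a M b ha m n
    refine (l1Dist_triangle T _ ((a : Aut μ) * g.1 ^ n) _).trans ?_
    rw [zpow_add, l1Dist_mul_right]
    exact add_le_add (l1Dist_mul_left_le ha _ _) le_rfl
  refine eq_of_l1Dist_eq_zero T (le_antisymm (le_of_forall_gt fun ε hε => ?_) zero_le)
  -- The sum of the four coefficients in the two instances of `key`.
  set C : ℕ := 2 * M + 1 + (2 * N + 1) + 2 with hC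
  have hδ : 0 < ε / C := ENNReal.div_pos hε.ne' (ENNReal.natCast_ne_top _)
  obtain ⟨m, hm⟩ := approx _ ha1 _ hδ
  obtain ⟨n, hn⟩ := approx _ hb1 _ hδ
  -- For infinite `ε` it is enough that the distance is finite, which holds as both products lie in
  -- the L¹ full group.
  by_cases hεt : ε = ⊤
  · rw [hεt] at hε ⊢
    rw [lt_top_iff_ne_top]
    exact fun h => by
      have h1 := mul_mem ha1 hb1
      have h2 := mul_mem hb1 ha1
      have h3 := (l1Dist_triangle T ((a : Aut μ) * (b : Aut μ)) 1 ((b : Aut μ) * (a : Aut μ)))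
      rw [h, l1Dist_comm] at h3
      exact (ENNReal.add_lt_top.2 ⟨h1.2, h2.2⟩).ne (top_le_iff.1 h3)
  have hC0 : (C : ℝ≥0∞) ≠ 0 := by simp [hC]
  have hlt : (C : ℝ≥0∞) * max (l1Dist T (a : Aut μ) (g.1 ^ m)) (l1Dist T (b : Aut μ) (g.1 ^ n)) <
      ε := by
    rw [mul_comm]
    exact ENNReal.mul_lt_of_lt_div (max_lt hm hn)
  refine lt_of_le_of_lt ?_ hlt
  refine (l1Dist_triangle T _ (g.1 ^ (m + n)) _).trans ?_
  rw [l1Dist_comm T (g.1 ^ (m + n))]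
  have k1 := key (b : Aut μ) ha m n
  have k2 := key (a : Aut μ) hb n m
  rw [add_comm n m] at k2
  calc _ ≤ _ := add_le_add k1 k2
    _ ≤ (2 * M + 1 : ℕ) * max (l1Dist T (a : Aut μ) (g.1 ^ m)) (l1Dist T (b : Aut μ) (g.1 ^ n)) +
        max (l1Dist T (a : Aut μ) (g.1 ^ m)) (l1Dist T (b : Aut μ) (g.1 ^ n)) +
        ((2 * N + 1 : ℕ) * max (l1Dist T (a : Aut μ) (g.1 ^ m)) (l1Dist T (b : Aut μ) (g.1 ^ n)) +
        max (l1Dist T (a : Aut μ) (g.1 ^ m)) (l1Dist T (b : Aut μ) (g.1 ^ n))) := by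
        gcongr
        · exact le_max_right _ _
        · exact le_max_left _ _
        · exact le_max_left _ _
        · exact le_max_right _ _
    _ = _ := by rw [hC]; push_cast; ring

/-- For the upper bound any irrational `β` below both `α` and `1 - α` serves. A dense subgroup
generated by at most one element would have dense powers and make `T` commute with the involution of
`[0,β[`. -/
theorem topologicalRank_rotation {α : ℝ} (hα : Irrational α) (h0 : 0 ≤ α) (h1 : α < 1) :
    topologicalRank (l1FullGroup (rotation α)) = 2 := by
  have hpos : 0 < α := lt_of_le_of_ne h0 fun h => hα ⟨0, by rw [← h]; simp⟩
  obtain ⟨β, -, hβ0, hβ⟩ := exists_irrational_btwn (lt_min hpos (sub_pos.2 h1))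
  have hβα := hβ.trans_le (min_le_left _ _)
  have hd := disjoint_arc h1 hβ0 hβα.le (hβ.trans_le (min_le_right _ _)).le
  refine le_antisymm ?_ (le_iInf₂ fun s hs => ?_)
  · refine iInf₂_le_of_le _ (dense_closure hα h1 hβ0 hβα hd) ((Set.encard_insert_le _ _).trans ?_)
    rw [Set.encard_singleton, one_add_one_eq_two]
  · by_contra hlt
    rw [not_le] at hlt
    have hle : s.encard ≤ 1 := by
      have : s.encard + 1 ≤ 2 := Order.add_one_le_of_lt hlt
      exact (ENat.add_le_add_iff_right (by simp)).1 (this.trans_eq one_add_one_eq_two.symm)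
    rw [Set.encard_le_one_iff] at hle
    obtain ⟨g, hg⟩ : ∃ g, s ⊆ {g} := by
      rcases s.eq_empty_or_nonempty with rfl | ⟨g, hg⟩
      · exact ⟨1, Set.empty_subset _⟩
      · exact ⟨g, fun x hx => hle x g hx hg⟩
    have hdense : Dense (Subgroup.zpowers g : Set (l1FullGroup (rotation α))) := by
      refine hs.mono ?_
      rw [Subgroup.zpowers_eq_closure]
      exact Subgroup.closure_mono hg
    refine not_commute_involution hα hβ0 hd (mul_comm_of_dense_zpowers (StepBounded.self _)
      (swapInv_stepBounded _ _) (l1Self (rotation α)).2 ?_ g hdense)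
    rw [swapInv_eq_involution hd]
    exact (l1Involution (rotation α) (arc β) (measurableSet_arc β) hd).2

end L1Full

end

theorem mainTheorem12 (α : ℝ) (hα : Irrational α) (hα01 : α ∈ Set.Ico (0 : ℝ) 1) :
    (∀ (β : ℝ), Irrational β → β ∈ Set.Ioo 0 α →
      ∀ hd : Disjoint (L1Full.arc β) ((L1Full.rotation α).1 '' L1Full.arc β),
        orderOf (L1Full.l1Involution (L1Full.rotation α) (L1Full.arc β)
          (L1Full.measurableSet_arc β) hd) = 2 ∧
        Dense (Subgroup.closure
          {L1Full.l1Self (L1Full.rotation α),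
            L1Full.l1Involution (L1Full.rotation α) (L1Full.arc β)
              (L1Full.measurableSet_arc β) hd} :
          Set (L1Full.l1FullGroup (L1Full.rotation α)))) ∧
    L1Full.topologicalRank (L1Full.l1FullGroup (L1Full.rotation α)) = 2 :=
  ⟨fun _ _ hβ hd => ⟨L1Full.orderOf_involution hα hβ.1 hd,
    L1Full.dense_closure hα hα01.2 hβ.1 hβ.2 hd⟩,
    L1Full.topologicalRank_rotation hα hα01.1 hα01.2⟩
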